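/- Let $\lambda\in(0,\infty)$ and $\beta\in(-1,1)$. Let $\alpha$ be a random variable with values in $(0,1)$ having a probability density of the form $\psi(x)(1-x)^\beta$, $x\in(0,1)$, where $\psi\ge 0$ satisfies $\lim_{x\uparrow1}\psi(x)=\psi_1\in(0,\infty)$. Let $X_0$, $\xi_{k,i}$, $\varepsilon_k$ ($k,i\in\mathbb N$) be random variables that are conditionally independent given $\alpha$ and such that, given $\alpha$, $\xi_{k,i}$ is Bernoulli distributed with mean $\alpha$, $\varepsilon_k$ is Poisson distributed with mean $\lambda$, and $X_0$ is Poisson distributed with mean $\lambda/(1-\alpha)$. Let $(X_k)_{k\ge0}$ be the randomized INAR(1) process $$X_k=\sum_{i=1}^{X_{k-1}}\xi_{k,i}+\varepsilon_k,\qquad k\in\mathbb N .$$ Let $(\alpha^{(j)},(X^{(j)}_k)_{k\ge0})$, $j\in\mathbb N$, be independent copies of $(\alpha,(X_k)_{k\ge0})$, and for $N,n\in\mathbb N$, $t\ge0$ put $$\widetilde S^{(N,n)}_t=\sum_{j=1}^N\sum_{k=1}^{\lfloor nt\rfloor}\bigl(X^{(j)}_k-\mathbb E(X^{(j)}_k\mid\alpha^{(j)})\bigr),$$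 where the conditional expectations of the nonnegative variables $X_k^{(j)}$ are taken in the generalized sense (integrability is not required). Put $$k_\beta=\frac{(2\lambda)^{\frac{1+\beta}2}\,\psi_1}{1+\beta}\,\Gamma\Bigl(\frac{1-\beta}2\Bigr).$$ Then there is a probability law on $(0,\infty)$ with Laplace transform $\theta\mapsto e^{-k_\beta\theta^{(1+\beta)/2}}$, $\theta\ge0$. Let $Y_{(1+\beta)/2}$ be any random variable with this law, and let $(B_t)_{t\ge0}$ be a standard Wiener process independent of $Y_{(1+\beta)/2}$. Then $$\mathcal D_f\text{-}\lim_{N\to\infty}\ \mathcal D_f\text{-}\lim_{n\to\infty}\ N^{-\frac1{1+\beta}}\,n^{-\frac12}\,\widetilde S^{(N,n)}=\mathcal Y_{1+\beta},\qquad \mathcal Y_{1+\beta}(t)=\sqrt{Y_{(1+\beta)/2}}\;B_t,$$ where $\mathcal D_f$-$\lim$ denotes weak convergence of all finite dimensional distributions, first as $n\to\infty$ for each fixed $N$ (to some limit process depending on $N$), and then as $N\to\infty$. Moreover, $Y_{(1+\beta)/2}$ is strictly $\frac{1+\beta}2$-stable with characteristic function $$\mathbb E\bigl(e^{i\theta Y_{(1+\beta)/2}}\bigr)=\exp\Bigl\{-k_\beta|\theta|^{\frac{1+\beta}2}e^{-i\,\mathrm{sign}(\theta)\frac{\pi(1+\beta)}4}\Bigr\},\qquad\theta\in\mathbb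 R,$$ and $\mathcal Y_{1+\beta}$ is a $(1+\beta)$-stable process (all its finite dimensional distributions are strictly $(1+\beta)$-stable) with stationary increments, starting from $0$ and with continuous paths almost surely. -/

import Mathlib

open MeasureTheory ProbabilityTheory Filter Topology
open scoped NNReal ENNReal

namespace RandomizedINAR

/-- The Poisson probability `P(Z = m)`, `Z` Poisson distributed with mean `r`. -/
noncomputable def poissonWeight (r : ℝ) (m : ℕ) : ℝ :=
  Real.exp (-r) * r ^ m / (m.factorial : ℝ)

/-- The Bernoulli probability of the outcome `x ∈ {0, 1}` with success probability `a`. -/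
noncomputable def bernoulliWeight (a : ℝ) (x : ℕ) : ℝ :=
  if x = 1 then a else 1 - a

/-- The conditional probability, given that the thinning parameter equals `a`, that the initial
value is `x₀`, the innovations with indices `1, …, n` are `l k`, and the offspring variables with
indices in `{1, …, n} × {1, …, n}` are `x k i`. -/
noncomputable def condWeight (lam a : ℝ) (n : ℕ) (x₀ : ℕ) (l : ℕ → ℕ) (x : ℕ → ℕ → ℕ) : ℝ :=
  poissonWeight (lam / (1 - a)) x₀
    * (∏ k ∈ Finset.Icc 1 n, poissonWeight lam (l k))
    * ∏ k ∈ Finset.Icc 1 n, ∏ i ∈ Finset.Icc 1 n, bernoulliWeight a (x k i)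

/-- `(X k)_{k ≥ 0}` is the randomized INAR(1) sequence with Poisson(`lam`) innovations driven by
the random thinning parameter `α`, the offspring variables `ξ k i` and the innovations `ε k`
(`k, i ≥ 1`).  The field `joint` says that, given `α`, the variables `X 0`, `ξ k i`, `ε k` are
conditionally independent, `ξ k i` being Bernoulli(`α`), `ε k` Poisson(`lam`) and `X 0`
Poisson(`lam / (1 - α)`) distributed. -/
structure IsRandomizedINAR1 {Ω : Type*} [MeasurableSpace Ω] (lam : ℝ) (α : Ω → ℝ)
    (X : ℕ → Ω → ℕ) (ξ : ℕ → ℕ → Ω → ℕ) (ε : ℕ → Ω → ℕ) (P : Measure Ω) : Prop where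
  measurable_param : Measurable α
  measurable_init : Measurable (X 0)
  measurable_offspring : ∀ k i, Measurable (ξ k i)
  measurable_innovation : ∀ k, Measurable (ε k)
  param_mem : ∀ᵐ ω ∂P, α ω ∈ Set.Ioo (0 : ℝ) 1
  joint : ∀ (n : ℕ) (S : Set ℝ) (x₀ : ℕ) (l : ℕ → ℕ) (x : ℕ → ℕ → ℕ), MeasurableSet S →
    (∀ k i, x k i = 0 ∨ x k i = 1) →
    P {ω | α ω ∈ S ∧ X 0 ω = x₀ ∧ (∀ k ∈ Finset.Icc 1 n, ε k ω = l k) ∧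
        ∀ k ∈ Finset.Icc 1 n, ∀ i ∈ Finset.Icc 1 n, ξ k i ω = x k i}
      = ∫⁻ a in S, ENNReal.ofReal (condWeight lam a n x₀ l x) ∂(P.map α)
  recursion : ∀ k ω, X (k + 1) ω = ∑ i ∈ Finset.Icc 1 (X k ω), ξ (k + 1) i ω + ε (k + 1) ω

/-- The mixing distribution: the law of `α` is absolutely continuous on `(0, 1)` with density
`ψ x * (1 - x) ^ β`, where `ψ ≥ 0` and `ψ x → ψ₁ ∈ (0, ∞)` as `x ↑ 1`. -/
structure HasMixingDensity {Ω : Type*} [MeasurableSpace Ω] (α : Ω → ℝ) (P : Measure Ω)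
    (ψ : ℝ → ℝ) (β ψ₁ : ℝ) : Prop where
  aemeasurable : AEMeasurable ψ (volume.restrict (Set.Ioo (0 : ℝ) 1))
  nonneg : ∀ x ∈ Set.Ioo (0 : ℝ) 1, 0 ≤ ψ x
  law : P.map α = (volume.restrict (Set.Ioo (0 : ℝ) 1)).withDensity
    (fun x => ENNReal.ofReal (ψ x * (1 - x) ^ β))
  limit_pos : 0 < ψ₁
  tendsto : Tendsto ψ (𝓝[<] 1) (𝓝 ψ₁)

/-- A version of the conditional expectation `E(Z | α)` of a nonnegative integer valued random
variable, in the generalized sense: `Z` need not be integrable. -/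
noncomputable def condMean {Ω : Type*} [MeasurableSpace Ω] (P : Measure Ω) (α : Ω → ℝ)
    (Z : Ω → ℕ) (ω : Ω) : ℝ :=
  (condLExp (MeasurableSpace.comap α inferInstance) P (fun ω' => (Z ω' : ℝ≥0∞)) ω).toReal

/-- The doubly aggregated process
`∑_{j ≤ N} ∑_{k = 1}^{⌊n t⌋} (X_k^{(j)} - E(X_k^{(j)} | α^{(j)}))`.
The copies are numbered from `0`, so the first `N` of them are those with `j < N`. -/
noncomputable def aggregate {Ω : Type*} [MeasurableSpace Ω] (P : Measure Ω) (α : ℕ → Ω → ℝ)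
    (X : ℕ → ℕ → Ω → ℕ) (N n : ℕ) (t : ℝ≥0) (ω : Ω) : ℝ :=
  ∑ j ∈ Finset.range N, ∑ k ∈ Finset.Icc 1 ⌊(n : ℝ) * (t : ℝ)⌋₊,
    ((X j k ω : ℝ) - condMean P (α j) (X j k) ω)

/-- Weak convergence of the finite dimensional distributions of `Y i` to those of `Z`. -/
def TendstoFDD {ι T : Type*} {Ω : ι → Type*} [∀ i, MeasurableSpace (Ω i)] {Ω' : Type*}
    [MeasurableSpace Ω'] (Y : (i : ι) → T → Ω i → ℝ) (F : Filter ι) (Z : T → Ω' → ℝ)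
    (P : (i : ι) → Measure (Ω i)) [∀ i, IsProbabilityMeasure (P i)]
    (P' : Measure Ω') [IsProbabilityMeasure P'] : Prop :=
  ∀ I : Finset T, TendstoInDistribution (fun i ω => I.restrict (fun t => Y i t ω)) F
    (fun ω => I.restrict (fun t => Z t ω)) P P'

/-- The iterated limit `lim_{N → ∞} lim_{n → ∞} S N n = Z` in the sense of finite dimensional
distributions: for every `N ≥ 1` the processes `S N n` converge, as `n → ∞`, to a process
with law `μ N` on path space, and these converge to `Z` as `N → ∞`. -/
def IteratedLimitFDD {Ω Ω' : Type*} [MeasurableSpace Ω] [MeasurableSpace Ω']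
    (S : ℕ → ℕ → ℝ≥0 → Ω → ℝ) (P : Measure Ω) [IsProbabilityMeasure P]
    (Z : ℝ≥0 → Ω' → ℝ) (P' : Measure Ω') [IsProbabilityMeasure P'] : Prop :=
  ∃ μ : ℕ → ProbabilityMeasure (ℝ≥0 → ℝ),
    (∀ N, 0 < N → TendstoFDD (S N) atTop (fun t (f : ℝ≥0 → ℝ) => f t)
      (fun _ => P) (μ N : Measure (ℝ≥0 → ℝ))) ∧
    TendstoFDD (fun _ t (f : ℝ≥0 → ℝ) => f t) atTop Z
      (fun N => (μ N : Measure (ℝ≥0 → ℝ))) P'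

/-- A law is strictly `a`-stable if, for independent `ζ₁, ζ₂` having this law and `c, d > 0`, the
variable `c ζ₁ + d ζ₂` has the law of `(c ^ a + d ^ a) ^ (1 / a) ζ₁`. -/
def IsStrictlyStable {E : Type*} [AddCommGroup E] [Module ℝ E] [MeasurableSpace E]
    (a : ℝ) (μ : Measure E) : Prop :=
  ∀ c d : ℝ, 0 < c → 0 < d →
    Measure.conv (μ.map (fun x => c • x)) (μ.map (fun x => d • x))
      = μ.map (fun x => ((c ^ a + d ^ a) ^ (1 / a) : ℝ) • x)

/-- All finite dimensional distributions of the process are strictly `a`-stable. -/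
def HasStableFDD {Ω T : Type*} [MeasurableSpace Ω] (a : ℝ) (Z : T → Ω → ℝ)
    (P : Measure Ω) : Prop :=
  ∀ I : Finset T, IsStrictlyStable a (P.map (fun ω => I.restrict (fun t => Z t ω)))

/-- For every `s`, the processes `Z (s + ·) - Z s` and `Z - Z 0` have the same finite dimensional
distributions. -/
def HasStationaryIncrements {Ω : Type*} [MeasurableSpace Ω] (Z : ℝ≥0 → Ω → ℝ)
    (P : Measure Ω) : Prop :=
  ∀ (s : ℝ≥0) (I : Finset ℝ≥0),
    IdentDistrib (fun ω => I.restrict (fun t => Z (s + t) ω - Z s ω))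
      (fun ω => I.restrict (fun t => Z t ω - Z 0 ω)) P P

/-- The constant `k_β`. -/
noncomputable def stableConst (lam β ψ₁ : ℝ) : ℝ :=
  (2 * lam) ^ ((1 + β) / 2) * ψ₁ / (1 + β) * Real.Gamma ((1 - β) / 2)

/-- `ν` is the law of a positive random variable with Laplace transform
`exp (-κ θ ^ a)`, `θ ≥ 0`. -/
structure IsPositiveStableLaw (a κ : ℝ) (ν : Measure ℝ) : Prop where
  isProbabilityMeasure : IsProbabilityMeasure ν
  pos : ∀ᵐ y ∂ν, 0 < y
  laplace : ∀ θ : ℝ, 0 ≤ θ → ∫ y, Real.exp (-(θ * y)) ∂ν = Real.exp (-(κ * θ ^ a))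

end RandomizedINAR

namespace RandomizedINAR

/-! ### The backward recursion of the generating function -/

/-! Given `α = a`, the joint generating function of the path is explicit. Absorbing the generations
one at a time, starting from the last, gives `exp (lam * (v 0 / (1 - a) + ∑ v (k + 1)))`, where `v`
solves the backward recursion `v k = z k * (1 + a * v (k + 1)) - 1` with terminal value `0`
(`integral_prod_pow_inarPath`). For a linear combination of partial sums, `z k = exp (i u k / √n)`
with `u` a step function of bounded variation. Expanding to second order and summing by parts
(`exists_log_generating_expansion`) shows that, once the linear term is cancelled by the centring,
only the quadratic term survives. Hence, conditionally on `a`, the partial sums converge to a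
Brownian motion with variance `W(a) = lam (1 + a) / (1 - a)²` (`longRunVariance`). The abstract
hypotheses enter through `condDistrib_modelNoise`, which identifies the conditional law of the
noise, and `condMean_ae_eq`, which identifies the centring as `lam / (1 - α)`.

By independence the `n`-limit for `N` rescaled copies is `√V_N B`, where `V_N = N^(-2/(1+β)) ∑
W(α_j)` is independent of `B`. Its characteristic function at `θ` is the Laplace transform of `V_N`
at `Q(θ)/2`, with `Q` the covariance form of Brownian motion, so the `N`-limit reduces to Laplace
transforms of sums of i.i.d. heavy-tailed variables. The substitution `x = 1 - ε u` near the
critical value gives `1 - E exp (-ε² W) ~ k_β ε^(1+β)` (`tendsto_one_sub_laplace`), whence `E exp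
(-s V_N) → exp (-k_β s^((1+β)/2))`.

The same limit produces the positive stable law, by tightness (`exists_measure_of_tendsto_laplace`).
Its characteristic function follows by analytic continuation of the Laplace transform to the
imaginary axis, and stability is homogeneity of the exponents. Stationarity of increments is
inherited from `B`, since shifted increments remain independent of `Y`. -/

lemma norm_exp_I_mul_sub_one_le (x : ℝ) : ‖Complex.exp (Complex.I * x) - 1‖ ≤ |x| := by
  simpa using Real.norm_exp_I_mul_ofReal_sub_one_le (x := x)

lemma norm_exp_I_mul_sub_linear_le {x : ℝ} (hx : |x| ≤ 1) :
    ‖Complex.exp (Complex.I * x) - 1 - Complex.I * x‖ ≤ |x| ^ 2 := by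
  have h := Complex.norm_exp_sub_one_sub_id_le (x := Complex.I * x) (by simpa using hx)
  simpa using h

lemma norm_exp_I_mul_sub_quadratic_le {x : ℝ} (hx : |x| ≤ 1) :
    ‖Complex.exp (Complex.I * x) - 1 - Complex.I * x + x ^ 2 / 2‖ ≤ |x| ^ 3 := by
  have h := Complex.exp_bound (x := Complex.I * x) (by simpa using hx) (n := 3) (by norm_num)
  have e : ∑ m ∈ Finset.range 3, (Complex.I * x) ^ m / (m.factorial : ℂ)
      = 1 + Complex.I * x - x ^ 2 / 2 := by
    simp [Finset.sum_range_succ, mul_pow, Nat.factorial]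
    ring
  rw [e] at h
  have h3 : 0 ≤ |x| ^ 3 := by positivity
  calc _ = ‖Complex.exp (Complex.I * x) - (1 + Complex.I * x - x ^ 2 / 2)‖ := by ring_nf
    _ ≤ _ := h
    _ ≤ |x| ^ 3 := by
      norm_num [Nat.factorial]
      linarith

/-- One step gives `‖v k‖ ≤ c + a * ‖v (k + 1)‖`, and `c / (1 - a)` is the fixed point of this
bound, so it propagates downwards from the terminal value. -/
lemma norm_backward_recursion_le {a c : ℝ} (ha : 0 < a) (ha1 : a < 1) (hc : 0 ≤ c) {m : ℕ}
    {z v : ℕ → ℂ} (hz1 : ∀ k, ‖z k‖ = 1) (hz : ∀ k, ‖z k - 1‖ ≤ c) (hvm : v (m + 1) = 0)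
    (hv : ∀ k ≤ m, v k = z k * (1 + a * v (k + 1)) - 1) {k : ℕ} (hk : k ≤ m + 1) :
    ‖v k‖ ≤ c / (1 - a) := by
  have h1a : 0 < 1 - a := by linarith
  induction hk using Nat.decreasingInduction with
  | self => rw [hvm, norm_zero]; positivity
  | of_succ j hj ih =>
    rw [hv j (by omega)]
    calc ‖z j * (1 + a * v (j + 1)) - 1‖ = ‖(z j - 1) + z j * (a * v (j + 1))‖ := by ring_nf
      _ ≤ ‖z j - 1‖ + ‖z j * (a * v (j + 1))‖ := norm_add_le _ _
      _ = ‖z j - 1‖ + a * ‖v (j + 1)‖ := by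
        rw [norm_mul, norm_mul, hz1, Complex.norm_real, Real.norm_of_nonneg ha.le, one_mul]
      _ ≤ c + a * (c / (1 - a)) := by gcongr; exact hz j
      _ = c / (1 - a) := by field_simp; ring

/-- The left side is the logarithm of the generating function divided by `lam`. Summing the
recursion over `k` produces precisely this combination: the stationary initial mean `lam / (1 - a)`
matches the boundary term at `0`. -/
lemma sum_backward_recursion {a : ℝ} (ha1 : a < 1) {m : ℕ} {z v : ℕ → ℂ} (hvm : v (m + 1) = 0)
    (hv : ∀ k ≤ m, v k = z k * (1 + a * v (k + 1)) - 1) :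
    v 0 / (1 - a) + ∑ k ∈ Finset.range m, v (k + 1)
      = (∑ k ∈ Finset.range (m + 1), (z k - 1)
          + a * ∑ k ∈ Finset.range (m + 1), (z k - 1) * v (k + 1)) / (1 - a) := by
  have h1a : (1 - a : ℂ) ≠ 0 := by
    norm_cast; linarith
  have h1 : ∑ k ∈ Finset.range (m + 1), v k
      = ∑ k ∈ Finset.range (m + 1), ((z k - 1) + a * ((z k - 1) * v (k + 1)) + a * v (k + 1)) :=
    Finset.sum_congr rfl fun k hk => by
      rw [hv k (by simpa [Nat.lt_succ_iff] using hk)]; ring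
  rw [Finset.sum_add_distrib, Finset.sum_add_distrib, ← Finset.mul_sum, ← Finset.mul_sum,
    Finset.sum_range_succ' v, Finset.sum_range_succ (fun k => v (k + 1)), hvm, add_zero] at h1
  rw [eq_div_iff h1a, add_mul, div_mul_cancel₀ _ h1a]
  linear_combination h1

/-- Summation by parts; both boundary terms vanish because `u 0 = 0` and `v (m + 1) = 0`. It
extracts the leading part of `∑ u k * v (k + 1)`, leaving an error governed by the variation of `u`.
-/
lemma sum_mul_backward_recursion {a : ℝ} {m : ℕ} {z v : ℕ → ℂ} {u : ℕ → ℝ} (hu0 : u 0 = 0)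
    (hvm : v (m + 1) = 0) (hv : ∀ k ≤ m, v k = z k * (1 + a * v (k + 1)) - 1) :
    (1 - a) * ∑ k ∈ Finset.range (m + 1), (u k : ℂ) * v (k + 1)
      = ∑ k ∈ Finset.range (m + 1), (u k : ℂ) * ((z k - 1) * (1 + a * v (k + 1)))
        + ∑ k ∈ Finset.range (m + 1), ((u k - u (k + 1) : ℝ) : ℂ) * v (k + 1) := by
  have h1 : ∑ k ∈ Finset.range (m + 1), (u k : ℂ) * v k
      = ∑ k ∈ Finset.range (m + 1), ((u k : ℂ) * ((z k - 1) * (1 + a * v (k + 1)))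
          + a * ((u k : ℂ) * v (k + 1))) :=
    Finset.sum_congr rfl fun k hk => by
      rw [hv k (by simpa [Nat.lt_succ_iff] using hk)]; ring
  have h2 : ∑ k ∈ Finset.range (m + 1), (u k : ℂ) * v k
      = ∑ k ∈ Finset.range (m + 1), (u (k + 1) : ℂ) * v (k + 1) := by
    rw [Finset.sum_range_succ' (fun k => (u k : ℂ) * v k),
      Finset.sum_range_succ (fun k => (u (k + 1) : ℂ) * v (k + 1)), hvm, hu0]
    simp
  have h3 : ∑ k ∈ Finset.range (m + 1), ((u k - u (k + 1) : ℝ) : ℂ) * v (k + 1)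
      = ∑ k ∈ Finset.range (m + 1), (u k : ℂ) * v (k + 1)
        - ∑ k ∈ Finset.range (m + 1), (u (k + 1) : ℂ) * v (k + 1) := by
    rw [← Finset.sum_sub_distrib]
    exact Finset.sum_congr rfl fun k _ => by push_cast; ring
  rw [Finset.sum_add_distrib, ← Finset.mul_sum, h2] at h1
  rw [h3]
  linear_combination h1

lemma norm_sum_range_le_mul {m : ℕ} {f : ℕ → ℂ} {c : ℝ}
    (h : ∀ k ∈ Finset.range (m + 1), ‖f k‖ ≤ c) :
    ‖∑ k ∈ Finset.range (m + 1), f k‖ ≤ (m + 1) * c := by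
  refine (norm_sum_le_of_le _ h).trans_eq ?_
  simp

/-- Second order expansion of the logarithm of the joint generating function of an INAR(1)
sequence with Poisson innovations. -/
lemma exists_log_generating_expansion {a C T V : ℝ} (ha : 0 < a) (ha1 : a < 1) (hC : 0 ≤ C) :
    ∃ K : ℝ, ∀ (m : ℕ) (δ : ℝ) (u : ℕ → ℝ) (v : ℕ → ℂ), 0 < δ → δ ≤ 1 → C * δ ≤ 1 → u 0 = 0 →
      (∀ k, |u k| ≤ C) → (m + 1) * δ ^ 2 ≤ T →
      ∑ k ∈ Finset.range (m + 1), |u k - u (k + 1)| ≤ V → v (m + 1) = 0 →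
      (∀ k ≤ m, v k = Complex.exp (Complex.I * (δ * u k : ℝ)) * (1 + a * v (k + 1)) - 1) →
      ‖v 0 / (1 - a) + ∑ k ∈ Finset.range m, v (k + 1)
          - Complex.I * ((δ * ∑ k ∈ Finset.range (m + 1), u k : ℝ) : ℂ) / (1 - a)
          + ((1 + a) / (1 - a) ^ 2 / 2 * (δ ^ 2 * ∑ k ∈ Finset.range (m + 1), u k ^ 2) : ℝ)‖
        ≤ K * δ := by
  have h1a : 0 < 1 - a := by linarith
  have h1a' : (1 - a : ℂ) ≠ 0 := by
    norm_cast; linarith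
  -- The constant collects the bounds for the remainders `E3`, `E2`, `F1`, `F2`, `F3` in the order
  -- in which they enter `key`.
  refine ⟨(T * C ^ 3 + a * (T * C ^ 3 / (1 - a))
    + a / (1 - a) * (T * C ^ 3 + a * (T * C ^ 3 / (1 - a)) + V * C / (1 - a))) / (1 - a), ?_⟩
  intro m δ u v hδ hδ1 hCδ hu0 huC hmT hV hvm hv
  obtain ⟨z, hz⟩ : ∃ z : ℕ → ℂ, ∀ k, z k = Complex.exp (Complex.I * (δ * u k : ℝ)) :=
    ⟨_, fun _ => rfl⟩
  simp only [← hz] at hv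
  have hx : ∀ k, |δ * u k| ≤ C * δ := fun k => by
    rw [abs_mul, abs_of_pos hδ, mul_comm]
    exact mul_le_mul_of_nonneg_right (huC k) hδ.le
  have hz1 : ∀ k, ‖z k‖ = 1 := fun k => by
    rw [hz, mul_comm]; exact Complex.norm_exp_ofReal_mul_I _
  have he1 : ∀ k, ‖z k - 1‖ ≤ C * δ := fun k => by
    rw [hz]; exact (norm_exp_I_mul_sub_one_le _).trans (hx k)
  have he2 : ∀ k, ‖z k - 1 - Complex.I * (δ * u k : ℝ)‖ ≤ (C * δ) ^ 2 := fun k => by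
    rw [hz]; exact (norm_exp_I_mul_sub_linear_le ((hx k).trans hCδ)).trans (by gcongr; exact hx k)
  have he3 : ∀ k, ‖z k - 1 - Complex.I * (δ * u k : ℝ) + (δ * u k : ℝ) ^ 2 / 2‖ ≤ (C * δ) ^ 3 :=
    fun k => by
    rw [hz]
    exact (norm_exp_I_mul_sub_quadratic_le ((hx k).trans hCδ)).trans (by gcongr; exact hx k)
  have hvb : ∀ k ∈ Finset.range (m + 1), ‖v (k + 1)‖ ≤ C * δ / (1 - a) := fun k hk =>
    norm_backward_recursion_le ha ha1 (by positivity) hz1 he1 hvm hv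
      (by simpa [Nat.lt_succ_iff] using hk)
  have hT0 : 0 ≤ T := le_trans (by positivity) hmT
  set R := Finset.range (m + 1) with hR
  set E3 := ∑ k ∈ R, (z k - 1 - Complex.I * (δ * u k : ℝ) + (δ * u k : ℝ) ^ 2 / 2) with hE3
  set E2 := ∑ k ∈ R, (z k - 1 - Complex.I * (δ * u k : ℝ)) * v (k + 1) with hE2
  set F1 := ∑ k ∈ R, (u k : ℂ) * (z k - 1 - Complex.I * (δ * u k : ℝ)) with hF1
  set F2 := ∑ k ∈ R, (u k : ℂ) * ((z k - 1) * v (k + 1)) with hF2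
  set F3 := ∑ k ∈ R, ((u k - u (k + 1) : ℝ) : ℂ) * v (k + 1) with hF3
  -- An exact identity. The quadratic coefficient arises as `1 / (2 (1 - a)) + a / (1 - a)²`: the
  -- first part comes from expanding `z k`, the second from the correlations carried by `v`.
  have key : v 0 / (1 - a) + ∑ k ∈ Finset.range m, v (k + 1)
          - Complex.I * ((δ * ∑ k ∈ R, u k : ℝ) : ℂ) / (1 - a)
          + ((1 + a) / (1 - a) ^ 2 / 2 * (δ ^ 2 * ∑ k ∈ R, u k ^ 2) : ℝ)
      = (E3 + a * E2 + Complex.I * δ * (a / (1 - a)) * (F1 + a * F2 + F3)) / (1 - a) := by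
    have i1 := sum_backward_recursion ha1 hvm hv
    have i2 := sum_mul_backward_recursion hu0 hvm hv
    have i3 : F1 + a * F2 + F3 = (1 - a) * ∑ k ∈ R, (u k : ℂ) * v (k + 1)
        - Complex.I * δ * ∑ k ∈ R, (u k : ℂ) ^ 2 := by
      rw [i2, hF1, hF2, hF3, Finset.mul_sum, Finset.mul_sum, ← Finset.sum_add_distrib,
        ← Finset.sum_add_distrib, ← Finset.sum_add_distrib, ← Finset.sum_sub_distrib]
      exact Finset.sum_congr rfl fun k _ => by push_cast; ring
    have i4 : ∑ k ∈ R, (z k - 1) * v (k + 1)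
        = E2 + Complex.I * δ * ∑ k ∈ R, (u k : ℂ) * v (k + 1) := by
      rw [hE2, Finset.mul_sum, ← Finset.sum_add_distrib]
      exact Finset.sum_congr rfl fun k _ => by push_cast; ring
    have i5 : ∑ k ∈ R, (z k - 1)
        = E3 + Complex.I * (δ * ∑ k ∈ R, (u k : ℂ)) - δ ^ 2 / 2 * ∑ k ∈ R, (u k : ℂ) ^ 2 := by
      rw [hE3, Finset.mul_sum, Finset.mul_sum, Finset.mul_sum, ← Finset.sum_add_distrib,
        ← Finset.sum_sub_distrib]
      exact Finset.sum_congr rfl fun k _ => by push_cast; ring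
    rw [i1, i3, i4, i5]
    push_cast
    field_simp
    ring_nf
    simp only [Complex.I_sq]
    ring
  -- There are of order `δ⁻²` summands, so terms of size `δ³` add up to `O(δ)`.
  have hma : (m + 1 : ℝ) * (C * δ) ^ 3 ≤ T * C ^ 3 * δ := by
    have := mul_le_mul_of_nonneg_right hmT (show 0 ≤ C ^ 3 * δ by positivity)
    nlinarith
  have hmb : (m + 1 : ℝ) * (C * (C * δ) ^ 2) ≤ T * C ^ 3 := by
    have := mul_le_mul_of_nonneg_right hmT (show 0 ≤ C ^ 3 by positivity)
    nlinarith
  have bE3 : ‖E3‖ ≤ T * C ^ 3 * δ := (norm_sum_range_le_mul fun k _ => he3 k).trans hma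
  have bE2 : ‖E2‖ ≤ T * C ^ 3 / (1 - a) * δ := by
    refine (norm_sum_range_le_mul (c := (C * δ) ^ 2 * (C * δ / (1 - a))) fun k hk => ?_).trans ?_
    · rw [norm_mul]
      exact mul_le_mul (he2 k) (hvb k hk) (norm_nonneg _) (by positivity)
    · calc _ = (m + 1 : ℝ) * (C * δ) ^ 3 / (1 - a) := by ring
        _ ≤ T * C ^ 3 * δ / (1 - a) := by gcongr
        _ = _ := by ring
  have bF1 : ‖F1‖ ≤ T * C ^ 3 := by
    refine (norm_sum_range_le_mul (c := C * (C * δ) ^ 2) fun k _ => ?_).trans hmb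
    rw [norm_mul, Complex.norm_real]
    exact mul_le_mul (huC k) (he2 k) (norm_nonneg _) hC
  have bF2 : ‖F2‖ ≤ T * C ^ 3 / (1 - a) := by
    refine (norm_sum_range_le_mul (c := C * (C * δ * (C * δ / (1 - a)))) fun k hk => ?_).trans ?_
    · rw [norm_mul, Complex.norm_real, norm_mul]
      exact mul_le_mul (huC k) (mul_le_mul (he1 k) (hvb k hk) (norm_nonneg _) (by positivity))
        (by positivity) hC
    · calc _ = (m + 1 : ℝ) * (C * (C * δ) ^ 2) / (1 - a) := by ring
        _ ≤ _ := by gcongr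
  -- Here bounded variation of `u` is essential: a term-by-term bound with `m + 1` summands would be
  -- too large.
  have bF3 : ‖F3‖ ≤ V * C / (1 - a) := by
    calc ‖F3‖ ≤ ∑ k ∈ R, |u k - u (k + 1)| * (C * δ / (1 - a)) := by
          refine norm_sum_le_of_le _ fun k hk => ?_
          rw [norm_mul, Complex.norm_real]
          exact mul_le_mul_of_nonneg_left (hvb k hk) (abs_nonneg _)
      _ = (∑ k ∈ R, |u k - u (k + 1)|) * (C * δ / (1 - a)) := by rw [Finset.sum_mul]
      _ ≤ V * (C * 1 / (1 - a)) := by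
        have hV0 : 0 ≤ V := (Finset.sum_nonneg fun k _ => abs_nonneg _).trans hV
        gcongr
      _ = _ := by ring
  rw [key, norm_div]
  have hn : ‖(1 - a : ℂ)‖ = 1 - a := by
    rw [← Complex.ofReal_one, ← Complex.ofReal_sub, Complex.norm_real, Real.norm_of_nonneg h1a.le]
  have hna : ‖(a : ℂ)‖ = a := by rw [Complex.norm_real, Real.norm_of_nonneg ha.le]
  have hnδ : ‖(δ : ℂ)‖ = δ := by rw [Complex.norm_real, Real.norm_of_nonneg hδ.le]
  rw [hn, div_mul_eq_mul_div]
  gcongr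
  calc _ ≤ ‖E3‖ + ‖(a : ℂ) * E2‖ + ‖Complex.I * δ * (a / (1 - a)) * (F1 + a * F2 + F3)‖ :=
        norm_add₃_le
    _ = ‖E3‖ + a * ‖E2‖ + δ * (a / (1 - a)) * ‖F1 + a * F2 + F3‖ := by
        simp only [norm_mul, norm_div, hn, hna, hnδ, Complex.norm_I, one_mul]
    _ ≤ T * C ^ 3 * δ + a * (T * C ^ 3 / (1 - a) * δ)
          + δ * (a / (1 - a)) * (T * C ^ 3 + a * (T * C ^ 3 / (1 - a)) + V * C / (1 - a)) := by
        gcongr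
        refine norm_add₃_le.trans ?_
        rw [norm_mul, hna]
        gcongr
    _ = _ := by ring

/-- The total coefficient of the `k`-th summand in a linear combination, with weights `θ`, of the
partial sums over `{1, …, ⌊n τ⌋}`. -/
noncomputable def stepCoeff {κ : Type*} [Fintype κ] (τ : κ → ℝ≥0) (θ : κ → ℝ) (n k : ℕ) : ℝ :=
  ∑ t, θ t * if k ∈ Finset.Icc 1 ⌊(n : ℝ) * (τ t : ℝ)⌋₊ then 1 else 0

/-- The variance of the linear combination `∑ θ t * B (τ t)` of a Brownian motion `B`. -/
noncomputable def brownianForm {κ : Type*} [Fintype κ] (τ : κ → ℝ≥0) (θ : κ → ℝ) : ℝ :=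
  ∑ s, ∑ t, θ s * θ t * (min (τ s) (τ t) : ℝ≥0)

/-! ### Step coefficients of linear combinations of partial sums -/

section StepCoeff

variable {κ : Type*} [Fintype κ] (τ : κ → ℝ≥0) (θ : κ → ℝ)

lemma stepCoeff_zero (n : ℕ) : stepCoeff τ θ n 0 = 0 := by
  simp [stepCoeff]

lemma abs_stepCoeff_le (n k : ℕ) : |stepCoeff τ θ n k| ≤ ∑ t, |θ t| := by
  refine (Finset.abs_sum_le_sum_abs _ _).trans (Finset.sum_le_sum fun t _ => ?_)
  split_ifs <;> simp

/-- The sum of all times serves as a common horizon; unlike a maximum it needs no nonempty index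
set. -/
lemma Icc_subset_range_floor (n : ℕ) (t : κ) :
    Finset.Icc 1 ⌊(n : ℝ) * (τ t : ℝ)⌋₊
      ⊆ Finset.range (⌊(n : ℝ) * ∑ s, (τ s : ℝ)⌋₊ + 1) := by
  intro k hk
  simp only [Finset.mem_Icc, Finset.mem_range] at hk ⊢
  have : ⌊(n : ℝ) * (τ t : ℝ)⌋₊ ≤ ⌊(n : ℝ) * ∑ s, (τ s : ℝ)⌋₊ := by
    gcongr
    exact Finset.single_le_sum (f := fun s => (τ s : ℝ)) (fun s _ => (τ s).2) (Finset.mem_univ t)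
  omega

lemma sum_stepCoeff_mul (n : ℕ) (f : ℕ → ℝ) :
    ∑ k ∈ Finset.range (⌊(n : ℝ) * ∑ s, (τ s : ℝ)⌋₊ + 1), stepCoeff τ θ n k * f k
      = ∑ t, θ t * ∑ k ∈ Finset.Icc 1 ⌊(n : ℝ) * (τ t : ℝ)⌋₊, f k := by
  simp only [stepCoeff, Finset.sum_mul]
  rw [Finset.sum_comm]
  refine Finset.sum_congr rfl fun t _ => ?_
  simp only [mul_assoc, ← Finset.mul_sum, ite_mul, one_mul, zero_mul]
  rw [Finset.sum_ite_mem, Finset.inter_eq_right.mpr (Icc_subset_range_floor τ n t)]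

/-- The indicator of `{1, …, p}` jumps only after `0` and after `p`. -/
lemma sum_abs_indicator_sub_le (p m : ℕ) :
    ∑ k ∈ Finset.range (m + 1), |(if k ∈ Finset.Icc 1 p then (1 : ℝ) else 0)
      - if k + 1 ∈ Finset.Icc 1 p then 1 else 0| ≤ 2 := by
  have h : ∀ k, |(if k ∈ Finset.Icc 1 p then (1 : ℝ) else 0)
      - if k + 1 ∈ Finset.Icc 1 p then 1 else 0|
      ≤ (if k = 0 then 1 else 0) + if k = p then 1 else 0 := by
    intro k
    simp only [Finset.mem_Icc]
    split_ifs <;> first | omega | norm_num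
  refine (Finset.sum_le_sum fun k _ => h k).trans ?_
  rw [Finset.sum_add_distrib, Finset.sum_ite_eq', Finset.sum_ite_eq']
  split_ifs <;> norm_num

lemma sum_abs_stepCoeff_sub_le (n m : ℕ) :
    ∑ k ∈ Finset.range (m + 1), |stepCoeff τ θ n k - stepCoeff τ θ n (k + 1)|
      ≤ 2 * ∑ t, |θ t| := by
  calc _ ≤ ∑ k ∈ Finset.range (m + 1), ∑ t, |θ t|
        * |(if k ∈ Finset.Icc 1 ⌊(n : ℝ) * (τ t : ℝ)⌋₊ then (1 : ℝ) else 0)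
          - if k + 1 ∈ Finset.Icc 1 ⌊(n : ℝ) * (τ t : ℝ)⌋₊ then 1 else 0| := by
        refine Finset.sum_le_sum fun k _ => ?_
        rw [stepCoeff, stepCoeff, ← Finset.sum_sub_distrib]
        refine (Finset.abs_sum_le_sum_abs _ _).trans_eq (Finset.sum_congr rfl fun t _ => ?_)
        rw [← mul_sub, abs_mul]
    _ ≤ ∑ t, |θ t| * 2 := by
        rw [Finset.sum_comm]
        refine Finset.sum_le_sum fun t _ => ?_
        rw [← Finset.mul_sum]
        gcongr
        exact sum_abs_indicator_sub_le _ _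
    _ = _ := by rw [← Finset.sum_mul, mul_comm]

/-- A product of two indicators is the indicator of the intersection, whose length is the floor at
the smaller time; this is where the Brownian covariance `min` originates. -/
lemma sum_stepCoeff_sq (n : ℕ) :
    ∑ k ∈ Finset.range (⌊(n : ℝ) * ∑ s, (τ s : ℝ)⌋₊ + 1), stepCoeff τ θ n k ^ 2
      = ∑ s, ∑ t, θ s * θ t * ⌊(n : ℝ) * (min (τ s) (τ t) : ℝ≥0)⌋₊ := by
  simp only [sq]
  rw [sum_stepCoeff_mul]
  refine Finset.sum_congr rfl fun s _ => ?_
  simp only [stepCoeff]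
  rw [Finset.sum_comm, Finset.mul_sum]
  refine Finset.sum_congr rfl fun t _ => ?_
  rw [← Finset.mul_sum, Finset.sum_ite_mem, mul_assoc]
  congr 2
  have : Finset.Icc 1 ⌊(n : ℝ) * (τ s : ℝ)⌋₊ ∩ Finset.Icc 1 ⌊(n : ℝ) * (τ t : ℝ)⌋₊
      = Finset.Icc 1 ⌊(n : ℝ) * (min (τ s) (τ t) : ℝ≥0)⌋₊ := by
    have hn : Monotone fun x : ℝ => ⌊(n : ℝ) * x⌋₊ :=
      fun x y h => Nat.floor_mono (mul_le_mul_of_nonneg_left h n.cast_nonneg)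
    have hm := hn.map_min (a := (τ s : ℝ)) (b := (τ t : ℝ))
    rw [NNReal.coe_min]
    rw [hm]
    ext k
    simp only [Finset.mem_inter, Finset.mem_Icc]
    omega
  rw [this]
  simp

lemma tendsto_sum_stepCoeff_sq :
    Tendsto (fun n : ℕ => ((n : ℝ) ^ (-(1 / 2) : ℝ)) ^ 2
      * ∑ k ∈ Finset.range (⌊(n : ℝ) * ∑ s, (τ s : ℝ)⌋₊ + 1), stepCoeff τ θ n k ^ 2) atTop
      (𝓝 (brownianForm τ θ)) := by
  have h : ∀ n : ℕ, ((n : ℝ) ^ (-(1 / 2) : ℝ)) ^ 2 = (n : ℝ)⁻¹ := fun n => by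
    rw [← Real.rpow_natCast, ← Real.rpow_mul n.cast_nonneg]
    norm_num [Real.rpow_neg_one]
  simp_rw [sum_stepCoeff_sq, h, Finset.mul_sum]
  refine tendsto_finsetSum _ fun s _ => tendsto_finsetSum _ fun t _ => ?_
  have := ((tendsto_nat_floor_mul_div_atTop (R := ℝ)
    (a := (min (τ s) (τ t) : ℝ≥0)) (NNReal.coe_nonneg _)).comp
    tendsto_natCast_atTop_atTop).const_mul (θ s * θ t)
  refine this.congr fun n => ?_
  simp only [Function.comp_apply]
  rw [mul_comm (n : ℝ)]
  ring

lemma brownianForm_smul (c : ℝ) : brownianForm τ (fun t => c * θ t) = c ^ 2 * brownianForm τ θ := by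
  simp only [brownianForm, Finset.mul_sum]
  exact Finset.sum_congr rfl fun s _ => Finset.sum_congr rfl fun t _ => by ring

/-- The form is a limit of normalized sums of squares. -/
lemma brownianForm_nonneg : 0 ≤ brownianForm τ θ :=
  ge_of_tendsto' (tendsto_sum_stepCoeff_sq τ θ) fun n => by positivity

end StepCoeff

lemma exists_backward_recursion (a : ℝ) (z : ℕ → ℂ) (m : ℕ) :
    ∃ v : ℕ → ℂ, v (m + 1) = 0 ∧ ∀ k ≤ m, v k = z k * (1 + a * v (k + 1)) - 1 := by
  -- Time is reversed: `f j` is the value at index `m + 1 - j`.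
  let f : ℕ → ℂ := fun j => Nat.rec 0 (fun j y => z (m - j) * (1 + a * y) - 1) j
  refine ⟨fun k => f (m + 1 - k), by simp [f], fun k hk => ?_⟩
  have h1 : m + 1 - k = (m - k) + 1 := by omega
  have h2 : m + 1 - (k + 1) = m - k := by omega
  have h3 : m - (m - k) = k := by omega
  simp only [h1, h2]
  change z (m - (m - k)) * (1 + a * f (m - k)) - 1 = _
  rw [h3]

/-- The logarithm of the characteristic function of a normalized linear combination of centred
partial sums of an INAR(1) sequence converges to that of a Gaussian variable. -/
lemma tendsto_log_generating {κ : Type*} [Fintype κ] (τ : κ → ℝ≥0) (θ : κ → ℝ) {a : ℝ}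
    (ha : 0 < a) (ha1 : a < 1) (v : ℕ → ℕ → ℂ)
    (hvm : ∀ n : ℕ, v n (⌊(n : ℝ) * ∑ s, (τ s : ℝ)⌋₊ + 1) = 0)
    (hv : ∀ n : ℕ, ∀ k ≤ ⌊(n : ℝ) * ∑ s, (τ s : ℝ)⌋₊, v n k
      = Complex.exp (Complex.I * ((n : ℝ) ^ (-(1 / 2) : ℝ) * stepCoeff τ θ n k : ℝ))
        * (1 + a * v n (k + 1)) - 1) :
    Tendsto (fun n : ℕ => v n 0 / (1 - a)
        + ∑ k ∈ Finset.range ⌊(n : ℝ) * ∑ s, (τ s : ℝ)⌋₊, v n (k + 1)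
        - Complex.I * (((n : ℝ) ^ (-(1 / 2) : ℝ)
          * ∑ k ∈ Finset.range (⌊(n : ℝ) * ∑ s, (τ s : ℝ)⌋₊ + 1), stepCoeff τ θ n k : ℝ) : ℂ)
            / (1 - a)) atTop
      (𝓝 (-((1 + a) / (1 - a) ^ 2 / 2 * brownianForm τ θ) : ℝ)) := by
  -- With `δ = n ^ (-1/2)` the normalized number of terms is `(⌊n ∑ τ⌋ + 1) / n ≤ ∑ τ + 1` for `n ≥
  -- 1`, which explains `T`; `V` is the variation bound for step coefficients.
  obtain ⟨K, hK⟩ := exists_log_generating_expansion (a := a) (C := ∑ t, |θ t|)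
    (T := ∑ s, (τ s : ℝ) + 1) (V := 2 * ∑ t, |θ t|) ha ha1
    (Finset.sum_nonneg fun t _ => abs_nonneg _)
  have hδ0 : Tendsto (fun n : ℕ => (n : ℝ) ^ (-(1 / 2) : ℝ)) atTop (𝓝 0) :=
    (tendsto_rpow_neg_atTop (by norm_num)).comp tendsto_natCast_atTop_atTop
  have hsq := (tendsto_sum_stepCoeff_sq τ θ).const_mul ((1 + a) / (1 - a) ^ 2 / 2)
  have hsq' := (Complex.continuous_ofReal.tendsto _).comp hsq
  have hlim : Tendsto (fun n : ℕ => v n 0 / (1 - a)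
        + ∑ k ∈ Finset.range ⌊(n : ℝ) * ∑ s, (τ s : ℝ)⌋₊, v n (k + 1)
        - Complex.I * (((n : ℝ) ^ (-(1 / 2) : ℝ)
          * ∑ k ∈ Finset.range (⌊(n : ℝ) * ∑ s, (τ s : ℝ)⌋₊ + 1), stepCoeff τ θ n k : ℝ) : ℂ)
            / (1 - a)
        + ((1 + a) / (1 - a) ^ 2 / 2 * (((n : ℝ) ^ (-(1 / 2) : ℝ)) ^ 2
          * ∑ k ∈ Finset.range (⌊(n : ℝ) * ∑ s, (τ s : ℝ)⌋₊ + 1), stepCoeff τ θ n k ^ 2) : ℝ))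
      atTop (𝓝 0) := by
    refine squeeze_zero_norm' ?_ (by have := hδ0.const_mul K; rwa [mul_zero] at this)
    have hC : ∀ᶠ n : ℕ in atTop, (∑ t, |θ t|) * (n : ℝ) ^ (-(1 / 2) : ℝ) < 1 := by
      have : Tendsto (fun n : ℕ => (∑ t, |θ t|) * (n : ℝ) ^ (-(1 / 2) : ℝ)) atTop (𝓝 0) := by
        simpa using hδ0.const_mul (∑ t, |θ t|)
      exact this.eventually_lt_const one_pos
    filter_upwards [eventually_ge_atTop 1, hC, hδ0.eventually_lt_const one_pos] with n hn hCn hδn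
    have hn0 : (0 : ℝ) < n := by exact_mod_cast hn
    refine hK _ _ _ _ (Real.rpow_pos_of_pos hn0 _) hδn.le hCn.le (stepCoeff_zero τ θ n)
      (abs_stepCoeff_le τ θ n) ?_ (sum_abs_stepCoeff_sub_le τ θ n _) (hvm n) (hv n)
    have h : ((n : ℝ) ^ (-(1 / 2) : ℝ)) ^ 2 = (n : ℝ)⁻¹ := by
      rw [← Real.rpow_natCast, ← Real.rpow_mul n.cast_nonneg]
      norm_num [Real.rpow_neg_one]
    rw [h, ← div_eq_mul_inv, div_le_iff₀ hn0, add_mul, one_mul, mul_comm _ (n : ℝ)]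
    gcongr
    · exact Nat.floor_le (by positivity)
    · exact_mod_cast hn
  have := hlim.sub hsq'
  simp only [Function.comp_def, add_sub_cancel_right, zero_sub] at this
  convert this using 2
  push_cast
  ring

/-! ### The INAR(1) sequence with a deterministic thinning parameter -/

/-- The INAR(1) sequence driven by the noise `η`: the initial value is `η 0 0`, the innovations
are `η k 0` and the offspring variables are `η k i`, with `k, i ≥ 1`. -/
def inarPath (η : ℕ → ℕ → ℕ) : ℕ → ℕ
  | 0 => η 0 0
  | k + 1 => ∑ i ∈ Finset.Icc 1 (inarPath η k), η (k + 1) i + η (k + 1) 0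

/-- The Bernoulli law on `{0, 1}` with success probability `p`. -/
noncomputable def bernoulliLaw (p : unitInterval) : Measure ℕ :=
  ENNReal.ofReal (1 - p) • Measure.dirac 0 + ENNReal.ofReal p • Measure.dirac 1

instance (p : unitInterval) : IsProbabilityMeasure (bernoulliLaw p) := ⟨by
  simp only [bernoulliLaw, Measure.coe_add, Measure.coe_smul, Pi.add_apply, Pi.smul_apply,
    measure_univ, smul_eq_mul, mul_one]
  rw [← ENNReal.ofReal_add (by linarith [p.2.2]) p.2.1]
  simp⟩

/-- The laws of the noise variables: Poisson(`r`) initial value, Poisson(`l`) innovations and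
Bernoulli(`p`) offspring variables. -/
noncomputable def noiseLaw (r l : ℝ≥0) (p : unitInterval) : ℕ → ℕ → Measure ℕ
  | 0, 0 => poissonMeasure r
  | 0, _ + 1 => Measure.dirac 0
  | _ + 1, 0 => poissonMeasure l
  | _ + 1, _ + 1 => bernoulliLaw p

instance (r l : ℝ≥0) (p : unitInterval) (k i : ℕ) : IsProbabilityMeasure (noiseLaw r l p k i) := by
  cases k <;> cases i <;> simp only [noiseLaw] <;> infer_instance

/-- The law of the independent noise of an INAR(1) sequence. -/
noncomputable def inarLaw (r l : ℝ≥0) (p : unitInterval) : Measure (ℕ → ℕ → ℕ) :=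
  Measure.infinitePi fun k => Measure.infinitePi fun i => noiseLaw r l p k i

instance (r l : ℝ≥0) (p : unitInterval) : IsProbabilityMeasure (inarLaw r l p) := by
  unfold inarLaw; infer_instance

/-- The noise up to generation `m`. -/
def truncateNoise (m : ℕ) (η : ℕ → ℕ → ℕ) : ℕ → ℕ → ℕ := fun k => if k ≤ m then η k else 0

/-- The path up to time `k` uses only the noise of generations up to `k`; this makes the past a
function of finitely many independent rows. -/
lemma inarPath_truncateNoise {m k : ℕ} (hk : k ≤ m) (η : ℕ → ℕ → ℕ) :
    inarPath (truncateNoise m η) k = inarPath η k := by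
  induction k with
  | zero => simp [inarPath, truncateNoise]
  | succ k ih =>
    simp only [inarPath, ih (by omega)]
    simp [truncateNoise, hk]

lemma measurable_truncateNoise (m : ℕ) : Measurable (truncateNoise m) := by
  refine measurable_pi_lambda _ fun k => ?_
  unfold truncateNoise
  split_ifs
  · exact measurable_pi_apply k
  · exact measurable_const

lemma measurable_sum_Icc : Measurable fun q : ℕ × (ℕ → ℕ) => ∑ i ∈ Finset.Icc 1 q.1,
    q.2 i + q.2 0 :=
  measurable_from_prod_countable_right fun x => by
    change Measurable fun r : ℕ → ℕ => ∑ i ∈ Finset.Icc 1 x, r i + r 0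
    fun_prop

lemma measurable_inarPath (k : ℕ) : Measurable fun η => inarPath η k := by
  induction k with
  | zero => simp only [inarPath]; fun_prop
  | succ k ih =>
    exact measurable_sum_Icc.comp (ih.prodMk (measurable_pi_apply (k + 1)))

/-- The Markov structure in product form: distinct rows of the noise are independent, and the
truncated array is a function of rows `0, …, m` alone. -/
lemma map_truncateNoise_prod (r l : ℝ≥0) (p : unitInterval) (m : ℕ) :
    (inarLaw r l p).map (fun η => (truncateNoise m η, η (m + 1)))
      = ((inarLaw r l p).map (truncateNoise m)).prod
        (Measure.infinitePi fun i => noiseLaw r l p (m + 1) i) := by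
  have hi : iIndepFun (fun k (η : ℕ → ℕ → ℕ) => η k) (inarLaw r l p) :=
    iIndepFun_infinitePi (X := fun _ x => x) fun _ => measurable_id
  have h := hi.indepFun_finset (Finset.range (m + 1)) {m + 1} (by simp)
    fun k => measurable_pi_apply k
  -- `f` rebuilds the truncated array from its finitely many nontrivial rows.
  let f : ((k : Finset.range (m + 1)) → ℕ → ℕ) → ℕ → ℕ → ℕ :=
    fun y k => if hk : k ∈ Finset.range (m + 1) then y ⟨k, hk⟩ else 0
  have hf : Measurable f := by
    refine measurable_pi_lambda _ fun k => ?_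
    simp only [f]
    split_ifs
    · exact measurable_pi_apply _
    · exact measurable_const
  let g : ((k : ({m + 1} : Finset ℕ)) → ℕ → ℕ) → ℕ → ℕ := fun y => y ⟨m + 1, by simp⟩
  have hg : Measurable g := measurable_pi_apply _
  have h2 := h.comp hf hg
  have e1 : (f ∘ fun η (k : Finset.range (m + 1)) => η k) = truncateNoise m := by
    ext η k
    simp only [f, Function.comp_apply, truncateNoise, Finset.mem_range, Nat.lt_succ_iff]
    split_ifs <;> rfl
  rw [e1] at h2
  have h3 := (indepFun_iff_map_prod_eq_prod_map_map (measurable_truncateNoise m).aemeasurable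
    (measurable_pi_apply (m + 1)).aemeasurable).1 h2
  change Measure.map (fun η => (truncateNoise m η, η (m + 1))) _
    = (Measure.map _ _).prod (Measure.map (fun η : ℕ → ℕ → ℕ => η (m + 1)) _) at h3
  rw [h3]
  congr 1
  exact Measure.infinitePi_map_eval _ _

lemma integral_infinitePi_finset_prod {ι : Type*} {E : ι → Type*} [∀ i, MeasurableSpace (E i)]
    (μ : ∀ i, Measure (E i)) [∀ i, IsProbabilityMeasure (μ i)] (s : Finset ι) (g : ∀ i, E i → ℂ)
    (hg : ∀ i, Measurable (g i)) :
    ∫ x, ∏ i ∈ s, g i (x i) ∂Measure.infinitePi μ = ∏ i ∈ s, ∫ y, g i y ∂μ i := by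
  have h := integral_restrict_infinitePi (μ := μ) (s := s)
    (f := fun y : (i : s) → E i => ∏ i : s, g i (y i))
    (Measurable.aestronglyMeasurable
      (Finset.measurable_prod _ fun i _ => (hg i).comp (measurable_pi_apply i)))
  rw [integral_fintype_prod_eq_prod (f := fun (i : s) y => g i y)] at h
  rw [← Finset.prod_coe_sort s (fun i => ∫ y, g i y ∂μ i), ← h]
  congr with x
  exact (Finset.prod_coe_sort s fun i => g i (x i)).symm

lemma integral_pow_bernoulliLaw (p : unitInterval) (z : ℂ) :
    ∫ n, z ^ n ∂bernoulliLaw p = 1 - (p : ℝ) + (p : ℝ) * z := by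
  rw [bernoulliLaw, integral_add_measure, integral_smul_measure, integral_smul_measure,
    integral_dirac, integral_dirac, ENNReal.toReal_ofReal (by linarith [p.2.2]),
    ENNReal.toReal_ofReal p.2.1]
  · simp
  all_goals
    refine Integrable.smul_measure ?_ ENNReal.ofReal_ne_top
    exact integrable_dirac (by simp)

lemma integral_pow_poissonMeasure (r : ℝ≥0) (z : ℂ) :
    ∫ n, z ^ n ∂poissonMeasure r = Complex.exp (r * (z - 1)) := by
  rw [integral_poissonMeasure]
  calc ∑' n : ℕ, (Real.exp (-r) * r ^ n / n.factorial) • z ^ n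
      = ∑' n : ℕ, (Real.exp (-r) : ℂ) * ((r * z) ^ n / n.factorial) := by
        congr with n
        rw [Complex.real_smul, mul_pow]
        push_cast
        ring
    _ = (Real.exp (-r) : ℂ) * Complex.exp (r * z) := by
        rw [tsum_mul_left, (NormedSpace.expSeries_div_hasSum_exp (r * z : ℂ)).tsum_eq,
          Complex.exp_eq_exp_ℂ]
    _ = _ := by
        rw [Complex.ofReal_exp, ← Complex.exp_add]
        push_cast
        ring_nf

lemma integral_pow_thinning (r l : ℝ≥0) (p : unitInterval) (k x : ℕ) (z : ℂ) :
    ∫ y, z ^ (∑ i ∈ Finset.Icc 1 x, y i + y 0)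
        ∂Measure.infinitePi (fun i => noiseLaw r l p (k + 1) i)
      = (1 - (p : ℝ) + (p : ℝ) * z) ^ x * Complex.exp (l * (z - 1)) := by
  have h := integral_infinitePi_finset_prod (fun i => noiseLaw r l p (k + 1) i)
    (Finset.range (x + 1)) (fun _ n => z ^ n) fun _ => measurable_from_nat
  have e : ∀ y : ℕ → ℕ, z ^ (∑ i ∈ Finset.Icc 1 x, y i + y 0)
      = ∏ i ∈ Finset.range (x + 1), z ^ y i := fun y => by
    -- Index `0` carries the innovation and indices `1, …, x` the offspring, so all of them form a
    -- single product over `range (x + 1)`.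
    rw [Finset.prod_pow_eq_pow_sum, Finset.sum_range_succ', Finset.range_eq_Ico,
      Finset.sum_Ico_add' (fun i => y i) 0 x 1]
    rfl
  simp_rw [e, h]
  rw [Finset.prod_range_succ']
  simp only [noiseLaw, integral_pow_bernoulliLaw, integral_pow_poissonMeasure, Finset.prod_const,
    Finset.card_range]

lemma norm_pow_le_one_of_norm_le_one {z : ℂ} (hz : ‖z‖ ≤ 1) (n : ℕ) : ‖z ^ n‖ ≤ 1 := by
  rw [norm_pow]; exact pow_le_one₀ (norm_nonneg _) hz

lemma norm_one_sub_add_mul_le (p : unitInterval) {z : ℂ} (hz : ‖z‖ ≤ 1) :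
    ‖(1 - (p : ℝ) + (p : ℝ) * z : ℂ)‖ ≤ 1 := by
  calc _ ≤ ‖((1 - (p : ℝ) : ℝ) : ℂ)‖ + ‖((p : ℝ) : ℂ)‖ * ‖z‖ := by
        rw [← norm_mul]; push_cast; exact norm_add_le _ _
    _ ≤ (1 - p) + p * 1 := by
        rw [Complex.norm_real, Complex.norm_real, Real.norm_of_nonneg p.2.1,
          Real.norm_of_nonneg (by linarith [p.2.2])]
        gcongr
        exact p.2.1
    _ = 1 := by ring

/-- Fubini over the past and generation `m + 1`: integrating out the new generation replaces `z` by
the Bernoulli generating function raised to the current population, times the Poisson factor of the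
innovation. The bound on `F` supplies integrability. -/
lemma integral_mul_pow_inarPath_succ (r l : ℝ≥0) (p : unitInterval) (m : ℕ) {z : ℂ}
    (hz : ‖z‖ ≤ 1) (F : (ℕ → ℕ → ℕ) → ℂ) (hF : Measurable F) (hF1 : ∀ η, ‖F η‖ ≤ 1)
    (hFm : ∀ η, F (truncateNoise m η) = F η) :
    ∫ η, F η * z ^ inarPath η (m + 1) ∂inarLaw r l p
      = (∫ η, F η * (1 - (p : ℝ) + (p : ℝ) * z) ^ inarPath η m ∂inarLaw r l p)
        * Complex.exp (l * (z - 1)) := by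
  let G : (ℕ → ℕ → ℕ) × (ℕ → ℕ) → ℂ :=
    fun q => F q.1 * z ^ (∑ i ∈ Finset.Icc 1 (inarPath q.1 m), q.2 i + q.2 0)
  have hG : Measurable G := by
    refine (hF.comp measurable_fst).mul ((measurable_from_nat (f := fun n => z ^ n)).comp ?_)
    exact measurable_sum_Icc.comp (((measurable_inarPath m).comp measurable_fst).prodMk
      measurable_snd)
  have e1 : ∀ η, F η * z ^ inarPath η (m + 1) = G (truncateNoise m η, η (m + 1)) := fun η => by
    simp only [G, hFm, inarPath_truncateNoise le_rfl]
    rfl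
  have hmt := measurable_truncateNoise m
  simp_rw [e1]
  rw [← integral_map (φ := fun η => (truncateNoise m η, η (m + 1)))
    (hmt.prodMk (measurable_pi_apply _)).aemeasurable hG.aestronglyMeasurable,
    map_truncateNoise_prod]
  have : IsProbabilityMeasure ((inarLaw r l p).map (truncateNoise m)) :=
    Measure.isProbabilityMeasure_map hmt.aemeasurable
  rw [integral_prod]
  · simp only [G, integral_const_mul, integral_pow_thinning]
    rw [integral_map hmt.aemeasurable]
    · simp only [hFm, inarPath_truncateNoise le_rfl, ← mul_assoc]
      rw [integral_mul_const]
    · refine Measurable.aestronglyMeasurable (hF.mul (Measurable.mul_const ?_ _))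
      exact (measurable_from_nat (f := fun n => (1 - (p : ℝ) + (p : ℝ) * z : ℂ) ^ n)).comp
        (measurable_inarPath m)
  · refine Integrable.of_bound hG.aestronglyMeasurable 1 (ae_of_all _ fun q => ?_)
    simp only [G]
    rw [norm_mul]
    exact mul_le_one₀ (hF1 _) (norm_nonneg _) (norm_pow_le_one_of_norm_le_one hz _)

/-- The joint generating function of a stationary INAR(1) sequence with Poisson innovations. -/
lemma integral_prod_pow_inarPath (r l : ℝ≥0) (p : unitInterval) (m : ℕ) (z w : ℕ → ℂ)
    (hz : ∀ k, ‖z k‖ ≤ 1) (hwm : w m = z m)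
    (hw : ∀ k < m, w k = z k * (1 - (p : ℝ) + (p : ℝ) * w (k + 1))) :
    ∫ η, ∏ k ∈ Finset.range (m + 1), z k ^ inarPath η k ∂inarLaw r l p
      = Complex.exp (r * (w 0 - 1) + l * ∑ k ∈ Finset.range m, (w (k + 1) - 1)) := by
  induction m generalizing z with
  | zero =>
    simp only [zero_add, Finset.prod_range_one, inarPath, Finset.range_zero, Finset.sum_empty,
      mul_zero, add_zero, hwm]
    have h1 := integral_infinitePi_finset_prod
      (fun k => Measure.infinitePi fun i => noiseLaw r l p k i) {0} (fun _ y => z 0 ^ y 0)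
      fun _ => (measurable_from_nat (f := fun n => z 0 ^ n)).comp (measurable_pi_apply 0)
    have h2 := integral_infinitePi_finset_prod (fun i => noiseLaw r l p 0 i) {0}
      (fun _ n => z 0 ^ n) fun _ => measurable_from_nat
    simp only [Finset.prod_singleton] at h1 h2
    rw [inarLaw, h1, h2, noiseLaw, integral_pow_poissonMeasure]
  | succ m ih =>
    have hwn : ‖w m‖ ≤ 1 := by
      rw [hw m (by omega), hwm, norm_mul]
      exact mul_le_one₀ (hz m) (norm_nonneg _) (norm_one_sub_add_mul_le p (hz _))
    have hmeas : ∀ k, Measurable fun η => z k ^ inarPath η k := fun k =>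
      (measurable_from_nat (f := fun n => z k ^ n)).comp (measurable_inarPath k)
    have step := integral_mul_pow_inarPath_succ r l p m (hz (m + 1))
      (fun η => ∏ k ∈ Finset.range (m + 1), z k ^ inarPath η k)
      (Finset.measurable_prod _ fun k _ => hmeas k)
      (fun η => by
        rw [norm_prod]
        exact Finset.prod_le_one (fun _ _ => norm_nonneg _)
          fun k _ => norm_pow_le_one_of_norm_le_one (hz k) _)
      (fun η => Finset.prod_congr rfl fun k hk => by
        rw [inarPath_truncateNoise (by simpa [Nat.lt_succ_iff] using hk)])
    simp_rw [Finset.prod_range_succ (fun k => z k ^ _) (m + 1)]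
    rw [step]
    -- After the last generation is integrated out, its contribution is absorbed into the weight at
    -- time `m`, which becomes `z m * (1 - p + p * z (m + 1)) = w m`.
    have ih' := ih (Function.update z m (w m))
      (fun k => by
        by_cases hk : k = m
        · subst hk; simpa using hwn
        · simpa [Function.update_of_ne hk] using hz k)
      (by simp)
      (fun k hk => by rw [Function.update_of_ne (by omega)]; exact hw k (by omega))
    have e : ∀ η, (∏ k ∈ Finset.range (m + 1), z k ^ inarPath η k)
        * (1 - (p : ℝ) + (p : ℝ) * z (m + 1)) ^ inarPath η m
        = ∏ k ∈ Finset.range (m + 1), Function.update z m (w m) k ^ inarPath η k := fun η => by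
      rw [Finset.prod_range_succ, Finset.prod_range_succ, Function.update_self, hw m (by omega),
        hwm, mul_pow, mul_assoc]
      congr 1
      refine Finset.prod_congr rfl fun k hk => ?_
      rw [Function.update_of_ne (by simp at hk; omega)]
    simp_rw [e, ih', ← Complex.exp_add]
    rw [Finset.sum_range_succ _ m, hwm]
    congr 1
    ring

/-! ### Means -/

lemma lintegral_natCast_poissonMeasure (r : ℝ≥0) : ∫⁻ n, (n : ℝ≥0∞) ∂poissonMeasure r = r := by
  -- After an index shift, `(n + 1)` cancels against the factorial and leaves `r` times the Poisson
  -- weight of `n`.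
  have hsum : HasSum (fun n : ℕ => Real.exp (-r) * (r : ℝ) ^ n / n.factorial * n) r := by
    rw [← hasSum_nat_add_iff' 1]
    have h := (hasSum_one_poissonMeasure r).mul_left (r : ℝ)
    rw [mul_one] at h
    simp only [Finset.range_one, Finset.sum_singleton, Nat.cast_zero, mul_zero, sub_zero]
    refine h.congr_fun fun n => ?_
    rw [Nat.factorial_succ]
    push_cast
    field_simp
    ring
  rw [poissonMeasure, lintegral_sum_measure]
  simp only [lintegral_smul_measure, lintegral_dirac, smul_eq_mul]
  have : ∀ n : ℕ, ENNReal.ofReal (Real.exp (-r) * (r : ℝ) ^ n / n.factorial) * (n : ℝ≥0∞)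
      = ENNReal.ofReal (Real.exp (-r) * (r : ℝ) ^ n / n.factorial * n) := fun n => by
    rw [ENNReal.ofReal_mul (by positivity), ENNReal.ofReal_natCast]
  simp_rw [this]
  rw [← ENNReal.ofReal_tsum_of_nonneg (fun n => by positivity) hsum.summable, hsum.tsum_eq,
    ENNReal.ofReal_coe_nnreal]

lemma lintegral_natCast_bernoulliLaw (p : unitInterval) :
    ∫⁻ n, (n : ℝ≥0∞) ∂bernoulliLaw p = ENNReal.ofReal p := by
  simp [bernoulliLaw, lintegral_add_measure, lintegral_smul_measure]

lemma lintegral_thinning (r l : ℝ≥0) (p : unitInterval) (k x : ℕ) :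
    ∫⁻ y, ((∑ i ∈ Finset.Icc 1 x, y i + y 0 : ℕ) : ℝ≥0∞)
        ∂Measure.infinitePi (fun i => noiseLaw r l p (k + 1) i)
      = x * ENNReal.ofReal p + l := by
  have hm : ∀ i, Measurable fun y : ℕ → ℕ => (y i : ℝ≥0∞) := fun i =>
    measurable_from_nat.comp (measurable_pi_apply i)
  have hl : ∀ i, ∫⁻ y, (y i : ℝ≥0∞) ∂Measure.infinitePi (fun i => noiseLaw r l p (k + 1) i)
      = ∫⁻ n, (n : ℝ≥0∞) ∂noiseLaw r l p (k + 1) i := fun i => by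
    rw [← Measure.infinitePi_map_eval (fun i => noiseLaw r l p (k + 1) i) i,
      lintegral_map measurable_from_nat (measurable_pi_apply i)]
  push_cast
  rw [lintegral_add_right _ (hm 0), lintegral_finsetSum _ fun i _ => hm i, hl 0,
    Finset.sum_congr rfl (g := fun _ => ENNReal.ofReal p)]
  · simp [noiseLaw, lintegral_natCast_poissonMeasure]
  · intro i hi
    rw [hl]
    obtain ⟨j, rfl⟩ : ∃ j, i = j + 1 := ⟨i - 1, by simp at hi; omega⟩
    exact lintegral_natCast_bernoulliLaw p

/-- One generation sends the mean `x` to `x p + l`; the hypothesis `hr` says that the initial mean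
is a fixed point. -/
lemma lintegral_inarPath (r l : ℝ≥0) (p : unitInterval)
    (hr : (r : ℝ≥0∞) * ENNReal.ofReal p + l = r) (k : ℕ) :
    ∫⁻ η, (inarPath η k : ℝ≥0∞) ∂inarLaw r l p = r := by
  induction k with
  | zero =>
    have h1 := Measure.infinitePi_map_eval
      (fun k => Measure.infinitePi fun i => noiseLaw r l p k i) 0
    have h2 := Measure.infinitePi_map_eval (fun i => noiseLaw r l p 0 i) 0
    rw [← h1, Measure.map_map (by fun_prop) (by fun_prop)] at h2
    have h3 : ∫⁻ n, (n : ℝ≥0∞) ∂noiseLaw r l p 0 0 = r := lintegral_natCast_poissonMeasure r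
    rw [← h2, lintegral_map measurable_from_nat (by fun_prop)] at h3
    exact h3
  | succ m ih =>
    let G : (ℕ → ℕ → ℕ) × (ℕ → ℕ) → ℝ≥0∞ :=
      fun q => ((∑ i ∈ Finset.Icc 1 (inarPath q.1 m), q.2 i + q.2 0 : ℕ) : ℝ≥0∞)
    have hG : Measurable G := measurable_from_nat.comp (measurable_sum_Icc.comp
      (((measurable_inarPath m).comp measurable_fst).prodMk measurable_snd))
    have e1 : ∀ η, (inarPath η (m + 1) : ℝ≥0∞) = G (truncateNoise m η, η (m + 1)) := fun η => by
      simp only [G, inarPath_truncateNoise le_rfl]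
      rfl
    have hmt := measurable_truncateNoise m
    have hmX : Measurable fun η => (inarPath η m : ℝ≥0∞) :=
      measurable_from_nat.comp (measurable_inarPath m)
    simp_rw [e1]
    rw [← lintegral_map (g := fun η => (truncateNoise m η, η (m + 1))) hG
      (hmt.prodMk (measurable_pi_apply _)), map_truncateNoise_prod,
        lintegral_prod _ hG.aemeasurable]
    simp only [G, lintegral_thinning]
    rw [lintegral_map ((hmX.mul_const _).add_const _) hmt]
    simp only [inarPath_truncateNoise le_rfl]
    rw [lintegral_add_right _ measurable_const, lintegral_mul_const _ hmX, ih]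
    simpa using hr

/-! ### The conditional law of the noise given the thinning parameter -/

/-- Agreement on `V` gives `μ V = ν V = 1`, so `μ` has no mass elsewhere either. It is needed
because the model prescribes offspring probabilities only for outcomes in `{0, 1}`. -/
lemma measure_eq_of_singleton_of_mem {E : Type*} [MeasurableSpace E] [Countable E]
    [MeasurableSingletonClass E] {μ ν : Measure E} [IsProbabilityMeasure μ]
    [IsProbabilityMeasure ν] (V : Set E) (hν : ν Vᶜ = 0) (h : ∀ y ∈ V, μ {y} = ν {y}) : μ = ν := by
  have hV : MeasurableSet V := V.to_countable.measurableSet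
  have hμV : μ V = ν V := by
    rw [← Set.biUnion_of_singleton V, measure_biUnion V.to_countable
      (fun x _ y _ hxy => by simpa using hxy) fun _ _ => MeasurableSet.singleton _,
      measure_biUnion V.to_countable (fun x _ y _ hxy => by simpa using hxy)
      fun _ _ => MeasurableSet.singleton _]
    exact tsum_congr fun y => h y y.2
  have hμ : μ Vᶜ = 0 := by
    rw [prob_compl_eq_zero_iff hV, hμV]
    exact (prob_compl_eq_zero_iff hV).1 hν
  refine Measure.ext_of_singleton fun y => ?_
  by_cases hy : y ∈ V
  · exact h y hy
  · have hs : {y} ⊆ Vᶜ := by simpa using hy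
    rw [measure_mono_null hs hμ, measure_mono_null hs hν]

/-- Square boxes are cofinal among finite index sets, so point probabilities on boxes determine
every cylinder. -/
lemma eq_infinitePi_of_box (μ : Measure (ℕ × ℕ → ℕ)) [IsProbabilityMeasure μ]
    (m : ℕ × ℕ → Measure ℕ) [∀ p, IsProbabilityMeasure (m p)] (V : ℕ × ℕ → Set ℕ)
    (hV0 : ∀ p, 0 ∈ V p) (hV : ∀ p, m p (V p)ᶜ = 0)
    (h : ∀ (n : ℕ) (y : ℕ × ℕ → ℕ), (∀ p, y p ∈ V p) →
      μ {η | ∀ p ∈ Finset.range (n + 1) ×ˢ Finset.range (n + 1), η p = y p}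
        = ∏ p ∈ Finset.range (n + 1) ×ˢ Finset.range (n + 1), m p {y p}) :
    μ = Measure.infinitePi m := by
  have hbox : ∀ n : ℕ, μ.map (Finset.range (n + 1) ×ˢ Finset.range (n + 1)).restrict
      = Measure.pi fun p : (Finset.range (n + 1) ×ˢ Finset.range (n + 1) : Finset (ℕ × ℕ)) =>
        m p := by
    intro n
    set b := Finset.range (n + 1) ×ˢ Finset.range (n + 1) with hb
    have : IsProbabilityMeasure (μ.map b.restrict) :=
      Measure.isProbabilityMeasure_map (by fun_prop)
    refine measure_eq_of_singleton_of_mem (Set.univ.pi fun p : b => V p) ?_ fun y hy => ?_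
    · have hsub : (Set.univ.pi fun p : b => V p)ᶜ ⊆ ⋃ p : b, Function.eval p ⁻¹' (V p)ᶜ := by
        intro x hx
        simpa [Set.mem_pi] using hx
      refine measure_mono_null hsub (measure_iUnion_null fun p => ?_)
      rw [← Measure.map_apply (measurable_pi_apply p) (Set.to_countable _).measurableSet,
        (measurePreserving_eval _ p).map_eq, hV]
    · rw [Measure.map_apply (by fun_prop) (MeasurableSet.singleton _), Measure.pi_singleton]
      have h1 := h n (fun p => if hp : p ∈ b then y ⟨p, hp⟩ else 0) fun p => by
        split_ifs with hp
        · exact hy ⟨p, hp⟩ trivial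
        · exact hV0 p
      rw [← hb] at h1
      rw [← Finset.prod_coe_sort b] at h1
      convert h1 using 2
      · ext η
        simp only [Set.mem_preimage, Set.mem_singleton_iff, Set.mem_ofPred_eq, funext_iff,
          Subtype.forall, Finset.restrict]
        refine forall_congr' fun p => forall_congr' fun hp => ?_
        rw [dif_pos hp]
      · rename_i p _
        rw [dif_pos p.2]
  refine Measure.eq_infinitePi _ fun s t ht => ?_
  obtain ⟨n, hn⟩ : ∃ n, s ⊆ Finset.range (n + 1) ×ˢ Finset.range (n + 1) := by
    -- The sum `p.1 + p.2` bounds both coordinates at once.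
    refine ⟨s.sup fun p => p.1 + p.2, fun p hp => ?_⟩
    have := Finset.le_sup (f := fun p : ℕ × ℕ => p.1 + p.2) hp
    simp only [Finset.mem_product, Finset.mem_range]
    omega
  rw [← Measure.infinitePi_pi m fun i _ => ht i]
  have e : Set.pi s t = (Finset.range (n + 1) ×ˢ Finset.range (n + 1)).restrict ⁻¹'
      {f : (Finset.range (n + 1) ×ˢ Finset.range (n + 1) : Finset (ℕ × ℕ)) → ℕ |
        ∀ p (hp : p ∈ s), f ⟨p, hn hp⟩ ∈ t p} := by
    ext η; simp [Set.mem_pi]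
  rw [e, ← Measure.map_apply (by fun_prop) (Set.to_countable _).measurableSet, hbox,
    ← Measure.map_apply (by fun_prop) (Set.to_countable _).measurableSet,
    Measure.infinitePi_map_restrict]

lemma prod_Icc_one_eq_prod_range {M : Type*} [CommMonoid M] (n : ℕ) (f : ℕ → M) :
    ∏ k ∈ Finset.Icc 1 n, f k = ∏ k ∈ Finset.range n, f (k + 1) := by
  rw [Finset.range_eq_Ico, Finset.prod_Ico_add' f 0 n 1]
  rfl

lemma poissonMeasure_singleton_eq {r : ℝ} (hr : 0 ≤ r) (k : ℕ) :
    poissonMeasure r.toNNReal {k} = ENNReal.ofReal (poissonWeight r k) := by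
  rw [poissonMeasure_singleton, Real.coe_toNNReal _ hr, poissonWeight]

lemma bernoulliLaw_singleton_eq (p : unitInterval) {x : ℕ} (hx : x = 0 ∨ x = 1) :
    bernoulliLaw p {x} = ENNReal.ofReal (bernoulliWeight p x) := by
  rcases hx with rfl | rfl <;> simp [bernoulliLaw, bernoulliWeight]

lemma poissonWeight_nonneg {r : ℝ} (hr : 0 ≤ r) (k : ℕ) : 0 ≤ poissonWeight r k := by
  unfold poissonWeight; positivity

lemma bernoulliWeight_nonneg {a : ℝ} (ha : 0 ≤ a) (ha1 : a ≤ 1) (x : ℕ) :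
    0 ≤ bernoulliWeight a x := by
  unfold bernoulliWeight
  split_ifs <;> linarith

lemma measurable_condWeight (lam : ℝ) (n x₀ : ℕ) (l : ℕ → ℕ) (x : ℕ → ℕ → ℕ) :
    Measurable fun a => condWeight lam a n x₀ l x := by
  have hb : ∀ x : ℕ, Measurable fun a => bernoulliWeight a x := fun x => by
    unfold bernoulliWeight
    split_ifs <;> fun_prop
  unfold condWeight
  refine Measurable.mul (Measurable.mul ?_ measurable_const)
    (Finset.measurable_prod _ fun k _ => Finset.measurable_prod _ fun i _ => hb _)
  unfold poissonWeight
  fun_prop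

/-- The possible values of the noise variables. -/
def noiseRange : ℕ × ℕ → Set ℕ
  | (0, 0) => Set.univ
  | (0, _ + 1) => {0}
  | (_ + 1, 0) => Set.univ
  | (_ + 1, _ + 1) => {0, 1}

lemma zero_mem_noiseRange (p : ℕ × ℕ) : 0 ∈ noiseRange p := by
  obtain ⟨k, i⟩ := p
  cases k <;> cases i <;> simp [noiseRange]

lemma noiseLaw_compl_noiseRange (r l : ℝ≥0) (q : unitInterval) (p : ℕ × ℕ) :
    noiseLaw r l q p.1 p.2 (noiseRange p)ᶜ = 0 := by
  obtain ⟨k, i⟩ := p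
  cases k <;> cases i <;> simp [noiseRange, noiseLaw, bernoulliLaw]

/-- The box splits into the corner (initial value), the rest of column `0` (innovations), the
interior (offspring), and the rest of row `0`, where Dirac masses at `0` contribute factors `1`. -/
lemma prod_noiseLaw_singleton {lam a : ℝ} (hlam : 0 ≤ lam) (ha : a ∈ Set.Ioo (0 : ℝ) 1)
    (q : unitInterval) (hq : (q : ℝ) = a) (n : ℕ) (y : ℕ × ℕ → ℕ) (hy : ∀ p, y p ∈ noiseRange p) :
    ∏ p ∈ Finset.range (n + 1) ×ˢ Finset.range (n + 1),
        noiseLaw (lam / (1 - a)).toNNReal lam.toNNReal q p.1 p.2 {y p}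
      = ENNReal.ofReal (condWeight lam a n (y (0, 0)) (fun k => y (k, 0)) fun k i => y (k, i)) := by
  have h1a : 0 ≤ lam / (1 - a) := div_nonneg hlam (by linarith [ha.2])
  have hy1 : ∀ k i, y (k + 1, i + 1) = 0 ∨ y (k + 1, i + 1) = 1 := fun k i => hy (k + 1, i + 1)
  have hy0 : ∀ i, y (0, i + 1) = 0 := fun i => hy (0, i + 1)
  rw [Finset.prod_product, Finset.prod_range_succ', condWeight,
    ENNReal.ofReal_mul (mul_nonneg (poissonWeight_nonneg h1a _)
      (Finset.prod_nonneg fun _ _ => poissonWeight_nonneg hlam _)),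
    ENNReal.ofReal_mul (poissonWeight_nonneg h1a _),
    ENNReal.ofReal_prod_of_nonneg fun _ _ => poissonWeight_nonneg hlam _,
    ENNReal.ofReal_prod_of_nonneg fun _ _ => Finset.prod_nonneg
      fun _ _ => bernoulliWeight_nonneg ha.1.le ha.2.le _]
  simp only [ENNReal.ofReal_prod_of_nonneg fun _ _ => bernoulliWeight_nonneg ha.1.le ha.2.le _,
    prod_Icc_one_eq_prod_range, Finset.prod_range_succ' _ n, noiseLaw, Finset.prod_mul_distrib,
    bernoulliLaw_singleton_eq q (hy1 _ _), poissonMeasure_singleton_eq hlam,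
    poissonMeasure_singleton_eq h1a, hy0, hq]
  simp only [Measure.dirac_apply, Set.mem_singleton_iff, Set.indicator_of_mem, Pi.one_apply,
    Finset.prod_const_one, one_mul]
  ring

section Model

variable {Ω : Type*} [MeasurableSpace Ω] {lam : ℝ} {α : Ω → ℝ} {X : ℕ → Ω → ℕ}
  {ξ : ℕ → ℕ → Ω → ℕ} {ε : ℕ → Ω → ℕ} {P : Measure Ω}

/-- The noise driving a randomized INAR(1) sequence. -/
def modelNoise (X : ℕ → Ω → ℕ) (ξ : ℕ → ℕ → Ω → ℕ) (ε : ℕ → Ω → ℕ) (ω : Ω) : ℕ → ℕ → ℕ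
  | 0, 0 => X 0 ω
  | 0, _ + 1 => 0
  | k + 1, 0 => ε (k + 1) ω
  | k + 1, i + 1 => ξ (k + 1) (i + 1) ω

/-- The conditional law of the noise given that the thinning parameter equals `a`. -/
noncomputable def condNoiseLaw (lam a : ℝ) : Measure (ℕ → ℕ → ℕ) :=
  inarLaw (lam / (1 - a)).toNNReal lam.toNNReal (Set.projIcc 0 1 zero_le_one a)

instance (lam a : ℝ) : IsProbabilityMeasure (condNoiseLaw lam a) := by
  unfold condNoiseLaw; infer_instance

lemma IsRandomizedINAR1.measurable_modelNoise (h : IsRandomizedINAR1 lam α X ξ ε P) :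
    Measurable (modelNoise X ξ ε) := by
  refine measurable_pi_lambda _ fun k => measurable_pi_lambda _ fun i => ?_
  cases k <;> cases i <;> simp only [modelNoise]
  · exact h.measurable_init
  · exact measurable_const
  · exact h.measurable_innovation _
  · exact h.measurable_offspring _ _

lemma IsRandomizedINAR1.inarPath_modelNoise (h : IsRandomizedINAR1 lam α X ξ ε P) (k : ℕ) (ω : Ω) :
    inarPath (modelNoise X ξ ε ω) k = X k ω := by
  induction k with
  | zero => rfl
  | succ k ih =>
    rw [inarPath, ih, h.recursion]
    congr 1
    refine Finset.sum_congr rfl fun i hi => ?_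
    obtain ⟨j, rfl⟩ : ∃ j, i = j + 1 := ⟨i - 1, by simp at hi; omega⟩
    rfl

/-- Both sides have the same integral over every measurable set of parameters, by the disintegration
of the joint law and the field `joint`. -/
lemma IsRandomizedINAR1.condDistrib_box [IsProbabilityMeasure P]
    (h : IsRandomizedINAR1 lam α X ξ ε P) (n : ℕ) (y : ℕ × ℕ → ℕ) (hy : ∀ p, y p ∈ noiseRange p) :
    ∀ᵐ a ∂P.map α, condDistrib (modelNoise X ξ ε) α P a
        {η | ∀ p ∈ Finset.range (n + 1) ×ˢ Finset.range (n + 1), η p.1 p.2 = y p}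
      = ENNReal.ofReal (condWeight lam a n (y (0, 0)) (fun k => y (k, 0)) fun k i => y (k, i)) := by
  have hC : MeasurableSet {η : ℕ → ℕ → ℕ |
      ∀ p ∈ Finset.range (n + 1) ×ˢ Finset.range (n + 1), η p.1 p.2 = y p} := by
    have : {η : ℕ → ℕ → ℕ | ∀ p ∈ Finset.range (n + 1) ×ˢ Finset.range (n + 1), η p.1 p.2 = y p}
        = ⋂ p ∈ Finset.range (n + 1) ×ˢ Finset.range (n + 1),
          (fun η : ℕ → ℕ → ℕ => η p.1 p.2) ⁻¹' {y p} := by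
      ext η; simp
    rw [this]
    refine Finset.measurableSet_biInter _ fun p _ => ?_
    exact (by fun_prop : Measurable fun η : ℕ → ℕ → ℕ => η p.1 p.2) (MeasurableSet.singleton _)
  have : IsProbabilityMeasure (P.map α) :=
    Measure.isProbabilityMeasure_map h.measurable_param.aemeasurable
  -- The field `joint` asks for all offspring values to be `0` or `1`, whereas row and column `0` of
  -- `y` hold unrestricted values; those entries do not enter `condWeight` and are reset to `0`.
  set x : ℕ → ℕ → ℕ := fun k i => if k = 0 ∨ i = 0 then 0 else y (k, i) with hx
  have hx01 : ∀ k i, x k i = 0 ∨ x k i = 1 := by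
    intro k i
    obtain _ | k := k
    · simp [hx]
    obtain _ | i := i
    · simp [hx]
    have := hy (k + 1, i + 1)
    simpa [hx, noiseRange] using this
  have hw : ∀ a, condWeight lam a n (y (0, 0)) (fun k => y (k, 0)) x
      = condWeight lam a n (y (0, 0)) (fun k => y (k, 0)) fun k i => y (k, i) := fun a => by
    unfold condWeight
    congr 1
    refine Finset.prod_congr rfl fun k hk => Finset.prod_congr rfl fun i hi => ?_
    simp only [Finset.mem_Icc] at hk hi
    simp only [hx]
    rw [if_neg (by omega)]
  refine ae_eq_of_forall_setLIntegral_eq_of_sigmaFinite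
    (ProbabilityTheory.Kernel.measurable_coe _ hC)
    (measurable_condWeight _ _ _ _ _).ennreal_ofReal fun S hS _ => ?_
  rw [← Measure.compProd_apply_prod hS hC, compProd_map_condDistrib
    h.measurable_modelNoise.aemeasurable, Measure.map_apply
    (h.measurable_param.prodMk h.measurable_modelNoise) (hS.prod hC)]
  simp_rw [← hw]
  rw [← h.joint n S (y (0, 0)) (fun k => y (k, 0)) x hS hx01]
  congr 1
  ext ω
  simp only [Set.mem_preimage, Set.mem_prod, Set.mem_ofPred_eq, Finset.mem_product,
    Finset.mem_range, Prod.forall, Finset.mem_Icc]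
  refine and_congr_right fun _ => ⟨fun hp => ⟨hp 0 0 ⟨by omega, by omega⟩, fun k hk => ?_,
    fun k hk i hi => ?_⟩, fun ⟨h0, h1, h2⟩ k i hki => ?_⟩
  · obtain ⟨k, rfl⟩ : ∃ j, k = j + 1 := ⟨k - 1, by omega⟩
    exact hp (k + 1) 0 ⟨by omega, by omega⟩
  · obtain ⟨k, rfl⟩ : ∃ j, k = j + 1 := ⟨k - 1, by omega⟩
    obtain ⟨i, rfl⟩ : ∃ j, i = j + 1 := ⟨i - 1, by omega⟩
    simp only [hx]
    rw [if_neg (by omega)]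
    exact hp (k + 1) (i + 1) ⟨by omega, by omega⟩
  · obtain _ | k := k
    · obtain _ | i := i
      · exact h0
      · exact (hy (0, i + 1) : y (0, i + 1) = 0).symm
    · obtain _ | i := i
      · exact h1 (k + 1) (by omega)
      · have := h2 (k + 1) (by omega) (i + 1) (by omega)
        simp only [hx] at this
        rwa [if_neg (by omega)] at this

/-- Given the thinning parameter, the noise variables are independent, with the Poisson and
Bernoulli laws of the deterministic model. -/
theorem IsRandomizedINAR1.condDistrib_modelNoise [IsProbabilityMeasure P] (hlam : 0 ≤ lam)
    (h : IsRandomizedINAR1 lam α X ξ ε P) :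
    ∀ᵐ a ∂P.map α, condDistrib (modelNoise X ξ ε) α P a = condNoiseLaw lam a := by
  have hmem : ∀ᵐ a ∂P.map α, a ∈ Set.Ioo (0 : ℝ) 1 :=
    (ae_map_iff h.measurable_param.aemeasurable measurableSet_Ioo).2 h.param_mem
  -- Configurations are indexed by functions on finite boxes, a countable family, so that a single
  -- null set of parameters serves all of them; `0` is an admissible default outside the box.
  let ext : (n : ℕ) → ((Finset.range (n + 1) ×ˢ Finset.range (n + 1) : Finset (ℕ × ℕ)) → ℕ) →
      ℕ × ℕ → ℕ := fun n y p => if hp : p ∈ Finset.range (n + 1) ×ˢ Finset.range (n + 1)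
        then y ⟨p, hp⟩ else 0
  have hall : ∀ᵐ a ∂P.map α, ∀ (n : ℕ)
      (y : (Finset.range (n + 1) ×ˢ Finset.range (n + 1) : Finset (ℕ × ℕ)) → ℕ),
      (∀ p, ext n y p ∈ noiseRange p) → condDistrib (modelNoise X ξ ε) α P a
        {η | ∀ p ∈ Finset.range (n + 1) ×ˢ Finset.range (n + 1), η p.1 p.2 = ext n y p}
      = ENNReal.ofReal (condWeight lam a n (ext n y (0, 0)) (fun k => ext n y (k, 0))
        fun k i => ext n y (k, i)) := by
    refine ae_all_iff.2 fun n => ae_all_iff.2 fun y => ?_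
    by_cases hy : ∀ p, ext n y p ∈ noiseRange p
    · filter_upwards [h.condDistrib_box n (ext n y) hy] with a ha _ using ha
    · exact ae_of_all _ fun a hy' => absurd hy' hy
  filter_upwards [hmem, hall] with a ha hbox
  set q := Set.projIcc (0 : ℝ) 1 zero_le_one a with hq
  have hqa : (q : ℝ) = a := by
    rw [hq, Set.projIcc_of_mem zero_le_one ⟨ha.1.le, ha.2.le⟩]
  set μ := condDistrib (modelNoise X ξ ε) α P a with hμ
  have hprob : IsProbabilityMeasure
    ((condDistrib (modelNoise X ξ ε) α P a).map (MeasurableEquiv.curry ℕ ℕ ℕ).symm) :=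
    Measure.isProbabilityMeasure_map (MeasurableEquiv.measurable _).aemeasurable
  rw [condNoiseLaw, inarLaw, ← Measure.infinitePi_map_curry, ← hq, eq_comm,
    MeasurableEquiv.map_apply_eq_iff_map_symm_apply_eq]
  refine Eq.symm (eq_infinitePi_of_box _
    (fun p => noiseLaw (lam / (1 - a)).toNNReal lam.toNNReal q p.1 p.2)
    noiseRange zero_mem_noiseRange
    (noiseLaw_compl_noiseRange _ _ _) fun n y hy => ?_)
  set y' : (Finset.range (n + 1) ×ˢ Finset.range (n + 1) : Finset (ℕ × ℕ)) → ℕ :=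
    fun p => y p with hy'
  have hyy : ∀ p ∈ Finset.range (n + 1) ×ˢ Finset.range (n + 1), ext n y' p = y p :=
    fun p hp => dif_pos hp
  have hext : ∀ p, ext n y' p ∈ noiseRange p := fun p => by
    by_cases hp : p ∈ Finset.range (n + 1) ×ˢ Finset.range (n + 1)
    · rw [hyy p hp]; exact hy p
    · simp only [ext]
      rw [dif_neg hp]
      exact zero_mem_noiseRange p
  rw [← Finset.prod_congr rfl fun p hp => congrArg (fun v : ℕ =>
      noiseLaw (lam / (1 - a)).toNNReal lam.toNNReal q p.1 p.2 {v}) (hyy p hp),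
    prod_noiseLaw_singleton hlam ha q hqa n (ext n y') hext, ← hbox n y' hext,
    MeasurableEquiv.map_apply]
  congr 1
  ext η
  refine forall_congr' fun p => forall_congr' fun hp => ?_
  rw [hyy p hp]
  rfl

/-- Integrals of functions of the parameter and the path, in terms of the conditional law. -/
lemma IsRandomizedINAR1.integral_eq [IsProbabilityMeasure P] (hlam : 0 ≤ lam)
    (h : IsRandomizedINAR1 lam α X ξ ε P) (f : ℝ × (ℕ → ℕ) → ℂ) (hf : Measurable f)
    (hf1 : ∀ x, ‖f x‖ ≤ 1) :
    ∫ ω, f (α ω, fun k => X k ω) ∂P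
      = ∫ a, ∫ η, f (a, inarPath η) ∂condNoiseLaw lam a ∂P.map α := by
  have hp : Measurable fun q : ℝ × (ℕ → ℕ → ℕ) => (q.1, inarPath q.2) :=
    measurable_fst.prodMk
      (measurable_pi_lambda _ fun k => (measurable_inarPath k).comp measurable_snd)
  have hfp : Measurable fun q : ℝ × (ℕ → ℕ → ℕ) => f (q.1, inarPath q.2) := hf.comp hp
  have hmap := compProd_map_condDistrib (mβ := inferInstance) (X := α) (μ := P)
    (Y := modelNoise X ξ ε) h.measurable_modelNoise.aemeasurable
  have : IsProbabilityMeasure (P.map α) :=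
    Measure.isProbabilityMeasure_map h.measurable_param.aemeasurable
  calc ∫ ω, f (α ω, fun k => X k ω) ∂P
      = ∫ ω, (fun q : ℝ × (ℕ → ℕ → ℕ) => f (q.1, inarPath q.2)) (α ω, modelNoise X ξ ε ω) ∂P := by
        refine integral_congr_ae (ae_of_all _ fun ω => ?_)
        simp only
        congr 2
        ext k
        exact (h.inarPath_modelNoise k ω).symm
    _ = ∫ q, f (q.1, inarPath q.2) ∂((P.map α) ⊗ₘ condDistrib (modelNoise X ξ ε) α P) := by
        rw [hmap, integral_map (h.measurable_param.prodMk h.measurable_modelNoise).aemeasurable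
          hfp.aestronglyMeasurable]
    _ = ∫ a, ∫ η, f (a, inarPath η) ∂condDistrib (modelNoise X ξ ε) α P a ∂P.map α := by
        refine Measure.integral_compProd (Integrable.of_bound
          hfp.aestronglyMeasurable 1 (ae_of_all _ fun q => hf1 _))
    _ = _ := by
        refine integral_congr_ae ?_
        filter_upwards [h.condDistrib_modelNoise hlam] with a ha
        rw [ha]

lemma IsRandomizedINAR1.lintegral_eq [IsProbabilityMeasure P] (hlam : 0 ≤ lam)
    (h : IsRandomizedINAR1 lam α X ξ ε P) (f : ℝ × (ℕ → ℕ) → ℝ≥0∞) (hf : Measurable f) :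
    ∫⁻ ω, f (α ω, fun k => X k ω) ∂P
      = ∫⁻ a, ∫⁻ η, f (a, inarPath η) ∂condNoiseLaw lam a ∂P.map α := by
  have hp : Measurable fun q : ℝ × (ℕ → ℕ → ℕ) => (q.1, inarPath q.2) :=
    measurable_fst.prodMk
      (measurable_pi_lambda _ fun k => (measurable_inarPath k).comp measurable_snd)
  have hfp : Measurable fun q : ℝ × (ℕ → ℕ → ℕ) => f (q.1, inarPath q.2) := hf.comp hp
  have hmap := compProd_map_condDistrib (mβ := inferInstance) (X := α) (μ := P)
    (Y := modelNoise X ξ ε) h.measurable_modelNoise.aemeasurable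
  have : IsProbabilityMeasure (P.map α) :=
    Measure.isProbabilityMeasure_map h.measurable_param.aemeasurable
  calc ∫⁻ ω, f (α ω, fun k => X k ω) ∂P
      = ∫⁻ ω, (fun q : ℝ × (ℕ → ℕ → ℕ) => f (q.1, inarPath q.2)) (α ω, modelNoise X ξ ε ω) ∂P := by
        refine lintegral_congr fun ω => ?_
        simp only
        congr 2
        ext k
        exact (h.inarPath_modelNoise k ω).symm
    _ = ∫⁻ q, f (q.1, inarPath q.2) ∂((P.map α) ⊗ₘ condDistrib (modelNoise X ξ ε) α P) := by
        rw [hmap, lintegral_map hfp (h.measurable_param.prodMk h.measurable_modelNoise)]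
    _ = ∫⁻ a, ∫⁻ η, f (a, inarPath η) ∂condDistrib (modelNoise X ξ ε) α P a ∂P.map α :=
        Measure.lintegral_compProd hfp
    _ = _ := by
        refine lintegral_congr_ae ?_
        filter_upwards [h.condDistrib_modelNoise hlam] with a ha
        rw [ha]

lemma lintegral_condNoiseLaw {lam a : ℝ} (hlam : 0 ≤ lam) (ha : a ∈ Set.Ioo (0 : ℝ) 1) (k : ℕ) :
    ∫⁻ η, (inarPath η k : ℝ≥0∞) ∂condNoiseLaw lam a = ENNReal.ofReal (lam / (1 - a)) := by
  have h1a : 0 < 1 - a := by linarith [ha.2]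
  rw [condNoiseLaw, lintegral_inarPath]
  · rfl
  · rw [Set.projIcc_of_mem zero_le_one ⟨ha.1.le, ha.2.le⟩]
    change ENNReal.ofReal (lam / (1 - a)) * ENNReal.ofReal a + ENNReal.ofReal lam
      = ENNReal.ofReal (lam / (1 - a))
    rw [← ENNReal.ofReal_mul (by positivity),
      ← ENNReal.ofReal_add (mul_nonneg (by positivity) ha.1.le) hlam]
    congr 1
    field_simp
    ring

/-- The generalized conditional mean of an INAR(1) sequence given its thinning parameter. -/
lemma condMean_ae_eq {Ω₀ : Type*} [MeasurableSpace Ω₀] {P₀ : Measure Ω₀} [IsProbabilityMeasure P₀]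
    {α₀ : Ω₀ → ℝ} {X₀ : ℕ → Ω₀ → ℕ} {ξ₀ : ℕ → ℕ → Ω₀ → ℕ} {ε₀ : ℕ → Ω₀ → ℕ} (hlam : 0 ≤ lam)
    (h : IsRandomizedINAR1 lam α₀ X₀ ξ₀ ε₀ P₀) [IsProbabilityMeasure P] (hα : Measurable α)
    (hid : IdentDistrib (fun ω => (α ω, fun k => X k ω)) (fun ω => (α₀ ω, fun k => X₀ k ω)) P P₀)
    (k : ℕ) : ∀ᵐ ω ∂P, condMean P α (X k) ω = lam / (1 - α ω) := by
  have hidα : IdentDistrib α α₀ P P₀ := hid.comp measurable_fst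
  have hmem : ∀ᵐ a ∂P₀.map α₀, a ∈ Set.Ioo (0 : ℝ) 1 :=
    (ae_map_iff h.measurable_param.aemeasurable measurableSet_Ioo).2 h.param_mem
  have hmemP : ∀ᵐ ω ∂P, α ω ∈ Set.Ioo (0 : ℝ) 1 := by
    rw [← hidα.map_eq] at hmem
    exact (ae_map_iff hα.aemeasurable measurableSet_Ioo).1 hmem
  have hmean : Measurable fun a : ℝ => ENNReal.ofReal (lam / (1 - a)) := by fun_prop
  -- The candidate is measurable with respect to `α`, so equality of integrals over the sets `α ⁻¹'
  -- S` suffices. These integrals transfer to the reference model and then to the conditional law.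
  have key : (fun ω => ENNReal.ofReal (lam / (1 - α ω))) =ᵐ[P]
      condLExp (MeasurableSpace.comap α inferInstance) P (fun ω => (X k ω : ℝ≥0∞)) := by
    refine ae_eq_condLExp hα.comap_le P _ (hmean.comp (comap_measurable α)) ?_
    rintro _ ⟨S, hS, rfl⟩
    rw [← lintegral_indicator (hα hS), ← lintegral_indicator (hα hS)]
    let f : ℝ × (ℕ → ℕ) → ℝ≥0∞ := fun x => S.indicator 1 x.1 * (x.2 k : ℝ≥0∞)
    have hf : Measurable f := ((measurable_one.indicator hS).comp measurable_fst).mul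
      (measurable_from_nat.comp ((measurable_pi_apply k).comp measurable_snd))
    have e1 : ∀ ω, (α ⁻¹' S).indicator (fun ω => ENNReal.ofReal (lam / (1 - α ω))) ω
        = S.indicator (fun a => ENNReal.ofReal (lam / (1 - a))) (α ω) := fun ω => rfl
    have e2 : ∀ ω, (α ⁻¹' S).indicator (fun ω => (X k ω : ℝ≥0∞)) ω
        = f (α ω, fun k => X k ω) := fun ω => by
      simp only [f]
      by_cases hω : α ω ∈ S <;> simp [hω]
    have hE := (hid.comp hf).lintegral_eq
    simp only [Function.comp_def] at hE
    simp_rw [e1, e2]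
    rw [hE, h.lintegral_eq hlam f hf,
      ← lintegral_map (f := S.indicator fun a => ENNReal.ofReal (lam / (1 - a)))
        (hmean.indicator hS) hα, hidα.map_eq]
    refine lintegral_congr_ae ?_
    filter_upwards [hmem] with a ha
    simp only [f]
    have hmX : Measurable fun η => (inarPath η k : ℝ≥0∞) :=
      measurable_from_nat.comp (measurable_inarPath k)
    rw [lintegral_const_mul _ hmX, lintegral_condNoiseLaw hlam ha]
    by_cases haS : a ∈ S <;> simp [haS]
  filter_upwards [key, hmemP] with ω hω hm
  rw [condMean, ← hω, ENNReal.toReal_ofReal (div_nonneg hlam (by linarith [hm.2]))]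

end Model

/-! ### The central limit theorem for one copy -/

/-- The long-run variance of the stationary INAR(1) sequence with thinning parameter `a`. -/
noncomputable def longRunVariance (lam a : ℝ) : ℝ := lam * (1 + a) / (1 - a) ^ 2

lemma longRunVariance_nonneg {lam a : ℝ} (hlam : 0 ≤ lam) (ha : a ∈ Set.Ioo (0 : ℝ) 1) :
    0 ≤ longRunVariance lam a := by
  have := ha.1
  unfold longRunVariance; positivity

lemma measurable_longRunVariance (lam : ℝ) : Measurable (longRunVariance lam) := by
  unfold longRunVariance; fun_prop

section OneCopy

variable {κ : Type*} [Fintype κ] (τ : κ → ℝ≥0) (θ : κ → ℝ)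

/-- The normalized linear combination of centred partial sums of the path `x`. -/
noncomputable def centredSum (lam : ℝ) (n : ℕ) (a : ℝ) (x : ℕ → ℕ) : ℝ :=
  (n : ℝ) ^ (-(1 / 2) : ℝ)
    * ∑ t, θ t * ∑ k ∈ Finset.Icc 1 ⌊(n : ℝ) * (τ t : ℝ)⌋₊, ((x k : ℝ) - lam / (1 - a))

lemma measurable_centredSum (lam : ℝ) (n : ℕ) :
    Measurable fun p : ℝ × (ℕ → ℕ) => centredSum τ θ lam n p.1 p.2 := by
  have hk : ∀ k, Measurable fun p : ℝ × (ℕ → ℕ) => (p.2 k : ℝ) := fun k =>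
    measurable_from_nat.comp ((measurable_pi_apply k).comp measurable_snd)
  unfold centredSum
  refine Measurable.const_mul (Finset.measurable_sum _ fun t _ => Measurable.const_mul
    (Finset.measurable_sum _ fun k _ => (hk k).sub ?_) _) _
  fun_prop

/-- The characteristic function is the generating function evaluated at unimodular `z k`, times the
deterministic phase of the centring; `w = 1 + v` converts one recursion into the other. -/
lemma integral_exp_centredSum_condNoiseLaw {lam a : ℝ} (hlam : 0 ≤ lam)
    (ha : a ∈ Set.Ioo (0 : ℝ) 1) (n : ℕ) (v : ℕ → ℂ)
    (hvm : v (⌊(n : ℝ) * ∑ s, (τ s : ℝ)⌋₊ + 1) = 0)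
    (hv : ∀ k ≤ ⌊(n : ℝ) * ∑ s, (τ s : ℝ)⌋₊, v k
      = Complex.exp (Complex.I * ((n : ℝ) ^ (-(1 / 2) : ℝ) * stepCoeff τ θ n k : ℝ))
        * (1 + a * v (k + 1)) - 1) :
    ∫ η, Complex.exp (Complex.I * (centredSum τ θ lam n a (inarPath η) : ℝ)) ∂condNoiseLaw lam a
      = Complex.exp (lam * (v 0 / (1 - a)
        + ∑ k ∈ Finset.range ⌊(n : ℝ) * ∑ s, (τ s : ℝ)⌋₊, v (k + 1)
        - Complex.I * (((n : ℝ) ^ (-(1 / 2) : ℝ)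
          * ∑ k ∈ Finset.range (⌊(n : ℝ) * ∑ s, (τ s : ℝ)⌋₊ + 1), stepCoeff τ θ n k : ℝ) : ℂ)
            / (1 - a))) := by
  have h1a : 0 < 1 - a := by linarith [ha.2]
  set m := ⌊(n : ℝ) * ∑ s, (τ s : ℝ)⌋₊ with hm
  set δ := (n : ℝ) ^ (-(1 / 2) : ℝ) with hδ
  set z : ℕ → ℂ := fun k => Complex.exp (Complex.I * (δ * stepCoeff τ θ n k : ℝ)) with hz
  have e : ∀ x : ℕ → ℕ, Complex.exp (Complex.I * (centredSum τ θ lam n a x : ℝ))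
      = Complex.exp (-(Complex.I * (δ * ∑ k ∈ Finset.range (m + 1), stepCoeff τ θ n k : ℝ)
          * (lam / (1 - a))))
        * ∏ k ∈ Finset.range (m + 1), z k ^ x k := fun x => by
    rw [centredSum, ← sum_stepCoeff_mul, ← hm, ← hδ]
    simp only [hz, ← Complex.exp_nat_mul]
    rw [← Complex.exp_sum, ← Complex.exp_add]
    congr 1
    push_cast
    simp only [Finset.mul_sum, Finset.sum_mul]
    rw [← Finset.sum_neg_distrib, ← Finset.sum_add_distrib]
    exact Finset.sum_congr rfl fun k _ => by ring
  simp_rw [e]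
  rw [integral_const_mul, condNoiseLaw, integral_prod_pow_inarPath _ _ _ m z (fun k => 1 + v k)]
  · rw [← Complex.exp_add, Real.coe_toNNReal _ hlam, Real.coe_toNNReal _ (by positivity)]
    congr 1
    simp only [add_sub_cancel_left]
    push_cast
    ring
  · intro k
    rw [hz]
    simp only
    rw [mul_comm, Complex.norm_exp_ofReal_mul_I]
  · rw [hv m le_rfl, hvm]
    simp [hz]
  · intro k hk
    rw [hv k hk.le, Set.projIcc_of_mem zero_le_one ⟨ha.1.le, ha.2.le⟩]
    simp only [hz]
    ring

lemma tendsto_integral_exp_centredSum_condNoiseLaw {lam a : ℝ} (hlam : 0 ≤ lam)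
    (ha : a ∈ Set.Ioo (0 : ℝ) 1) :
    Tendsto (fun n : ℕ =>
      ∫ η, Complex.exp (Complex.I * (centredSum τ θ lam n a (inarPath η) : ℝ))
        ∂condNoiseLaw lam a) atTop
      (𝓝 (Real.exp (-(longRunVariance lam a * (brownianForm τ θ / 2))) : ℝ)) := by
  choose v hvm hv using fun n : ℕ => exists_backward_recursion a
    (fun k => Complex.exp (Complex.I * ((n : ℝ) ^ (-(1 / 2) : ℝ) * stepCoeff τ θ n k : ℝ)))
    ⌊(n : ℝ) * ∑ s, (τ s : ℝ)⌋₊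
  simp_rw [fun n => integral_exp_centredSum_condNoiseLaw τ θ hlam ha n (v n) (hvm n) (hv n)]
  have h := ((tendsto_log_generating τ θ ha.1 ha.2 v hvm hv).const_mul (lam : ℂ)).cexp
  convert h using 2
  rw [← Complex.ofReal_mul, ← Complex.ofReal_exp, longRunVariance]
  congr 2
  ring

lemma IsRandomizedINAR1.tendsto_integral_exp_centredSum {Ω : Type*} [MeasurableSpace Ω]
    {lam : ℝ} {α : Ω → ℝ} {X : ℕ → Ω → ℕ} {ξ : ℕ → ℕ → Ω → ℕ} {ε : ℕ → Ω → ℕ} {P : Measure Ω}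
    [IsProbabilityMeasure P] (hlam : 0 ≤ lam) (h : IsRandomizedINAR1 lam α X ξ ε P) :
    Tendsto (fun n : ℕ => ∫ ω, Complex.exp
      (Complex.I * (centredSum τ θ lam n (α ω) (fun k => X k ω) : ℝ)) ∂P) atTop
      (𝓝 (∫ ω, Real.exp (-(longRunVariance lam (α ω) * (brownianForm τ θ / 2))) ∂P : ℝ)) := by
  have hmem : ∀ᵐ a ∂P.map α, a ∈ Set.Ioo (0 : ℝ) 1 :=
    (ae_map_iff h.measurable_param.aemeasurable measurableSet_Ioo).2 h.param_mem
  have : IsProbabilityMeasure (P.map α) :=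
    Measure.isProbabilityMeasure_map h.measurable_param.aemeasurable
  have hf : ∀ n, Measurable fun p : ℝ × (ℕ → ℕ) =>
      Complex.exp (Complex.I * (centredSum τ θ lam n p.1 p.2 : ℝ)) := fun n =>
    Complex.measurable_exp.comp ((Complex.measurable_ofReal.comp
      (measurable_centredSum τ θ lam n)).const_mul _)
  have hnorm : ∀ x : ℝ, ‖Complex.exp (Complex.I * x)‖ ≤ 1 := fun x => by
    rw [mul_comm, Complex.norm_exp_ofReal_mul_I]
  have hrepr : ∀ n : ℕ, ∫ ω, Complex.exp
      (Complex.I * (centredSum τ θ lam n (α ω) (fun k => X k ω) : ℝ)) ∂P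
      = ∫ a, ∫ η, Complex.exp (Complex.I * (centredSum τ θ lam n a (inarPath η) : ℝ))
        ∂condNoiseLaw lam a ∂P.map α := fun n =>
    h.integral_eq hlam (fun p => Complex.exp (Complex.I * (centredSum τ θ lam n p.1 p.2 : ℝ)))
      (hf n) fun x => hnorm _
  have hp : Measurable fun q : ℝ × (ℕ → ℕ → ℕ) => (q.1, inarPath q.2) :=
    measurable_fst.prodMk
      (measurable_pi_lambda _ fun k => (measurable_inarPath k).comp measurable_snd)
  -- Integrals against the kernel `condDistrib` are measurable in `a`, as dominated convergence
  -- requires; the explicit law returns almost everywhere when the pointwise limit is taken.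
  have hrepr2 : ∀ n : ℕ, ∫ ω, Complex.exp
      (Complex.I * (centredSum τ θ lam n (α ω) (fun k => X k ω) : ℝ)) ∂P
      = ∫ a, ∫ η, Complex.exp (Complex.I * (centredSum τ θ lam n a (inarPath η) : ℝ))
        ∂condDistrib (modelNoise X ξ ε) α P a ∂P.map α := fun n => by
    rw [hrepr]
    refine integral_congr_ae ?_
    filter_upwards [h.condDistrib_modelNoise hlam] with a ha
    rw [ha]
  rw [← integral_map (f := fun a => Real.exp (-(longRunVariance lam a * (brownianForm τ θ / 2))))
    h.measurable_param.aemeasurable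
    (((measurable_longRunVariance lam).mul_const _).neg.exp).aestronglyMeasurable,
    ← integral_complex_ofReal]
  simp_rw [hrepr2]
  refine tendsto_integral_of_dominated_convergence (fun _ => 1) (fun n => ?_)
    (integrable_const 1) (fun n => ae_of_all _ fun a => ?_) ?_
  · exact (((hf n).comp hp).stronglyMeasurable.integral_kernel_prod_right'
      (κ := condDistrib (modelNoise X ξ ε) α P)).aestronglyMeasurable
  · refine (norm_integral_le_of_norm_le_const (ae_of_all _ fun η => hnorm _)).trans ?_
    simp
  · filter_upwards [h.condDistrib_modelNoise hlam, hmem] with a ha ha1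
    rw [ha]
    exact tendsto_integral_exp_centredSum_condNoiseLaw τ θ hlam ha1

end OneCopy

/-! ### Convergence in distribution and uniqueness in a finite power of the real line -/

section Pi

variable {κ : Type*} [Fintype κ]

lemma charFun_map_toLp {Ω : Type*} [MeasurableSpace Ω] {P : Measure Ω} {X : Ω → κ → ℝ}
    (hX : AEMeasurable X P) (θ : EuclideanSpace ℝ κ) :
    charFun (P.map fun ω => WithLp.toLp 2 (X ω)) θ
      = ∫ ω, Complex.exp (Complex.I * (∑ t, θ t * X ω t : ℝ)) ∂P := by
  have hm : AEMeasurable (fun ω => (WithLp.toLp 2 (X ω) : EuclideanSpace ℝ κ)) P :=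
    (by fun_prop : Measurable (WithLp.toLp 2 : (κ → ℝ) → EuclideanSpace ℝ κ)).comp_aemeasurable hX
  rw [charFun_apply, integral_map hm (by fun_prop)]
  congr with ω
  rw [mul_comm]
  congr 2

/-- Lévy's continuity theorem in Euclidean space, transported along the homeomorphism with the plain
function space. -/
lemma tendstoInDistribution_of_tendsto_integral_exp {Ω : ℕ → Type*} [∀ n, MeasurableSpace (Ω n)]
    {Ω' : Type*} [MeasurableSpace Ω'] {P : ∀ n, Measure (Ω n)} [∀ n, IsProbabilityMeasure (P n)]
    {P' : Measure Ω'} [IsProbabilityMeasure P'] {X : ∀ n, Ω n → κ → ℝ} {Z : Ω' → κ → ℝ}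
    (hX : ∀ n, AEMeasurable (X n) (P n)) (hZ : AEMeasurable Z P')
    (h : ∀ θ : κ → ℝ, Tendsto
      (fun n => ∫ ω, Complex.exp (Complex.I * (∑ t, θ t * X n ω t : ℝ)) ∂P n) atTop
      (𝓝 (∫ ω, Complex.exp (Complex.I * (∑ t, θ t * Z ω t : ℝ)) ∂P'))) :
    TendstoInDistribution X atTop Z P P' := by
  have hm : Measurable (WithLp.toLp 2 : (κ → ℝ) → EuclideanSpace ℝ κ) := by fun_prop
  have h2 : TendstoInDistribution (fun n ω => (WithLp.toLp 2 (X n ω) : EuclideanSpace ℝ κ)) atTop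
      (fun ω => WithLp.toLp 2 (Z ω)) P P' := by
    refine ⟨fun n => hm.comp_aemeasurable (hX n), hm.comp_aemeasurable hZ, ?_⟩
    refine ProbabilityMeasure.tendsto_of_tendsto_charFun fun θ => ?_
    simp only [ProbabilityMeasure.coe_mk]
    rw [charFun_map_toLp hZ]
    simp_rw [fun n => charFun_map_toLp (hX n) θ]
    exact h θ
  exact h2.continuous_comp (g := WithLp.ofLp) (by fun_prop)

lemma measure_pi_ext_of_integral_exp {μ ν : Measure (κ → ℝ)} [IsProbabilityMeasure μ]
    [IsProbabilityMeasure ν]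
    (h : ∀ θ : κ → ℝ, ∫ x, Complex.exp (Complex.I * (∑ t, θ t * x t : ℝ)) ∂μ
      = ∫ x, Complex.exp (Complex.I * (∑ t, θ t * x t : ℝ)) ∂ν) : μ = ν := by
  refine (MeasurableEquiv.toLp 2 (κ → ℝ)).map_measurableEquiv_injective ?_
  have : IsProbabilityMeasure (μ.map (MeasurableEquiv.toLp 2 (κ → ℝ))) :=
    Measure.isProbabilityMeasure_map (MeasurableEquiv.measurable _).aemeasurable
  have : IsProbabilityMeasure (ν.map (MeasurableEquiv.toLp 2 (κ → ℝ))) :=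
    Measure.isProbabilityMeasure_map (MeasurableEquiv.measurable _).aemeasurable
  refine Measure.ext_of_charFun (funext fun θ => ?_)
  have h1 := charFun_map_toLp (P := μ) (X := fun x => x) aemeasurable_id θ
  have h2 := charFun_map_toLp (P := ν) (X := fun x => x) aemeasurable_id θ
  exact h1.trans ((h θ).trans h2.symm)

end Pi

/-! ### Mixtures of a Brownian motion -/

section Mixture

variable {κ : Type*} [Fintype κ] {Ω' : Type*} [MeasurableSpace Ω'] {P' : Measure Ω'}

lemma _root_.ProbabilityTheory.IsPreBrownianReal.integral_exp_sum {B : ℝ≥0 → Ω' → ℝ}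
    (hB : IsPreBrownianReal B P')
    (I : Finset ℝ≥0) (θ : I → ℝ) :
    ∫ ω, Complex.exp (Complex.I * (∑ t : I, θ t * B t ω : ℝ)) ∂P'
      = Real.exp (-(brownianForm (fun t : I => (t : ℝ≥0)) θ / 2)) := by
  have h := charFun_map_toLp (hB.hasLaw I).aemeasurable (WithLp.toLp 2 θ)
  have e : (P'.map fun ω => WithLp.toLp 2 (I.restrict (B · ω)))
      = multivariateGaussian 0 (BrownianReal.covMatrix I) := by
    have h1 : P'.map (fun ω => WithLp.toLp 2 (I.restrict (B · ω)))
        = (P'.map fun ω => I.restrict (B · ω)).map (WithLp.toLp 2) := by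
      rw [AEMeasurable.map_map_of_aemeasurable (by fun_prop) (hB.hasLaw I).aemeasurable]
      rfl
    rw [h1, (hB.hasLaw I).map_eq,
      (BrownianReal.measurePreserving_toLp_projectiveFamily I).map_eq]
  rw [e, charFun_multivariateGaussian (BrownianReal.posSemidef_covMatrix I)] at h
  refine h.symm.trans ?_
  rw [Complex.ofReal_exp]
  congr 1
  simp only [inner_zero_right, Complex.ofReal_zero, zero_mul, zero_sub]
  push_cast
  congr 2
  simp only [brownianForm, Matrix.mulVec, dotProduct, BrownianReal.covMatrix_apply,
    Finset.mul_sum]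
  push_cast
  exact Finset.sum_congr rfl fun s _ => Finset.sum_congr rfl fun t _ => by ring

/-- The characteristic function of the finite dimensional distributions of `√Y B`, for `Y ≥ 0`
independent of the Brownian motion `B`. -/
lemma integral_exp_sqrt_mul_brownian [IsProbabilityMeasure P'] {Y : Ω' → ℝ} {B : ℝ≥0 → Ω' → ℝ}
    (hY : Measurable Y) (hBm : ∀ t, Measurable (B t)) (hY0 : ∀ᵐ ω ∂P', 0 ≤ Y ω)
    (hB : IsPreBrownianReal B P') (hind : IndepFun Y (fun ω t => B t ω) P')
    (I : Finset ℝ≥0) (θ : I → ℝ) :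
    ∫ ω, Complex.exp (Complex.I * (∑ t : I, θ t * (Real.sqrt (Y ω) * B t ω) : ℝ)) ∂P'
      = (∫ ω, Real.exp (-(Y ω * (brownianForm (fun t : I => (t : ℝ≥0)) θ / 2))) ∂P' : ℝ) := by
  have hr : Measurable fun (b : ℝ≥0 → ℝ) (t : I) => b t := by fun_prop
  have hBI : Measurable fun ω (t : I) => B t ω := measurable_pi_lambda _ fun t => hBm t
  have hind' : IndepFun Y (fun ω (t : I) => B t ω) P' := hind.comp measurable_id hr
  have hprod := (indepFun_iff_map_prod_eq_prod_map_map hY.aemeasurable hBI.aemeasurable).1 hind'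
  let f : ℝ × (I → ℝ) → ℂ :=
    fun p => Complex.exp (Complex.I * (∑ t : I, θ t * (Real.sqrt p.1 * p.2 t) : ℝ))
  have hf : Measurable f := by
    refine Complex.measurable_exp.comp ((Complex.measurable_ofReal.comp ?_).const_mul _)
    fun_prop
  have : IsProbabilityMeasure (P'.map Y) := Measure.isProbabilityMeasure_map hY.aemeasurable
  have : IsProbabilityMeasure (P'.map fun ω (t : I) => B t ω) :=
    Measure.isProbabilityMeasure_map hBI.aemeasurable
  have hY0' : ∀ᵐ y ∂P'.map Y, 0 ≤ y := (ae_map_iff hY.aemeasurable measurableSet_Ici).2 hY0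
  rw [← integral_map (f := fun y => Real.exp (-(y * (brownianForm (fun t : I => (t : ℝ≥0)) θ / 2))))
    hY.aemeasurable (by fun_prop), ← integral_complex_ofReal]
  calc _ = ∫ ω, f (Y ω, fun t : I => B t ω) ∂P' := rfl
    _ = ∫ p, f p ∂((P'.map Y).prod (P'.map fun ω (t : I) => B t ω)) := by
        rw [← hprod, integral_map (hY.prodMk hBI).aemeasurable hf.aestronglyMeasurable]
    _ = ∫ y, ∫ b, f (y, b) ∂(P'.map fun ω (t : I) => B t ω) ∂P'.map Y := by
        refine integral_prod _ (Integrable.of_bound hf.aestronglyMeasurable 1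
          (ae_of_all _ fun p => ?_))
        simp only [f]
        rw [mul_comm, Complex.norm_exp_ofReal_mul_I]
    _ = _ := by
        refine integral_congr_ae ?_
        filter_upwards [hY0'] with y hy
        have hfy : Measurable fun b : I → ℝ => f (y, b) := hf.comp measurable_prodMk_left
        rw [integral_map hBI.aemeasurable hfy.aestronglyMeasurable]
        -- For fixed `y` the factor `√y` is absorbed into the weights, and the quadratic form turns
        -- it into `y`.
        have h := hB.integral_exp_sum I fun t => Real.sqrt y * θ t
        rw [brownianForm_smul, Real.sq_sqrt hy, mul_div_assoc] at h
        rw [← h]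
        congr with ω
        simp only [f]
        congr 3
        exact Finset.sum_congr rfl fun t _ => by ring

end Mixture

/-! ### The tail of the long-run variance -/

/-- Near `0` the bound `1 - exp (-(b v)) ≤ b v` leaves `v ^ (-ρ)`, integrable since `ρ < 1`; at
infinity the factor is at most `1` and `ρ > 0` suffices. -/
lemma integrableOn_one_sub_exp_mul_rpow {b ρ : ℝ} (hb : 0 < b) (hρ : 0 < ρ) (hρ1 : ρ < 1) :
    IntegrableOn (fun v : ℝ => (1 - Real.exp (-(b * v))) * v ^ (-ρ - 1)) (Set.Ioi 0) := by
  have hm : Measurable fun v : ℝ => (1 - Real.exp (-(b * v))) * v ^ (-ρ - 1) := by fun_prop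
  rw [← Set.Ioc_union_Ioi_eq_Ioi zero_le_one]
  refine IntegrableOn.union ?_ ?_
  · have h1 : IntegrableOn (fun v : ℝ => b * v ^ (-ρ)) (Set.Ioc 0 1) :=
      ((intervalIntegrable_iff_integrableOn_Ioc_of_le zero_le_one).1
        (intervalIntegral.intervalIntegrable_rpow' (by linarith))).const_mul b
    refine h1.mono' hm.aestronglyMeasurable ((ae_restrict_iff' measurableSet_Ioc).2
      (ae_of_all _ fun v hv => ?_))
    have hv0 : 0 < v := hv.1
    have he : Real.exp (-(b * v)) ≤ 1 := Real.exp_le_one_iff.2 (by nlinarith)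
    have he2 := Real.add_one_le_exp (-(b * v))
    rw [norm_mul, Real.norm_of_nonneg (by linarith), Real.norm_of_nonneg (by positivity),
      Real.rpow_sub_one hv0.ne', ← mul_div_assoc, div_le_iff₀ hv0]
    have : (1 - Real.exp (-(b * v))) ≤ b * v := by linarith
    have hp : 0 ≤ v ^ (-ρ) := by positivity
    nlinarith
  · refine (integrableOn_Ioi_rpow_of_lt (a := -ρ - 1) (by linarith) one_pos).mono'
      hm.aestronglyMeasurable ((ae_restrict_iff' measurableSet_Ioi).2 (ae_of_all _ fun v hv => ?_))
    have hv0 : (0 : ℝ) < v := lt_trans one_pos hv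
    have he : Real.exp (-(b * v)) ≤ 1 := Real.exp_le_one_iff.2 (by nlinarith)
    have he2 := Real.exp_pos (-(b * v))
    rw [norm_mul, Real.norm_of_nonneg (by linarith), Real.norm_of_nonneg (by positivity)]
    have hp : 0 ≤ v ^ (-ρ - 1) := by positivity
    nlinarith

/-- Integration by parts against the antiderivative `-v ^ (-ρ) / ρ`: the boundary terms vanish for
`0 < ρ < 1`, and a Gamma integral remains. -/
lemma integral_one_sub_exp_mul_rpow {b ρ : ℝ} (hb : 0 < b) (hρ : 0 < ρ) (hρ1 : ρ < 1) :
    ∫ v in Set.Ioi (0 : ℝ), (1 - Real.exp (-(b * v))) * v ^ (-ρ - 1)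
      = b ^ ρ / ρ * Real.Gamma (1 - ρ) := by
  have hu : ∀ x ∈ Set.Ioi (0 : ℝ), HasDerivAt (fun v => 1 - Real.exp (-(b * v)))
      (b * Real.exp (-(b * x))) x := fun x _ => by
    have h := (((hasDerivAt_id x).const_mul b).neg.exp).const_sub 1
    refine HasDerivAt.congr_deriv (f := fun v => 1 - Real.exp (-(b * v))) h ?_
    simp only [Pi.neg_apply, id_eq]
    ring
  have hv : ∀ x ∈ Set.Ioi (0 : ℝ), HasDerivAt (fun v : ℝ => -(v ^ (-ρ) / ρ)) (x ^ (-ρ - 1)) x :=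
    fun x hx => by
    have h := ((Real.hasDerivAt_rpow_const (x := x) (p := -ρ)
      (Or.inl (ne_of_gt hx))).div_const ρ).neg
    refine HasDerivAt.congr_deriv (f := fun v : ℝ => -(v ^ (-ρ) / ρ)) h ?_
    field_simp
  have hexp : IntegrableOn (fun x : ℝ => x ^ (-ρ) * Real.exp (-(b * x))) (Set.Ioi 0) := by
    have := integrableOn_rpow_mul_exp_neg_mul_rpow (s := -ρ) (p := 1) (by linarith) one_pos hb
    simpa using this
  have hu'v : IntegrableOn (fun x : ℝ => b * Real.exp (-(b * x)) * -(x ^ (-ρ) / ρ)) (Set.Ioi 0) := by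
    refine (hexp.const_mul (-(b / ρ))).congr (ae_of_all _ fun x => ?_)
    simp only
    ring
  have hbound : ∀ x : ℝ, 0 < x → 1 - Real.exp (-(b * x)) ≤ b * x := fun x _ => by
    have := Real.add_one_le_exp (-(b * x)); linarith
  have hle : ∀ x : ℝ, 0 < x → 0 ≤ 1 - Real.exp (-(b * x)) := fun x hx => by
    have : Real.exp (-(b * x)) ≤ 1 := Real.exp_le_one_iff.2 (by nlinarith)
    linarith
  have h0 : Tendsto (fun x : ℝ => (1 - Real.exp (-(b * x))) * -(x ^ (-ρ) / ρ)) (𝓝[>] 0) (𝓝 0) := by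
    have hlim : Tendsto (fun x : ℝ => b / ρ * x ^ (1 - ρ)) (𝓝[>] 0) (𝓝 0) := by
      have := ((Real.continuousAt_rpow_const 0 (1 - ρ) (Or.inr (by linarith))).tendsto.const_mul
        (b / ρ)).mono_left (nhdsWithin_le_nhds (s := Set.Ioi 0))
      rwa [Real.zero_rpow (by linarith), mul_zero] at this
    refine squeeze_zero_norm' ?_ hlim
    filter_upwards [self_mem_nhdsWithin] with x hx
    have hx : 0 < x := hx
    rw [norm_mul, norm_neg, Real.norm_of_nonneg (hle x hx), Real.norm_of_nonneg (by positivity)]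
    calc _ ≤ b * x * (x ^ (-ρ) / ρ) := by gcongr; exact hbound x hx
      _ = _ := by
        rw [show (1 - ρ) = -ρ + 1 by ring, Real.rpow_add_one hx.ne']
        ring
  have hinf : Tendsto (fun x : ℝ => (1 - Real.exp (-(b * x))) * -(x ^ (-ρ) / ρ)) atTop (𝓝 0) := by
    have hlim : Tendsto (fun x : ℝ => x ^ (-ρ) / ρ) atTop (𝓝 0) := by
      simpa using (tendsto_rpow_neg_atTop hρ).div_const ρ
    refine squeeze_zero_norm' ?_ hlim
    filter_upwards [eventually_gt_atTop 0] with x hx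
    rw [norm_mul, norm_neg, Real.norm_of_nonneg (hle x hx), Real.norm_of_nonneg (by positivity)]
    refine mul_le_of_le_one_left (by positivity) ?_
    linarith [Real.exp_pos (-(b * x))]
  have key := integral_Ioi_mul_deriv_eq_deriv_mul hu hv
    (integrableOn_one_sub_exp_mul_rpow hb hρ hρ1) hu'v h0 hinf
  rw [key]
  have hG := Real.integral_rpow_mul_exp_neg_mul_Ioi (a := 1 - ρ) (r := b) (by linarith) hb
  have e : ∀ x : ℝ, b * Real.exp (-(b * x)) * -(x ^ (-ρ) / ρ)
      = -(b / ρ) * (x ^ (1 - ρ - 1) * Real.exp (-(b * x))) := fun x => by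
    rw [show 1 - ρ - 1 = -ρ by ring]; ring
  simp_rw [e]
  rw [integral_const_mul, hG, one_div, Real.inv_rpow hb.le, Real.rpow_sub hb, Real.rpow_one]
  field_simp
  ring

/-- The change of variables `v = u⁻²`, with Jacobian, which leads to the exponent `ρ = (1 + β) / 2`.
-/
lemma one_sub_exp_div_sq_mul_rpow_eq {b β u : ℝ} (hu : 0 < u) :
    (1 - Real.exp (-(b / u ^ 2))) * u ^ β
      = (|(-2 : ℝ)| * u ^ ((-2 : ℝ) - 1)) •
        (1 / 2 * ((1 - Real.exp (-(b * u ^ (-2 : ℝ))))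
          * (u ^ (-2 : ℝ)) ^ (-((1 + β) / 2) - 1))) := by
  rw [← Real.rpow_mul hu.le, smul_eq_mul]
  have h : u ^ β = u ^ ((-2 : ℝ) - 1) * u ^ (-2 * (-((1 + β) / 2) - 1)) := by
    rw [← Real.rpow_add hu]; congr 1; ring
  have h2 : u ^ (-2 : ℝ) = (u ^ 2)⁻¹ := by
    rw [Real.rpow_neg hu.le]; norm_cast
  rw [h, h2, ← div_eq_mul_inv, abs_neg, abs_two]
  ring

lemma integrableOn_one_sub_exp_div_sq_mul_rpow {b β : ℝ} (hb : 0 < b)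
    (hβ : β ∈ Set.Ioo (-1 : ℝ) 1) :
    IntegrableOn (fun u : ℝ => (1 - Real.exp (-(b / u ^ 2))) * u ^ β) (Set.Ioi 0) := by
  have h := (integrableOn_Ioi_comp_rpow_iff (fun v : ℝ => 1 / 2 * ((1 - Real.exp (-(b * v)))
    * v ^ (-((1 + β) / 2) - 1))) (p := -2) (by norm_num)).2
    ((integrableOn_one_sub_exp_mul_rpow hb (by linarith [hβ.1]) (by linarith [hβ.2])).const_mul _)
  exact h.congr_fun (fun u hu => (one_sub_exp_div_sq_mul_rpow_eq hu).symm) measurableSet_Ioi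

lemma integral_one_sub_exp_div_sq_mul_rpow {b β : ℝ} (hb : 0 < b) (hβ : β ∈ Set.Ioo (-1 : ℝ) 1) :
    ∫ u in Set.Ioi (0 : ℝ), (1 - Real.exp (-(b / u ^ 2))) * u ^ β
      = b ^ ((1 + β) / 2) / (1 + β) * Real.Gamma ((1 - β) / 2) := by
  have h := integral_comp_rpow_Ioi (fun v : ℝ => 1 / 2 * ((1 - Real.exp (-(b * v)))
    * v ^ (-((1 + β) / 2) - 1))) (p := -2) (by norm_num)
  rw [setIntegral_congr_fun measurableSet_Ioi fun u hu => one_sub_exp_div_sq_mul_rpow_eq hu, h,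
    integral_const_mul, integral_one_sub_exp_mul_rpow hb (by linarith [hβ.1]) (by linarith [hβ.2]),
    show 1 - (1 + β) / 2 = (1 - β) / 2 by ring]
  have : 1 + β ≠ 0 := by linarith [hβ.1]
  field_simp

/-- The density of the mixing distribution on the whole real line. -/
noncomputable def mixingDensity (ψ : ℝ → ℝ) (β : ℝ) : ℝ → ℝ :=
  (Set.Ioo (0 : ℝ) 1).indicator fun x => ψ x * (1 - x) ^ β

section Mixing

variable {Ω : Type*} [MeasurableSpace Ω] {α : Ω → ℝ} {P : Measure Ω} {ψ : ℝ → ℝ} {β ψ₁ : ℝ}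

lemma HasMixingDensity.mixingDensity_nonneg (h : HasMixingDensity α P ψ β ψ₁) (x : ℝ) :
    0 ≤ mixingDensity ψ β x := by
  refine Set.indicator_nonneg (fun x hx => ?_) x
  exact mul_nonneg (h.nonneg x hx) (Real.rpow_nonneg (by linarith [hx.2]) _)

lemma HasMixingDensity.aemeasurable_density (h : HasMixingDensity α P ψ β ψ₁) :
    AEMeasurable (fun x => ψ x * (1 - x) ^ β) (volume.restrict (Set.Ioo (0 : ℝ) 1)) :=
  h.aemeasurable.mul (by fun_prop)

lemma HasMixingDensity.integral_comp (h : HasMixingDensity α P ψ β ψ₁) (hα : Measurable α)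
    {g : ℝ → ℝ} (hg : Measurable g) :
    ∫ ω, g (α ω) ∂P = ∫ x, g x * mixingDensity ψ β x := by
  rw [← integral_map hα.aemeasurable hg.aestronglyMeasurable, h.law,
    integral_withDensity_eq_integral_toReal_smul₀ h.aemeasurable_density.ennreal_ofReal
      (ae_of_all _ fun x => ENNReal.ofReal_lt_top), ← integral_indicator measurableSet_Ioo]
  refine integral_congr_ae (ae_of_all _ fun x => ?_)
  simp only [mixingDensity]
  by_cases hx : x ∈ Set.Ioo (0 : ℝ) 1
  · simp only [Set.indicator_of_mem hx, smul_eq_mul]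
    rw [ENNReal.toReal_ofReal (mul_nonneg (h.nonneg x hx)
      (Real.rpow_nonneg (by linarith [hx.2]) _)), mul_comm]
  · simp only [Set.indicator_of_notMem hx, mul_zero]

lemma HasMixingDensity.integrable_mixingDensity [IsProbabilityMeasure P]
    (h : HasMixingDensity α P ψ β ψ₁)
    (hα : Measurable α) : Integrable (mixingDensity ψ β) := by
  rw [mixingDensity, integrable_indicator_iff measurableSet_Ioo]
  refine ⟨h.aemeasurable_density.aestronglyMeasurable, ?_⟩
  rw [hasFiniteIntegral_iff_ofReal]
  · have h1 : (P.map α) Set.univ = 1 := by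
      have := Measure.isProbabilityMeasure_map (μ := P) hα.aemeasurable
      exact measure_univ
    rw [h.law, withDensity_apply _ MeasurableSet.univ, Measure.restrict_univ] at h1
    rw [h1]
    exact ENNReal.one_lt_top
  · refine (ae_restrict_iff' measurableSet_Ioo).2 (ae_of_all _ fun x hx => ?_)
    exact mul_nonneg (h.nonneg x hx) (Real.rpow_nonneg (by linarith [hx.2]) _)

end Mixing

/-! ### Laplace transform of the long-run variance near the origin -/

section Mixing

variable {Ω : Type*} [MeasurableSpace Ω] {α : Ω → ℝ} {P : Measure Ω}
  {ψ : ℝ → ℝ} {lam β ψ₁ : ℝ}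

lemma measurable_one_sub_exp_longRunVariance (lam c : ℝ) :
    Measurable fun x => 1 - Real.exp (-(c * longRunVariance lam x)) :=
  (((measurable_longRunVariance lam).const_mul c).neg.exp).const_sub 1

lemma one_sub_exp_longRunVariance_mem {c x : ℝ} (hlam : 0 < lam) (hc : 0 ≤ c)
    (hx : x ∈ Set.Ioo (0 : ℝ) 1) :
    0 ≤ 1 - Real.exp (-(c * longRunVariance lam x)) ∧
      1 - Real.exp (-(c * longRunVariance lam x)) ≤ 1 ∧
      1 - Real.exp (-(c * longRunVariance lam x)) ≤ c * longRunVariance lam x := by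
  have hW := mul_nonneg hc (longRunVariance_nonneg hlam.le hx)
  have h1 : Real.exp (-(c * longRunVariance lam x)) ≤ 1 := Real.exp_le_one_iff.2 (by linarith)
  have h2 := Real.add_one_le_exp (-(c * longRunVariance lam x))
  have h3 := Real.exp_pos (-(c * longRunVariance lam x))
  exact ⟨by linarith, by linarith, by linarith⟩

lemma HasMixingDensity.norm_mul_mixingDensity_le (h : HasMixingDensity α P ψ β ψ₁)
    (hlam : 0 < lam) {c : ℝ} (hc : 0 ≤ c) (x : ℝ) :
    ‖(1 - Real.exp (-(c * longRunVariance lam x))) * mixingDensity ψ β x‖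
      ≤ mixingDensity ψ β x := by
  have hD := h.mixingDensity_nonneg x
  by_cases hx : x ∈ Set.Ioo (0 : ℝ) 1
  · obtain ⟨h1, h2, -⟩ := one_sub_exp_longRunVariance_mem hlam hc hx
    rw [norm_mul, Real.norm_of_nonneg h1, Real.norm_of_nonneg hD]
    exact mul_le_of_le_one_left hD h2
  · simp [mixingDensity, Set.indicator_of_notMem hx]

lemma HasMixingDensity.integrable_mul_mixingDensity [IsProbabilityMeasure P]
    (h : HasMixingDensity α P ψ β ψ₁)
    (hα : Measurable α) (hlam : 0 < lam) {c : ℝ} (hc : 0 ≤ c) :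
    Integrable fun x => (1 - Real.exp (-(c * longRunVariance lam x))) * mixingDensity ψ β x :=
  (h.integrable_mixingDensity hα).mono'
    ((measurable_one_sub_exp_longRunVariance lam c).aestronglyMeasurable.mul
      (h.integrable_mixingDensity hα).aestronglyMeasurable)
    (ae_of_all _ fun x => h.norm_mul_mixingDensity_le hlam hc x)

/-- The part of the integral away from the critical value `1` is negligible. -/
lemma HasMixingDensity.tendsto_bulk [IsProbabilityMeasure P] (h : HasMixingDensity α P ψ β ψ₁)
    (hα : Measurable α)
    (hlam : 0 < lam) (hβ : β ∈ Set.Ioo (-1 : ℝ) 1) {δ : ℝ} (hδ : 0 < δ) :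
    Tendsto (fun ε : ℝ => ε ^ (-(1 + β)) * ∫ x in Set.Iic (1 - δ),
      (1 - Real.exp (-(ε ^ 2 * longRunVariance lam x))) * mixingDensity ψ β x) (𝓝[>] 0) (𝓝 0) := by
  have hint := h.integrable_mixingDensity hα
  -- Away from `1` the variance is at most `2 lam / δ²`, so the integral is `O(ε²)`; after
  -- normalization `ε ^ (1 - β)` remains, which tends to `0` since `β < 1`.
  have hlim : Tendsto (fun ε : ℝ => ε ^ (1 - β) * ∫ x, lam * 2 / δ ^ 2 * mixingDensity ψ β x)
      (𝓝[>] 0) (𝓝 0) := by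
    have := ((Real.continuousAt_rpow_const 0 (1 - β)
      (Or.inr (by linarith [hβ.2]))).tendsto.mul_const
      (∫ x, lam * 2 / δ ^ 2 * mixingDensity ψ β x)).mono_left (nhdsWithin_le_nhds (s := Set.Ioi 0))
    rwa [Real.zero_rpow (by linarith [hβ.2]), zero_mul] at this
  refine squeeze_zero_norm' ?_ hlim
  filter_upwards [self_mem_nhdsWithin] with ε hε
  have hε : 0 < ε := hε
  rw [norm_mul, Real.norm_of_nonneg (by positivity),
    show 1 - β = -(1 + β) + (2 : ℕ) by push_cast; ring, Real.rpow_add_natCast hε.ne', mul_assoc,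
    ← integral_const_mul]
  gcongr
  calc ‖∫ x in Set.Iic (1 - δ),
        (1 - Real.exp (-(ε ^ 2 * longRunVariance lam x))) * mixingDensity ψ β x‖
      ≤ ∫ x in Set.Iic (1 - δ), ε ^ 2 * (lam * 2 / δ ^ 2 * mixingDensity ψ β x) := by
        refine norm_integral_le_of_norm_le ((hint.const_mul _).const_mul _).integrableOn
          ((ae_restrict_iff' measurableSet_Iic).2 (ae_of_all _ fun x hx => ?_))
        have hD := h.mixingDensity_nonneg x
        by_cases hx01 : x ∈ Set.Ioo (0 : ℝ) 1
        · obtain ⟨h1, -, h2⟩ := one_sub_exp_longRunVariance_mem hlam (sq_nonneg ε) hx01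
          rw [norm_mul, Real.norm_of_nonneg h1, Real.norm_of_nonneg hD, ← mul_assoc]
          gcongr
          refine h2.trans ?_
          gcongr
          unfold longRunVariance
          have hxδ : δ ≤ 1 - x := by
            have : x ≤ 1 - δ := hx
            linarith
          have := hx01.1
          gcongr
          linarith [hx01.2]
        · simp [mixingDensity, Set.indicator_of_notMem hx01]
    _ ≤ ∫ x, ε ^ 2 * (lam * 2 / δ ^ 2 * mixingDensity ψ β x) := by
        refine setIntegral_le_integral ((hint.const_mul _).const_mul _) (ae_of_all _ fun x => ?_)
        have := h.mixingDensity_nonneg x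
        positivity

/-- The rescaled integrand near the critical value `1`. -/
lemma rescaled_integrand_eq {ε δ u : ℝ} (hε : 0 < ε) (hδ1 : δ < 1) (hu : 0 < u)
    (huδ : ε * u < δ) :
    ε ^ (-(1 + β)) * (ε * (Set.Ioi (1 - δ)).indicator (fun x =>
      (1 - Real.exp (-(ε ^ 2 * longRunVariance lam x))) * mixingDensity ψ β x) (1 - ε * u))
      = (1 - Real.exp (-(lam * (2 - ε * u) / u ^ 2))) * (ψ (1 - ε * u) * u ^ β) := by
  have hm : 1 - ε * u ∈ Set.Ioi (1 - δ) := by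
    simp only [Set.mem_Ioi]; linarith
  have hpos : 0 < ε * u := by positivity
  have hm2 : 1 - ε * u ∈ Set.Ioo (0 : ℝ) 1 := ⟨by linarith, by linarith⟩
  have hW : ε ^ 2 * longRunVariance lam (1 - ε * u) = lam * (2 - ε * u) / u ^ 2 := by
    unfold longRunVariance
    field_simp
    ring
  -- The normalization exactly cancels the Jacobian `ε` and the factor `ε ^ β` of the density.
  have he : ε ^ (-(1 + β)) * (ε * ε ^ β) = 1 := by
    rw [mul_comm ε, ← Real.rpow_add_one hε.ne', ← Real.rpow_add hε,
      show -(1 + β) + (β + 1) = 0 by ring, Real.rpow_zero]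
  rw [Set.indicator_of_mem hm, hW, mixingDensity, Set.indicator_of_mem hm2, sub_sub_cancel,
    Real.mul_rpow hε.le hu.le]
  linear_combination ((1 - Real.exp (-(lam * (2 - ε * u) / u ^ 2)))
    * (ψ (1 - ε * u) * u ^ β)) * he

lemma rescaled_integrand_eq_zero {ε δ u : ℝ} (hε : 0 < ε) (hu : ¬ (0 < u ∧ ε * u < δ)) :
    ε ^ (-(1 + β)) * (ε * (Set.Ioi (1 - δ)).indicator (fun x =>
      (1 - Real.exp (-(ε ^ 2 * longRunVariance lam x))) * mixingDensity ψ β x) (1 - ε * u)) = 0 := by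
  by_cases hm : 1 - ε * u ∈ Set.Ioi (1 - δ)
  · have h1 : ε * u < δ := by
      simp only [Set.mem_Ioi] at hm; linarith
    have h2 : u ≤ 0 := by
      by_contra hu0
      exact hu ⟨not_le.1 hu0, h1⟩
    have hm2 : 1 - ε * u ∉ Set.Ioo (0 : ℝ) 1 := fun hmem => by
      have := mul_nonpos_of_nonneg_of_nonpos hε.le h2
      linarith [hmem.2]
    rw [Set.indicator_of_mem hm, mixingDensity, Set.indicator_of_notMem hm2]
    simp
  · rw [Set.indicator_of_notMem hm]
    simp

/-- After `x = 1 - ε u`, the integrand converges pointwise because `ψ → ψ₁` at `1`, and it is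
dominated because `lam * (2 - ε u) ≤ 2 * lam` and `ψ ≤ ψ₁ + 1` on the range involved. The limit
integral is the Gamma integral defining `stableConst`. -/
lemma HasMixingDensity.tendsto_critical [IsProbabilityMeasure P] (h : HasMixingDensity α P ψ β ψ₁)
    (hα : Measurable α)
    (hlam : 0 < lam) (hβ : β ∈ Set.Ioo (-1 : ℝ) 1) {δ : ℝ} (hδ : 0 < δ) (hδ1 : δ < 1)
    (hψ : ∀ x ∈ Set.Ioo (1 - δ) 1, ψ x ≤ ψ₁ + 1) :
    Tendsto (fun ε : ℝ => ε ^ (-(1 + β)) * ∫ x in Set.Ioi (1 - δ),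
      (1 - Real.exp (-(ε ^ 2 * longRunVariance lam x))) * mixingDensity ψ β x) (𝓝[>] 0)
      (𝓝 (stableConst lam β ψ₁)) := by
  set G : ℝ → ℝ → ℝ := fun ε => (Set.Ioi (1 - δ)).indicator (fun x =>
      (1 - Real.exp (-(ε ^ 2 * longRunVariance lam x))) * mixingDensity ψ β x) with hG
  have hGint : ∀ ε, Integrable (G ε) := fun ε =>
    (h.integrable_mul_mixingDensity hα hlam (sq_nonneg ε)).indicator measurableSet_Ioi
  have hsub : ∀ ε ∈ Set.Ioi (0 : ℝ), ε ^ (-(1 + β)) * ∫ x in Set.Ioi (1 - δ),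
      (1 - Real.exp (-(ε ^ 2 * longRunVariance lam x))) * mixingDensity ψ β x
      = ∫ u, ε ^ (-(1 + β)) * (ε * G ε (1 - ε * u)) := by
    intro ε hε
    have hε : 0 < ε := hε
    rw [integral_const_mul, integral_const_mul,
      Measure.integral_comp_mul_left (fun x => G ε (1 - x)) ε,
      integral_sub_left_eq_self (G ε) volume 1, ← integral_indicator measurableSet_Ioi,
      abs_of_pos (by positivity), smul_eq_mul, mul_inv_cancel_left₀ hε.ne']
  have hJ : stableConst lam β ψ₁ = ∫ u, (Set.Ioi (0 : ℝ)).indicator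
      (fun u => ψ₁ * ((1 - Real.exp (-(2 * lam / u ^ 2))) * u ^ β)) u := by
    rw [integral_indicator measurableSet_Ioi, integral_const_mul,
      integral_one_sub_exp_div_sq_mul_rpow (by positivity) hβ, stableConst]
    ring
  rw [hJ]
  refine Tendsto.congr' (eventually_nhdsWithin_of_forall fun ε hε => (hsub ε hε).symm) ?_
  refine tendsto_integral_filter_of_dominated_convergence ((Set.Ioi (0 : ℝ)).indicator
      fun u => (ψ₁ + 1) * ((1 - Real.exp (-(2 * lam / u ^ 2))) * u ^ β)) ?_ ?_ ?_ ?_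
  · filter_upwards [self_mem_nhdsWithin] with ε hε
    have hε : ε ≠ 0 := ne_of_gt hε
    exact ((((hGint ε).comp_sub_left 1).comp_mul_left' hε).const_mul _).const_mul _
      |>.aestronglyMeasurable
  · filter_upwards [self_mem_nhdsWithin] with ε hε
    have hε : 0 < ε := hε
    refine ae_of_all _ fun u => ?_
    have hψ1 := h.limit_pos
    have hexp : ∀ u : ℝ, 0 ≤ 1 - Real.exp (-(2 * lam / u ^ 2)) := fun u => by
      have : Real.exp (-(2 * lam / u ^ 2)) ≤ 1 := by
        rw [Real.exp_le_one_iff, neg_nonpos]; positivity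
      linarith
    by_cases hu : 0 < u ∧ ε * u < δ
    · obtain ⟨hu0, huδ⟩ := hu
      have hpos : 0 < ε * u := by positivity
      rw [rescaled_integrand_eq hε hδ1 hu0 huδ, Set.indicator_of_mem
        (show u ∈ Set.Ioi (0:ℝ) from hu0)]
      have h0 : 0 ≤ lam * (2 - ε * u) / u ^ 2 :=
        div_nonneg (mul_nonneg hlam.le (by linarith)) (by positivity)
      have h1 : Real.exp (-(lam * (2 - ε * u) / u ^ 2)) ≤ 1 := by
        rw [Real.exp_le_one_iff]; linarith
      have h2 : Real.exp (-(2 * lam / u ^ 2)) ≤ Real.exp (-(lam * (2 - ε * u) / u ^ 2)) := by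
        rw [Real.exp_le_exp, neg_le_neg_iff]
        exact div_le_div_of_nonneg_right (by nlinarith) (sq_nonneg u)
      have hψ0 : 0 ≤ ψ (1 - ε * u) := h.nonneg _ ⟨by linarith, by linarith⟩
      have hψ2 : ψ (1 - ε * u) ≤ ψ₁ + 1 := hψ _ ⟨by linarith, by linarith⟩
      have hu' : 0 ≤ u ^ β := by positivity
      rw [Real.norm_of_nonneg (mul_nonneg (by linarith) (mul_nonneg hψ0 hu'))]
      calc _ ≤ (1 - Real.exp (-(2 * lam / u ^ 2))) * ((ψ₁ + 1) * u ^ β) := by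
            gcongr
            exact hexp u
        _ = _ := by ring
    · rw [hG, rescaled_integrand_eq_zero hε hu, norm_zero]
      refine Set.indicator_nonneg (fun u hu => ?_) u
      have hu : 0 < u := hu
      exact mul_nonneg (by linarith) (mul_nonneg (hexp u) (by positivity))
  · rw [integrable_indicator_iff measurableSet_Ioi]
    exact (integrableOn_one_sub_exp_div_sq_mul_rpow (by positivity) hβ).const_mul _
  · refine ae_of_all _ fun u => ?_
    by_cases hu : 0 < u
    · rw [Set.indicator_of_mem (show u ∈ Set.Ioi (0:ℝ) from hu)]
      have hε0 : Tendsto (fun ε : ℝ => ε * u) (𝓝[>] 0) (𝓝 0) := by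
        have := ((continuous_id.mul continuous_const).tendsto (0 : ℝ)
          (f := fun ε : ℝ => ε * u)).mono_left
          (nhdsWithin_le_nhds (s := Set.Ioi 0))
        simpa using this
      have hlt : ∀ᶠ ε in 𝓝[>] (0 : ℝ), ε * u < δ := hε0.eventually_lt_const hδ
      have hψlim : Tendsto (fun ε : ℝ => ψ (1 - ε * u)) (𝓝[>] 0) (𝓝 ψ₁) := by
        refine h.tendsto.comp (tendsto_nhdsWithin_iff.2 ⟨by simpa using hε0.const_sub 1, ?_⟩)
        filter_upwards [self_mem_nhdsWithin] with ε hε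
        have : 0 < ε * u := mul_pos hε hu
        simp only [Set.mem_Iio]; linarith
      have hmain : Tendsto (fun ε : ℝ => (1 - Real.exp (-(lam * (2 - ε * u) / u ^ 2)))
          * (ψ (1 - ε * u) * u ^ β)) (𝓝[>] 0)
          (𝓝 (ψ₁ * ((1 - Real.exp (-(2 * lam / u ^ 2))) * u ^ β))) := by
        have h1 := ((((hε0.const_sub 2).const_mul lam).div_const (u ^ 2)).neg.rexp).const_sub 1
        have h2 := h1.mul (hψlim.mul_const (u ^ β))
        convert h2 using 2
        rw [sub_zero]
        ring_nf
      refine hmain.congr' ?_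
      filter_upwards [hlt, self_mem_nhdsWithin] with ε h1 h2
      exact (rescaled_integrand_eq h2 hδ1 hu h1).symm
    · rw [Set.indicator_of_notMem (show u ∉ Set.Ioi (0:ℝ) from hu)]
      refine tendsto_const_nhds.congr' ?_
      filter_upwards [self_mem_nhdsWithin] with ε hε
      exact (rescaled_integrand_eq_zero hε fun h => hu h.1).symm

/-- The Laplace transform of the long-run variance near the origin. -/
theorem HasMixingDensity.tendsto_one_sub_laplace [IsProbabilityMeasure P]
    (h : HasMixingDensity α P ψ β ψ₁)
    (hα : Measurable α) (hlam : 0 < lam) (hβ : β ∈ Set.Ioo (-1 : ℝ) 1) :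
    Tendsto (fun ε : ℝ => ε ^ (-(1 + β))
      * ∫ ω, (1 - Real.exp (-(ε ^ 2 * longRunVariance lam (α ω)))) ∂P) (𝓝[>] 0)
      (𝓝 (stableConst lam β ψ₁)) := by
  -- `ψ` need not be bounded on `(0, 1)`; its limit bounds it near `1`, and this determines where
  -- the integral is cut.
  obtain ⟨δ, hδ, hδ1, hψ⟩ : ∃ δ > 0, δ < 1 ∧ ∀ x ∈ Set.Ioo (1 - δ) 1, ψ x ≤ ψ₁ + 1 := by
    have hev : ∀ᶠ x in 𝓝[<] (1 : ℝ), ψ x ≤ ψ₁ + 1 :=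
      h.tendsto.eventually_le_const (by linarith)
    obtain ⟨l, hl, hsub⟩ := mem_nhdsLT_iff_exists_Ioo_subset.1 hev
    have hl : l < 1 := hl
    refine ⟨min (1 - l) (1 / 2), lt_min (by linarith) (by norm_num), ?_, fun x hx => hsub
      ⟨?_, hx.2⟩⟩
    · exact (min_le_right _ _).trans_lt (by norm_num)
    · have := min_le_left (1 - l) (1 / 2)
      linarith [hx.1]
  have hsum := (h.tendsto_bulk hα hlam hβ hδ).add (h.tendsto_critical hα hlam hβ hδ hδ1 hψ)
  rw [zero_add] at hsum
  refine hsum.congr fun ε => ?_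
  rw [h.integral_comp hα (measurable_one_sub_exp_longRunVariance lam (ε ^ 2)), ← mul_add,
    ← Set.compl_Iic, integral_add_compl measurableSet_Iic
      (h.integrable_mul_mixingDensity hα hlam (sq_nonneg ε))]

end Mixing

/-! ### Aggregation of independent copies -/

/-- Products over independent copies integrate to powers. -/
lemma integral_prod_range_eq_pow {Ω Ω₀ E 𝕜 : Type*} [MeasurableSpace Ω] [MeasurableSpace Ω₀]
    [MeasurableSpace E] [RCLike 𝕜] {P : Measure Ω} {P₀ : Measure Ω₀} {Z : ℕ → Ω → E} {Z₀ : Ω₀ → E}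
    (hid : ∀ j, IdentDistrib (Z j) Z₀ P P₀) (hind : iIndepFun Z P) {f : E → 𝕜} (hf : Measurable f)
    (N : ℕ) : ∫ ω, ∏ j ∈ Finset.range N, f (Z j ω) ∂P = (∫ ω, f (Z₀ ω) ∂P₀) ^ N := by
  have h := (hind.precomp (g := fun i : Fin N => (i : ℕ)) Fin.val_injective).integral_fun_prod_comp
    (f := fun _ => f) (fun i => (hid i).aemeasurable_fst) (fun i => hf.aestronglyMeasurable)
  simp_rw [← Fin.prod_univ_eq_prod_range (fun j => f (Z j _)) N]
  rw [h]
  have he : ∀ i, ∫ ω, f (Z i ω) ∂P = ∫ ω, f (Z₀ ω) ∂P₀ := fun i => ((hid i).comp hf).integral_eq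
  simp_rw [he]
  simp

/-- The rescaled sum of the long-run variances of the first `N` copies. -/
noncomputable def aggregateVariance {Ω : Type*} (lam β : ℝ) (α : ℕ → Ω → ℝ) (N : ℕ) (ω : Ω) : ℝ :=
  (N : ℝ) ^ (-(2 / (1 + β))) * ∑ j ∈ Finset.range N, longRunVariance lam (α j ω)

lemma aggregateVariance_nonneg {Ω : Type*} {lam β : ℝ} {α : ℕ → Ω → ℝ} {ω : Ω} (hlam : 0 ≤ lam)
    (h : ∀ j, α j ω ∈ Set.Ioo (0 : ℝ) 1)
    (N : ℕ) : 0 ≤ aggregateVariance lam β α N ω :=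
  mul_nonneg (by positivity) (Finset.sum_nonneg fun j _ => longRunVariance_nonneg hlam (h j))

section Aggregate

variable {Ω Ω₀ : Type*} [MeasurableSpace Ω] [MeasurableSpace Ω₀] {P : Measure Ω} {P₀ : Measure Ω₀}
  {α : ℕ → Ω → ℝ} {α₀ : Ω₀ → ℝ} {ψ : ℝ → ℝ} {lam β ψ₁ : ℝ}

lemma measurable_aggregateVariance (hα : ∀ j, Measurable (α j)) (N : ℕ) :
    Measurable (aggregateVariance lam β α N) :=
  (Finset.measurable_fun_sum _ fun j _ => (measurable_longRunVariance lam).comp (hα j)).const_mul _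

lemma integral_exp_aggregateVariance (hid : ∀ j, IdentDistrib (α j) α₀ P P₀)
    (hind : iIndepFun α P) (s : ℝ) (N : ℕ) :
    ∫ ω, Real.exp (-(s * aggregateVariance lam β α N ω)) ∂P
      = (∫ ω, Real.exp (-(s * (N : ℝ) ^ (-(2 / (1 + β))) * longRunVariance lam (α₀ ω))) ∂P₀) ^ N := by
  rw [← integral_prod_range_eq_pow hid hind
    (f := fun a => Real.exp (-(s * (N : ℝ) ^ (-(2 / (1 + β))) * longRunVariance lam a)))
    (((measurable_longRunVariance lam).const_mul _).neg.exp)]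
  refine integral_congr_ae (ae_of_all _ fun ω => ?_)
  simp only [aggregateVariance]
  rw [← Real.exp_sum, Finset.sum_neg_distrib, ← Finset.mul_sum, mul_assoc]

lemma integrable_exp_neg_longRunVariance [IsProbabilityMeasure P₀]
    (hα : Measurable α₀) (hlam : 0 < lam) (hα₀ : ∀ᵐ ω ∂P₀, α₀ ω ∈ Set.Ioo (0 : ℝ) 1) {c : ℝ}
    (hc : 0 ≤ c) : Integrable (fun ω => Real.exp (-(c * longRunVariance lam (α₀ ω)))) P₀ := by
  refine (integrable_const (1 : ℝ)).mono'
    (((measurable_longRunVariance lam).comp hα).const_mul c).neg.exp.aestronglyMeasurable ?_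
  filter_upwards [hα₀] with ω hω
  rw [Real.norm_of_nonneg (Real.exp_pos _).le]
  linarith [(one_sub_exp_longRunVariance_mem hlam hc hω).1]

/-- The rescaled aggregate variances converge, in the sense of Laplace transforms, to the positive
stable law. -/
theorem HasMixingDensity.tendsto_laplace_aggregateVariance [IsProbabilityMeasure P₀]
    (h : HasMixingDensity α₀ P₀ ψ β ψ₁)
    (hα : Measurable α₀) (hlam : 0 < lam) (hβ : β ∈ Set.Ioo (-1 : ℝ) 1)
    (hα₀ : ∀ᵐ ω ∂P₀, α₀ ω ∈ Set.Ioo (0 : ℝ) 1) (hid : ∀ j, IdentDistrib (α j) α₀ P P₀)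
    (hind : iIndepFun α P) {s : ℝ} (hs : 0 ≤ s) :
    Tendsto (fun N => ∫ ω, Real.exp (-(s * aggregateVariance lam β α N ω)) ∂P) atTop
      (𝓝 (Real.exp (-(stableConst lam β ψ₁ * s ^ ((1 + β) / 2))))) := by
  have hβ1 : 0 < 1 + β := by linarith [hβ.1]
  simp_rw [integral_exp_aggregateVariance hid hind]
  rcases hs.eq_or_lt with rfl | hs
  · rw [Real.zero_rpow (by positivity)]
    simp
  -- This `ε` satisfies `ε² = s N^(-2/(1+β))` and `s^((1+β)/2) ε^(-(1+β)) = N`, so the small-`ε`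
  -- asymptotics become `N` times the deviation of one factor from `1`.
  have hε : Tendsto (fun N : ℕ => √s * (N : ℝ) ^ (-(1 / (1 + β)))) atTop (𝓝[>] 0) := by
    refine tendsto_nhdsWithin_iff.2 ⟨?_, ?_⟩
    · have := ((tendsto_rpow_neg_atTop (one_div_pos.2 hβ1)).comp
        tendsto_natCast_atTop_atTop).const_mul √s
      rwa [mul_zero] at this
    · filter_upwards [eventually_gt_atTop 0] with N hN
      have : (0 : ℝ) < N := by exact_mod_cast hN
      exact mul_pos (Real.sqrt_pos.2 hs) (by positivity)
  have hlim := (((h.tendsto_one_sub_laplace hα hlam hβ).comp hε).const_mul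
    (s ^ ((1 + β) / 2))).neg
  have hexp := Real.tendsto_one_add_pow_exp_of_tendsto (g := fun N : ℕ =>
    ∫ ω, Real.exp (-(s * (N : ℝ) ^ (-(2 / (1 + β))) * longRunVariance lam (α₀ ω))) ∂P₀ - 1)
    (t := -(s ^ ((1 + β) / 2) * stableConst lam β ψ₁)) (hlim.congr' ?_)
  · simp_rw [add_sub_cancel] at hexp
    rwa [mul_comm (stableConst lam β ψ₁)]
  · filter_upwards [eventually_gt_atTop 0] with N hN
    have hN : (0 : ℝ) < N := by exact_mod_cast hN
    have hsq : (√s * (N : ℝ) ^ (-(1 / (1 + β)))) ^ 2 = s * (N : ℝ) ^ (-(2 / (1 + β))) := by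
      rw [mul_pow, Real.sq_sqrt hs.le, ← Real.rpow_natCast (_ ^ _), ← Real.rpow_mul hN.le]
      congr 2
      push_cast
      ring
    have hpow : s ^ ((1 + β) / 2) * (√s * (N : ℝ) ^ (-(1 / (1 + β)))) ^ (-(1 + β)) = N := by
      rw [Real.mul_rpow (Real.sqrt_nonneg s) (by positivity), Real.sqrt_eq_rpow,
        ← Real.rpow_mul hs.le, ← Real.rpow_mul hN.le, ← mul_assoc, ← Real.rpow_add hs]
      rw [show (1 + β) / 2 + 1 / 2 * -(1 + β) = 0 by ring,
        show -(1 / (1 + β)) * -(1 + β) = 1 by field_simp, Real.rpow_zero, Real.rpow_one, one_mul]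
    simp only [Function.comp_apply]
    rw [hsq, ← mul_assoc, hpow, integral_sub (integrable_const _)
      (integrable_exp_neg_longRunVariance hα hlam hα₀ (by positivity))]
    simp only [integral_const, probReal_univ, one_smul]
    ring

end Aggregate

/-! ### Limits of Laplace transforms -/

/-- A pointwise limit of Laplace transforms of probability laws on the half line which is continuous
at `0` is the Laplace transform of such a law. -/
theorem exists_measure_of_tendsto_laplace {μ : ℕ → Measure ℝ} [∀ n, IsProbabilityMeasure (μ n)]
    {f : ℝ → ℝ} (hμ : ∀ n, ∀ᵐ y ∂(μ n), 0 ≤ y)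
    (h : ∀ θ, 0 ≤ θ → Tendsto (fun n => ∫ y, Real.exp (-(θ * y)) ∂(μ n)) atTop (𝓝 (f θ)))
    (hf : Tendsto f (𝓝[>] 0) (𝓝 1)) :
    ∃ ν : Measure ℝ, IsProbabilityMeasure ν ∧ (∀ᵐ y ∂ν, 0 ≤ y) ∧
      ∀ θ, 0 ≤ θ → ∫ y, Real.exp (-(θ * y)) ∂ν = f θ := by
  have hint : ∀ n θ, 0 ≤ θ → Integrable (fun y => Real.exp (-(θ * y))) (μ n) := fun n θ hθ => by
    refine (integrable_const (1 : ℝ)).mono' (by fun_prop) ?_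
    filter_upwards [hμ n] with y hy
    rw [Real.norm_of_nonneg (Real.exp_pos _).le, Real.exp_le_one_iff]
    nlinarith
  -- Markov's inequality at `θ = 1 / r`: for `y > r` one has `1 - exp (-(y / r)) ≥ 1 - exp (-1) ≥ 1
  -- / 2`.
  have hbound : ∀ n, ∀ r : ℝ, 0 < r →
      μ n {x | r < ‖x‖} ≤ ENNReal.ofReal (2 * (1 - ∫ y, Real.exp (-(r⁻¹ * y)) ∂(μ n))) := by
    intro n r hr
    have hsub : μ n {x | r < ‖x‖} ≤ μ n {x | (1 / 2 : ℝ) ≤ 1 - Real.exp (-(r⁻¹ * x))} := by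
      refine measure_mono_ae ?_
      filter_upwards [hμ n] with y hy hry
      have hry : r < y := by
        have : r < ‖y‖ := hry
        rwa [Real.norm_of_nonneg hy] at this
      have h1 : 1 ≤ r⁻¹ * y := by
        rw [← div_eq_inv_mul, one_le_div hr]; exact hry.le
      have h2 : Real.exp (-(r⁻¹ * y)) ≤ Real.exp (-1) := Real.exp_le_exp.2 (by linarith)
      have h3 : Real.exp (-1) ≤ 1 / 2 := by
        rw [Real.exp_neg, one_div]
        gcongr
        linarith [Real.add_one_le_exp 1]
      have : (1 / 2 : ℝ) ≤ 1 - Real.exp (-(r⁻¹ * y)) := by linarith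
      exact this
    refine hsub.trans ?_
    have hm := mul_meas_ge_le_integral_of_nonneg (μ := μ n)
      (f := fun x => 1 - Real.exp (-(r⁻¹ * x))) ?_
      ((integrable_const 1).sub (hint n r⁻¹ (by positivity))) (1 / 2)
    · rw [integral_sub (integrable_const _) (hint n r⁻¹ (by positivity))] at hm
      simp only [integral_const, probReal_univ, one_smul] at hm
      rw [← ENNReal.ofReal_toReal (measure_ne_top (μ n) _)]
      refine ENNReal.ofReal_le_ofReal ?_
      have : (μ n).real {x | (1 / 2 : ℝ) ≤ 1 - Real.exp (-(r⁻¹ * x))}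
        ≤ 2 * (1 - ∫ y, Real.exp (-(r⁻¹ * y)) ∂(μ n)) := by linarith
      exact this
    · filter_upwards [hμ n] with y hy
      have : Real.exp (-(r⁻¹ * y)) ≤ 1 := Real.exp_le_one_iff.2 (by
        have : 0 ≤ r⁻¹ * y := by positivity
        linarith)
      simp only [Pi.zero_apply]
      linarith
  -- Letting `r → ∞` sends `θ = 1 / r` to `0`, so continuity of `f` at `0` makes the tails uniformly
  -- small.
  have htight : IsTightMeasureSet (Set.range μ) := by
    refine isTightMeasureSet_range_of_tendsto_limsup_measure_norm_gt ?_
    have hlim : Tendsto (fun r : ℝ => ENNReal.ofReal (2 * (1 - f r⁻¹))) atTop (𝓝 0) := by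
      have := ENNReal.tendsto_ofReal
        (((hf.comp tendsto_inv_atTop_nhdsGT_zero).const_sub 1).const_mul 2)
      simpa using this
    refine tendsto_of_tendsto_of_tendsto_of_le_of_le' tendsto_const_nhds hlim
      (Eventually.of_forall fun r => zero_le) ?_
    filter_upwards [eventually_gt_atTop 0] with r hr
    have hl := ENNReal.tendsto_ofReal (((h r⁻¹ (by positivity)).const_sub 1).const_mul 2)
    rw [← hl.limsup_eq]
    exact limsup_le_limsup (Eventually.of_forall fun n => hbound n r hr)
  let μ' : ℕ → ProbabilityMeasure ℝ := fun n => ⟨μ n, inferInstance⟩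
  have hcomp : IsCompact (closure (Set.range μ')) := by
    refine isCompact_closure_of_isTightMeasureSet (htight.subset ?_)
    rintro _ ⟨_, ⟨n, rfl⟩, rfl⟩
    exact ⟨n, rfl⟩
  let U := Ultrafilter.of (atTop : Filter ℕ)
  obtain ⟨ν, -, hν⟩ := hcomp.ultrafilter_le_nhds (U.map μ')
    (le_trans (by simp) (monotone_principal subset_closure))
  have hν : Tendsto μ' U (𝓝 ν) := hν
  -- Mapping by `max y 0` makes the limit nonnegative by construction, and `exp (-(θ * max y 0))` is
  -- a bounded continuous test function on the whole line that agrees with the Laplace kernel under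
  -- each `μ n`.
  refine ⟨(ν : Measure ℝ).map fun y => max y 0, Measure.isProbabilityMeasure_map (by fun_prop), ?_,
    fun θ hθ => ?_⟩
  · rw [ae_map_iff (by fun_prop) measurableSet_Ici]
    exact ae_of_all _ fun y => le_max_right y 0
  · rw [integral_map (by fun_prop) (by fun_prop)]
    let g : BoundedContinuousFunction ℝ ℝ := BoundedContinuousFunction.ofNormedAddCommGroup
      (fun y => Real.exp (-(θ * max y 0))) (by fun_prop) 1 (fun y => by
        rw [Real.norm_of_nonneg (Real.exp_pos _).le, Real.exp_le_one_iff]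
        have := mul_nonneg hθ (le_max_right y 0)
        linarith)
    refine tendsto_nhds_unique
      ((ProbabilityMeasure.tendsto_iff_forall_integral_tendsto.1 hν) g)
      (((h θ hθ).mono_left (Ultrafilter.of_le _)).congr fun n => ?_)
    refine integral_congr_ae ?_
    filter_upwards [hμ n] with y hy
    simp [g, max_eq_left hy]

lemma stableConst_pos {lam β ψ₁ : ℝ} (hlam : 0 < lam) (hβ : β ∈ Set.Ioo (-1 : ℝ) 1)
    (hψ₁ : 0 < ψ₁) : 0 < stableConst lam β ψ₁ := by
  have h1 : 0 < 1 + β := by linarith [hβ.1]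
  have h2 := Real.Gamma_pos_of_pos (show 0 < (1 - β) / 2 by linarith [hβ.2])
  unfold stableConst
  positivity

/-- A law on the half line with a stable Laplace transform does not charge the origin. -/
lemma isPositiveStableLaw_of_laplace {a κ : ℝ} (ha : 0 < a) (hκ : 0 < κ) {ν : Measure ℝ}
    [IsProbabilityMeasure ν] (hν : ∀ᵐ y ∂ν, 0 ≤ y)
    (h : ∀ θ : ℝ, 0 ≤ θ → ∫ y, Real.exp (-(θ * y)) ∂ν = Real.exp (-(κ * θ ^ a))) :
    IsPositiveStableLaw a κ ν := by
  refine ⟨inferInstance, ?_, h⟩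
  -- The mass at `0` contributes fully to every Laplace transform value, and these tend to `0` as `θ
  -- → ∞`.
  have hle : ∀ θ : ℝ, 0 ≤ θ → ν.real {0} ≤ Real.exp (-(κ * θ ^ a)) := fun θ hθ => by
    have hint : Integrable (fun y => Real.exp (-(θ * y))) ν := by
      refine (integrable_const (1 : ℝ)).mono' (by fun_prop) ?_
      filter_upwards [hν] with y hy
      rw [Real.norm_of_nonneg (Real.exp_pos _).le, Real.exp_le_one_iff]
      nlinarith
    rw [← h θ hθ, ← integral_indicator_one (measurableSet_singleton (0 : ℝ))]
    refine integral_mono ((integrable_const 1).indicator (measurableSet_singleton 0)) hint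
      fun y => ?_
    by_cases hy : y = 0
    · simp [hy]
    · simp [hy, Real.exp_nonneg]
  have hlim : Tendsto (fun θ : ℝ => Real.exp (-(κ * θ ^ a))) atTop (𝓝 0) :=
    Real.tendsto_exp_neg_atTop_nhds_zero.comp ((tendsto_rpow_atTop ha).const_mul_atTop hκ)
  have h0 : ν.real {0} = 0 := le_antisymm
    (ge_of_tendsto hlim ((eventually_ge_atTop 0).mono hle)) measureReal_nonneg
  have h0' : ∀ᵐ y ∂ν, y ≠ 0 := by
    rw [measureReal_eq_zero_iff] at h0
    rw [ae_iff]
    simpa using h0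
  filter_upwards [hν, h0'] with y h1 h2
  exact lt_of_le_of_ne h1 h2.symm

/-! ### The positive stable law -/

/-- The principal argument of `-iθ` is `-sign(θ) π / 2`. -/
lemma neg_mul_I_cpow {a θ : ℝ} (ha : 0 < a) :
    (-((θ : ℂ) * Complex.I)) ^ (a : ℂ)
      = ((|θ| ^ a : ℝ) : ℂ) * Complex.exp
        (-(Complex.I * ((Real.sign θ * (Real.pi * a / 2) : ℝ) : ℂ))) := by
  have key : ∀ r : ℝ, 0 < r → ∀ z : ℂ, z ≠ 0 →
      ((r : ℂ) * z) ^ (a : ℂ) = ((r ^ a : ℝ) : ℂ) * Complex.exp (Complex.log z * a) := by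
    intro r hr z hz
    rw [Complex.cpow_def_of_ne_zero (mul_ne_zero (by exact_mod_cast hr.ne') hz),
      Complex.log_ofReal_mul hr hz, add_mul, Complex.exp_add, Real.rpow_def_of_pos hr]
    push_cast
    rfl
  rcases lt_trichotomy θ 0 with h | rfl | h
  · rw [show -((θ : ℂ) * Complex.I) = ((-θ : ℝ) : ℂ) * Complex.I by push_cast; ring,
      key _ (by linarith) _ Complex.I_ne_zero, Complex.log_I, abs_of_neg h, Real.sign_of_neg h]
    congr 2
    push_cast
    ring
  · simp [Real.zero_rpow ha.ne', Complex.zero_cpow (show (a : ℂ) ≠ 0 by exact_mod_cast ha.ne')]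
  · rw [show -((θ : ℂ) * Complex.I) = (θ : ℂ) * -Complex.I by ring,
      key _ h _ (neg_ne_zero.2 Complex.I_ne_zero), Complex.log_neg_I, abs_of_pos h,
      Real.sign_of_pos h]
    congr 2
    push_cast
    ring

namespace IsPositiveStableLaw

variable {a κ : ℝ} {ν : Measure ℝ}

/-- Both sides are analytic in the open left half plane, where `-z` avoids the branch cut, and they
agree on the negative reals; the identity theorem applies. -/
lemma complexMGF_eq (h : IsPositiveStableLaw a κ ν) {z : ℂ} (hz : z.re < 0) :
    complexMGF id ν z = Complex.exp (-((κ : ℂ) * (-z) ^ (a : ℂ))) := by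
  have := h.isProbabilityMeasure
  have hsub : Set.Iio 0 ⊆ interior (integrableExpSet id ν) := by
    refine interior_maximal (fun t ht => ?_) isOpen_Iio
    have ht : t < 0 := ht
    refine (integrable_const (1 : ℝ)).mono' (by fun_prop) ?_
    filter_upwards [h.pos] with y hy
    rw [Real.norm_of_nonneg (Real.exp_pos _).le, Real.exp_le_one_iff]
    simp only [id_eq]
    nlinarith
  have h1 : AnalyticOnNhd ℂ (complexMGF id ν) {z | z.re < 0} :=
    analyticOnNhd_complexMGF.mono fun z hz => hsub hz
  have h2 : AnalyticOnNhd ℂ (fun z => Complex.exp (-((κ : ℂ) * (-z) ^ (a : ℂ)))) {z | z.re < 0} := by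
    intro z hz
    have hz : z.re < 0 := hz
    exact ((analyticAt_const.mul (analyticAt_id.neg.cpow analyticAt_const
      (Or.inl (by simpa using hz)))).neg).cexp
  have hreal : ∀ x : ℝ, x < 0 → complexMGF id ν x = Complex.exp
    (-((κ : ℂ) * (-(x : ℂ)) ^ (a : ℂ))) := by
    intro x hx
    have hl := h.laplace (-x) (by linarith)
    simp only [neg_mul, neg_neg] at hl
    rw [complexMGF_ofReal, mgf]
    simp only [id_eq]
    rw [hl, Complex.ofReal_exp]
    push_cast [Complex.ofReal_cpow (show 0 ≤ -x by linarith)]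
    rfl
  refine AnalyticOnNhd.eqOn_of_preconnected_of_frequently_eq h1 h2
    (convex_halfSpace_re_lt 0).isPreconnected (z₀ := ((-1 : ℝ) : ℂ)) (by simp) ?_ hz
  rw [frequently_iff_seq_forall]
  refine ⟨fun n => ((-1 - 1 / ((n : ℝ) + 1) : ℝ) : ℂ), ?_, fun n => ?_⟩
  · refine tendsto_nhdsWithin_iff.2 ⟨?_, Eventually.of_forall fun n => ?_⟩
    · have := (tendsto_one_div_add_atTop_nhds_zero_nat (𝕜 := ℝ)).const_sub (-1)
      rw [sub_zero] at this
      exact (Complex.continuous_ofReal.tendsto _).comp this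
    · have : (0 : ℝ) < 1 / ((n : ℝ) + 1) := by positivity
      simp only [Set.mem_compl_iff, Set.mem_singleton_iff, Complex.ofReal_inj]
      linarith
  · have : (0 : ℝ) < 1 / ((n : ℝ) + 1) := by positivity
    exact hreal _ (by linarith)

/-- The characteristic function of the positive stable law. -/
theorem charFun_eq (h : IsPositiveStableLaw a κ ν) (ha : 0 < a) (θ : ℝ) :
    charFun ν θ = Complex.exp (-(((κ * |θ| ^ a : ℝ) : ℂ)
      * Complex.exp (-(Complex.I * ((Real.sign θ * (Real.pi * a / 2) : ℝ) : ℂ))))) := by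
  have := h.isProbabilityMeasure
  rcases eq_or_ne θ 0 with rfl | hθ
  · simp [Real.zero_rpow ha.ne']
  -- The point `iθ` is approached from inside the left half plane. Dominated convergence handles the
  -- transform; for `θ ≠ 0` the principal power is continuous at `-iθ`.
  have hδ : Tendsto (fun n : ℕ => (θ : ℂ) * Complex.I - ((1 / ((n : ℝ) + 1) : ℝ) : ℂ)) atTop
      (𝓝 ((θ : ℂ) * Complex.I)) := by
    have := ((Complex.continuous_ofReal.tendsto _).comp
      (tendsto_one_div_add_atTop_nhds_zero_nat (𝕜 := ℝ))).const_sub ((θ : ℂ) * Complex.I)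
    rwa [Complex.ofReal_zero, sub_zero] at this
  have h1 : Tendsto (fun n : ℕ => complexMGF id ν
      ((θ : ℂ) * Complex.I - ((1 / ((n : ℝ) + 1) : ℝ) : ℂ))) atTop (𝓝 (charFun ν θ)) := by
    rw [← complexMGF_id_mul_I]
    refine tendsto_integral_of_dominated_convergence (fun _ => (1 : ℝ)) (fun n => by fun_prop)
      (integrable_const _) (fun n => ?_) (ae_of_all _ fun y => ?_)
    · filter_upwards [h.pos] with y hy
      rw [Complex.norm_exp, Real.exp_le_one_iff]
      have : (0 : ℝ) < 1 / ((n : ℝ) + 1) := by positivity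
      simp only [id_eq, Complex.re_mul_ofReal, Complex.sub_re, Complex.re_ofReal_mul, Complex.I_re,
        mul_zero, Complex.ofReal_re, zero_sub]
      nlinarith
    · exact (Complex.continuous_exp.tendsto _).comp (hδ.mul_const _)
  have h2 : Tendsto (fun n : ℕ => complexMGF id ν
      ((θ : ℂ) * Complex.I - ((1 / ((n : ℝ) + 1) : ℝ) : ℂ))) atTop
      (𝓝 (Complex.exp (-((κ : ℂ) * (-((θ : ℂ) * Complex.I)) ^ (a : ℂ))))) := by
    have hcont : ContinuousAt (fun z : ℂ => Complex.exp (-((κ : ℂ) * (-z) ^ (a : ℂ))))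
        ((θ : ℂ) * Complex.I) :=
      ((continuousAt_const.mul
        (continuousAt_neg.cpow continuousAt_const (Or.inr (by simpa using hθ)))).neg).cexp
    refine (hcont.tendsto.comp hδ).congr fun n => ?_
    have : (0 : ℝ) < 1 / ((n : ℝ) + 1) := by positivity
    refine (h.complexMGF_eq ?_).symm
    simp only [Complex.sub_re, Complex.re_ofReal_mul, Complex.I_re, mul_zero, Complex.ofReal_re,
      zero_sub]
    linarith
  rw [tendsto_nhds_unique h1 h2, neg_mul_I_cpow ha]
  push_cast
  ring_nf

/-- Scaling by `r > 0` preserves the sign of `θ` and multiplies the exponent of the characteristic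
function by `r ^ a`; convolution adds these factors. -/
theorem isStrictlyStable (h : IsPositiveStableLaw a κ ν) (ha : 0 < a) : IsStrictlyStable a ν := by
  have := h.isProbabilityMeasure
  intro c d hc hd
  have h1 : IsProbabilityMeasure (ν.map fun x => c • x) :=
    Measure.isProbabilityMeasure_map (by fun_prop)
  have h2 : IsProbabilityMeasure (ν.map fun x => d • x) :=
    Measure.isProbabilityMeasure_map (by fun_prop)
  have h3 : IsProbabilityMeasure (ν.map fun x => ((c ^ a + d ^ a) ^ (1 / a) : ℝ) • x) :=
    Measure.isProbabilityMeasure_map (by fun_prop)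
  have hcd : 0 < c ^ a + d ^ a := by positivity
  refine Measure.ext_of_charFun (funext fun θ => ?_)
  have hs : ∀ r : ℝ, 0 < r → charFun ν (r • θ) = Complex.exp (((r ^ a : ℝ) : ℂ) *
      -(((κ * |θ| ^ a : ℝ) : ℂ)
      * Complex.exp (-(Complex.I * ((Real.sign θ * (Real.pi * a / 2) : ℝ) : ℂ))))) := by
    intro r hr
    have hsign : Real.sign (r * θ) = Real.sign θ := by
      rcases lt_trichotomy θ 0 with h | rfl | h
      · rw [Real.sign_of_neg h, Real.sign_of_neg (mul_neg_of_pos_of_neg hr h)]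
      · simp
      · rw [Real.sign_of_pos h, Real.sign_of_pos (mul_pos hr h)]
    rw [h.charFun_eq ha, smul_eq_mul, hsign, abs_mul, abs_of_pos hr,
      Real.mul_rpow hr.le (abs_nonneg _)]
    push_cast
    ring_nf
  rw [charFun_conv, charFun_map_smul, charFun_map_smul, charFun_map_smul, hs c hc, hs d hd,
    hs _ (by positivity), ← Complex.exp_add, ← add_mul, ← Real.rpow_mul hcd.le,
    one_div_mul_cancel ha.ne', Real.rpow_one]
  push_cast
  rfl

end IsPositiveStableLaw

/-! ### The variance mixture of a Brownian motion -/

lemma measurable_exp_sum {ι : Type*} [Fintype ι] (θ : ι → ℝ) :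
    Measurable fun x : ι → ℝ => Complex.exp (Complex.I * (∑ t, θ t * x t : ℝ)) :=
  Complex.measurable_exp.comp ((Complex.measurable_ofReal.comp
    (by fun_prop : Measurable fun x : ι → ℝ => ∑ t, θ t * x t)).const_mul _)

section BrownianMixture

variable {Ω' : Type*} [MeasurableSpace Ω'] {P' : Measure Ω'}
  {Y : Ω' → ℝ} {B : ℝ≥0 → Ω' → ℝ} {a κ : ℝ}

lemma measurable_restrict_sqrt_mul (hY : Measurable Y) (hBm : ∀ t, Measurable (B t))
    (I : Finset ℝ≥0) : Measurable fun ω => I.restrict fun t => √(Y ω) * B t ω :=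
  measurable_pi_lambda _ fun t => hY.sqrt.mul (hBm t)

lemma IsPositiveStableLaw.ae_pos (hY : Measurable Y)
    (h : IsPositiveStableLaw a κ (P'.map Y)) : ∀ᵐ ω ∂P', 0 < Y ω :=
  ae_of_ae_map hY.aemeasurable h.pos

lemma IsPositiveStableLaw.integral_exp_sqrt_mul_brownian [IsProbabilityMeasure P']
    (hY : Measurable Y)
    (hBm : ∀ t, Measurable (B t)) (h : IsPositiveStableLaw a κ (P'.map Y))
    (hB : IsPreBrownianReal B P') (hind : IndepFun Y (fun ω t => B t ω) P')
    (I : Finset ℝ≥0) (θ : I → ℝ) :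
    ∫ ω, Complex.exp (Complex.I * (∑ t : I, θ t * (√(Y ω) * B t ω) : ℝ)) ∂P'
      = (Real.exp (-(κ * (brownianForm (fun t : I => (t : ℝ≥0)) θ / 2) ^ a)) : ℝ) := by
  rw [RandomizedINAR.integral_exp_sqrt_mul_brownian hY hBm
    ((h.ae_pos hY).mono fun _ => le_of_lt) hB hind]
  congr 1
  rw [← h.laplace _ (div_nonneg (brownianForm_nonneg _ _) zero_le_two),
    integral_map hY.aemeasurable (by fun_prop)]
  simp_rw [mul_comm]

/-- A law on a finite power of the real line is strictly stable if the exponent of its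
characteristic function is homogeneous. -/
lemma isStrictlyStable_of_integral_exp {ι : Type*} [Fintype ι] {m : Measure (ι → ℝ)}
    [IsProbabilityMeasure m] (ha : a ≠ 0) (g : (ι → ℝ) → ℝ)
    (hg : ∀ c : ℝ, 0 < c → ∀ θ, g (fun t => c * θ t) = c ^ a * g θ)
    (hm : ∀ θ : ι → ℝ, ∫ x, Complex.exp (Complex.I * (∑ t, θ t * x t : ℝ)) ∂m
      = (Real.exp (-g θ) : ℝ)) : IsStrictlyStable a m := by
  intro c d hc hd
  have h1 : ∀ r : ℝ, IsProbabilityMeasure (m.map fun x => r • x) := fun r =>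
    Measure.isProbabilityMeasure_map (by fun_prop)
  have hmap : ∀ r : ℝ, 0 < r → ∀ θ : ι → ℝ,
      ∫ x, Complex.exp (Complex.I * (∑ t, θ t * x t : ℝ)) ∂(m.map fun x => r • x)
        = (Real.exp (-(r ^ a * g θ)) : ℝ) := by
    intro r hr θ
    rw [← hg r hr, ← hm, integral_map (by fun_prop) (measurable_exp_sum θ).aestronglyMeasurable]
    congr with x
    congr 3
    exact Finset.sum_congr rfl fun t _ => by simp only [Pi.smul_apply, smul_eq_mul]; ring
  have hcd : 0 < c ^ a + d ^ a := by positivity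
  have := h1 c
  have := h1 d
  have := h1 ((c ^ a + d ^ a) ^ (1 / a))
  refine measure_pi_ext_of_integral_exp fun θ => ?_
  rw [hmap _ (by positivity), Measure.conv, integral_map (by fun_prop)
    (measurable_exp_sum θ).aestronglyMeasurable]
  have hadd : ∀ p : (ι → ℝ) × (ι → ℝ),
      Complex.exp (Complex.I * (∑ t, θ t * (p.1 + p.2) t : ℝ))
        = Complex.exp (Complex.I * (∑ t, θ t * p.1 t : ℝ))
          * Complex.exp (Complex.I * (∑ t, θ t * p.2 t : ℝ)) := fun p => by
    rw [← Complex.exp_add, ← mul_add, ← Complex.ofReal_add, ← Finset.sum_add_distrib]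
    congr 3
    exact Finset.sum_congr rfl fun t _ => by simp only [Pi.add_apply]; ring
  simp_rw [hadd]
  rw [integral_prod_mul (fun x : ι → ℝ => Complex.exp (Complex.I * (∑ t, θ t * x t : ℝ)))
    (fun x : ι → ℝ => Complex.exp (Complex.I * (∑ t, θ t * x t : ℝ))), hmap c hc, hmap d hd,
    ← Complex.ofReal_mul, ← Real.exp_add, ← Real.rpow_mul hcd.le, one_div_mul_cancel ha,
    Real.rpow_one]
  ring_nf

/-- The exponent is the `a`-th power of a quadratic form, hence homogeneous of degree `2 * a`. -/
theorem IsPositiveStableLaw.hasStableFDD [IsProbabilityMeasure P'] (ha : 0 < a) (hY : Measurable Y)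
    (hBm : ∀ t, Measurable (B t)) (h : IsPositiveStableLaw a κ (P'.map Y))
    (hB : IsPreBrownianReal B P') (hind : IndepFun Y (fun ω t => B t ω) P') :
    HasStableFDD (2 * a) (fun t ω => √(Y ω) * B t ω) P' := by
  intro I
  have hm := measurable_restrict_sqrt_mul hY hBm I
  have : IsProbabilityMeasure (P'.map fun ω => I.restrict fun t => √(Y ω) * B t ω) :=
    Measure.isProbabilityMeasure_map hm.aemeasurable
  refine isStrictlyStable_of_integral_exp (by positivity)
    (fun θ => κ * (brownianForm (fun t : I => (t : ℝ≥0)) θ / 2) ^ a) (fun c hc θ => ?_)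
    fun θ => ?_
  · rw [brownianForm_smul, mul_div_assoc, Real.mul_rpow (sq_nonneg c)
      (div_nonneg (brownianForm_nonneg _ _) zero_le_two), ← Real.rpow_natCast c 2,
      ← Real.rpow_mul hc.le]
    push_cast
    ring
  · rw [integral_map hm.aemeasurable (measurable_exp_sum θ).aestronglyMeasurable]
    exact h.integral_exp_sqrt_mul_brownian hY hBm hB hind I θ

/-- Increments of `B` after time `s` are again Brownian and independent of `Y`, so the mixture has a
characteristic function not depending on `s`; the unshifted process is the case `s = 0`. -/
theorem hasStationaryIncrements_sqrt_mul_brownian [IsProbabilityMeasure P'] (hY : Measurable Y)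
    (hBm : ∀ t, Measurable (B t)) (hY0 : ∀ᵐ ω ∂P', 0 ≤ Y ω) (hB : IsPreBrownianReal B P')
    (hind : IndepFun Y (fun ω t => B t ω) P') :
    HasStationaryIncrements (fun t ω => √(Y ω) * B t ω) P' := by
  intro s I
  have hBs : ∀ s t : ℝ≥0, Measurable fun ω => B (s + t) ω - B s ω := fun s t =>
    (hBm _).sub (hBm _)
  have hinds : ∀ s : ℝ≥0, IndepFun Y (fun ω t => B (s + t) ω - B s ω) P' := fun s =>
    hind.comp (ψ := fun (b : ℝ≥0 → ℝ) t => b (s + t) - b s) measurable_id (by fun_prop)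
  have hm : ∀ s : ℝ≥0, Measurable fun ω => I.restrict fun t =>
    √(Y ω) * B (s + t) ω - √(Y ω) * B s ω :=
    fun s => measurable_pi_lambda _ fun t => (hY.sqrt.mul (hBm _)).sub (hY.sqrt.mul (hBm _))
  have hprob : ∀ s : ℝ≥0, IsProbabilityMeasure
      (P'.map fun ω => I.restrict fun t => √(Y ω) * B (s + t) ω - √(Y ω) * B s ω) := fun s =>
    Measure.isProbabilityMeasure_map (hm s).aemeasurable
  have hchar : ∀ (s : ℝ≥0) (θ : I → ℝ), ∫ x, Complex.exp (Complex.I * (∑ t, θ t * x t : ℝ))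
      ∂(P'.map fun ω => I.restrict fun t => √(Y ω) * B (s + t) ω - √(Y ω) * B s ω)
      = (∫ ω, Real.exp (-(Y ω * (brownianForm (fun t : I => (t : ℝ≥0)) θ / 2))) ∂P' : ℝ) := by
    intro s θ
    rw [← integral_exp_sqrt_mul_brownian hY (hBs s) hY0 (hB.shift s) (hinds s) I θ,
      integral_map (hm s).aemeasurable (measurable_exp_sum θ).aestronglyMeasurable]
    simp_rw [mul_sub (√(Y _)), Finset.restrict]
  have hmap : P'.map (fun ω => I.restrict fun t => √(Y ω) * B (s + t) ω - √(Y ω) * B s ω)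
      = P'.map (fun ω => I.restrict fun t => √(Y ω) * B (0 + t) ω - √(Y ω) * B 0 ω) :=
    measure_pi_ext_of_integral_exp fun θ => (hchar s θ).trans (hchar 0 θ).symm
  have h0 := hm 0
  simp_rw [zero_add] at hmap h0
  exact ⟨(hm s).aemeasurable, h0.aemeasurable, hmap⟩

/-- On the product space the Brownian motion is independent of the parameters of the copies, which
is what the intermediate limit process requires. -/
lemma isPreBrownianReal_snd [IsProbabilityMeasure P'] {Ω : Type*} [MeasurableSpace Ω]
    (P : Measure Ω)
    [IsProbabilityMeasure P] (hB : IsPreBrownianReal B P') :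
    IsPreBrownianReal (fun t (p : Ω × Ω') => B t p.2) (P.prod P') := by
  refine ⟨fun I => ?_⟩
  have h := hB.hasLaw I
  have hs : MeasurePreserving (Prod.snd : Ω × Ω' → Ω') (P.prod P') P' := measurePreserving_snd
  refine ⟨?_, ?_⟩
  · exact h.aemeasurable.comp_quasiMeasurePreserving hs.quasiMeasurePreserving
  · have hm : AEMeasurable (fun ω => I.restrict (B · ω)) ((P.prod P').map Prod.snd) := by
      rw [hs.map_eq]
      exact h.aemeasurable
    have h1 := AEMeasurable.map_map_of_aemeasurable hm hs.measurable.aemeasurable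
    rw [hs.map_eq, h.map_eq] at h1
    exact h1.symm

end BrownianMixture

/-! ### The iterated limit -/

section Iterated

variable {Ω Ω₀ : Type*} [MeasurableSpace Ω] [MeasurableSpace Ω₀] {P : Measure Ω} {P₀ : Measure Ω₀}
  {α : ℕ → Ω → ℝ} {X : ℕ → ℕ → Ω → ℕ} {lam β : ℝ}

lemma measurable_condMean {α : Ω → ℝ} (hα : Measurable α) (Z : Ω → ℕ) :
    Measurable (condMean P α Z) :=
  ((measurable_condLExp _ _ _).mono hα.comap_le le_rfl).ennreal_toReal

lemma measurable_aggregate (hα : ∀ j, Measurable (α j)) (hX : ∀ j k, Measurable (X j k))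
    (N n : ℕ) (t : ℝ≥0) : Measurable (aggregate P α X N n t) :=
  Finset.measurable_fun_sum _ fun j _ => Finset.measurable_fun_sum _ fun k _ =>
    (measurable_from_nat.comp (hX j k)).sub (measurable_condMean (hα j) _)

lemma sum_mul_aggregate_ae_eq {κ : Type*} [Fintype κ]
    (hmean : ∀ j k, ∀ᵐ ω ∂P, condMean P (α j) (X j k) ω = lam / (1 - α j ω))
    (τ : κ → ℝ≥0) (θ : κ → ℝ) (c : ℝ) (N n : ℕ) :
    ∀ᵐ ω ∂P, ∑ t, θ t * (c * (n : ℝ) ^ (-(1 / 2) : ℝ) * aggregate P α X N n (τ t) ω)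
      = ∑ j ∈ Finset.range N,
        centredSum τ (fun t => c * θ t) lam n (α j ω) (fun k => X j k ω) := by
  filter_upwards [ae_all_iff.2 fun j => ae_all_iff.2 (hmean j)] with ω hω
  simp only [aggregate, centredSum, hω, Finset.mul_sum]
  rw [Finset.sum_comm]
  refine Finset.sum_congr rfl fun j _ => Finset.sum_congr rfl fun t _ =>
    Finset.sum_congr rfl fun k _ => by ring

/-- The characteristic functions of the finite dimensional distributions of the aggregate of `N`
copies converge. -/
lemma tendsto_integral_exp_aggregate [IsProbabilityMeasure P] [IsProbabilityMeasure P₀]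
    {α₀ : Ω₀ → ℝ} {X₀ : ℕ → Ω₀ → ℕ}
    {ξ₀ : ℕ → ℕ → Ω₀ → ℕ} {ε₀ : ℕ → Ω₀ → ℕ} (hlam : 0 ≤ lam)
    (hX₀ : IsRandomizedINAR1 lam α₀ X₀ ξ₀ ε₀ P₀) (hα : ∀ j, Measurable (α j))
    (hcopy : ∀ j, IdentDistrib (fun ω => (α j ω, fun k => X j k ω))
      (fun ω => (α₀ ω, fun k => X₀ k ω)) P P₀)
    (hindep : iIndepFun (fun j ω => (α j ω, fun k => X j k ω)) P)
    {κ : Type*} [Fintype κ] (τ : κ → ℝ≥0) (θ : κ → ℝ) (N : ℕ) :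
    Tendsto (fun n : ℕ => ∫ ω, Complex.exp (Complex.I * (∑ t, θ t * ((N : ℝ) ^ (-(1 / (1 + β)))
        * (n : ℝ) ^ (-(1 / 2) : ℝ) * aggregate P α X N n (τ t) ω) : ℝ)) ∂P) atTop
      (𝓝 (∫ ω, Real.exp (-(aggregateVariance lam β α N ω * (brownianForm τ θ / 2))) ∂P : ℝ)) := by
  set c := (N : ℝ) ^ (-(1 / (1 + β))) with hc
  have hmean : ∀ j k, ∀ᵐ ω ∂P, condMean P (α j) (X j k) ω = lam / (1 - α j ω) := fun j k =>
    condMean_ae_eq hlam hX₀ (hα j) (hcopy j) k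
  -- The constant `c` is absorbed into the weights; independence of the copies then turns the
  -- characteristic function into an `N`-th power for one copy.
  have hfactor : ∀ n : ℕ, ∫ ω, Complex.exp (Complex.I * (∑ t, θ t * (c
        * (n : ℝ) ^ (-(1 / 2) : ℝ) * aggregate P α X N n (τ t) ω) : ℝ)) ∂P
      = (∫ ω, Complex.exp (Complex.I * (centredSum τ (fun t => c * θ t) lam n (α₀ ω)
        (fun k => X₀ k ω) : ℝ)) ∂P₀) ^ N := by
    intro n
    have hf : Measurable fun p : ℝ × (ℕ → ℕ) => Complex.exp
        (Complex.I * (centredSum τ (fun t => c * θ t) lam n p.1 p.2 : ℝ)) :=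
      Complex.measurable_exp.comp ((Complex.measurable_ofReal.comp
        (measurable_centredSum τ _ lam n)).const_mul _)
    rw [← integral_prod_range_eq_pow hcopy hindep hf]
    refine integral_congr_ae ?_
    filter_upwards [sum_mul_aggregate_ae_eq hmean τ θ c N n] with ω hω
    rw [hω, ← Complex.exp_sum, Complex.ofReal_sum, Finset.mul_sum]
  simp_rw [hfactor]
  have hlim := (hX₀.tendsto_integral_exp_centredSum τ (fun t => c * θ t) hlam).pow N
  have hV : ∫ ω, Real.exp (-(aggregateVariance lam β α N ω * (brownianForm τ θ / 2))) ∂P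
      = (∫ ω, Real.exp (-(longRunVariance lam (α₀ ω)
        * (brownianForm τ (fun t => c * θ t) / 2))) ∂P₀) ^ N := by
    have hsq : c ^ 2 = (N : ℝ) ^ (-(2 / (1 + β))) := by
      rw [hc, ← Real.rpow_natCast (_ ^ _), ← Real.rpow_mul (Nat.cast_nonneg N)]
      congr 1
      push_cast
      ring
    have h := integral_exp_aggregateVariance (lam := lam) (β := β)
      (fun j => (hcopy j).comp measurable_fst)
      (hindep.comp (fun _ => Prod.fst) fun _ => measurable_fst) (brownianForm τ θ / 2) N
    simp_rw [mul_comm _ (brownianForm τ θ / 2)]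
    refine h.trans ?_
    rw [brownianForm_smul, hsq]
    congr 1
    refine integral_congr_ae (ae_of_all _ fun ω => ?_)
    simp only [Function.comp_apply]
    ring_nf
  rw [hV, Complex.ofReal_pow]
  exact hlim

/-- The intermediate limit is the law of `√V_N B` on the product space. Its characteristic functions
are Laplace transforms of `V_N` at half the Brownian form, so both limits reduce to results already
established. -/
theorem iteratedLimitFDD [IsProbabilityMeasure P] [IsProbabilityMeasure P₀] {ψ : ℝ → ℝ} {ψ₁ : ℝ}
    {α₀ : Ω₀ → ℝ}
    {X₀ : ℕ → Ω₀ → ℕ} {ξ₀ : ℕ → ℕ → Ω₀ → ℕ} {ε₀ : ℕ → Ω₀ → ℕ} (hlam : 0 < lam)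
    (hβ : β ∈ Set.Ioo (-1 : ℝ) 1)
    (hX₀ : IsRandomizedINAR1 lam α₀ X₀ ξ₀ ε₀ P₀) (hα₀ : HasMixingDensity α₀ P₀ ψ β ψ₁)
    (hα : ∀ j, Measurable (α j)) (hX : ∀ j k, Measurable (X j k))
    (hcopy : ∀ j, IdentDistrib (fun ω => (α j ω, fun k => X j k ω))
      (fun ω => (α₀ ω, fun k => X₀ k ω)) P P₀)
    (hindep : iIndepFun (fun j ω => (α j ω, fun k => X j k ω)) P)
    {Ω' : Type*} [MeasurableSpace Ω'] {P' : Measure Ω'} [IsProbabilityMeasure P']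
    {Y : Ω' → ℝ} {B : ℝ≥0 → Ω' → ℝ} (hY : Measurable Y) (hBm : ∀ t, Measurable (B t))
    (hlaw : IsPositiveStableLaw ((1 + β) / 2) (stableConst lam β ψ₁) (P'.map Y))
    (hB : IsPreBrownianReal B P') (hind : IndepFun Y (fun ω t => B t ω) P') :
    IteratedLimitFDD (fun N n t ω => (N : ℝ) ^ (-(1 / (1 + β))) * (n : ℝ) ^ (-(1 / 2) : ℝ)
      * aggregate P α X N n t ω) P (fun t ω => √(Y ω) * B t ω) P' := by
  have hid : ∀ j, IdentDistrib (α j) α₀ P P₀ := fun j => (hcopy j).comp measurable_fst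
  have hindα : iIndepFun α P := hindep.comp (fun _ => Prod.fst) fun _ => measurable_fst
  have hmem : ∀ᵐ ω ∂P, ∀ j, α j ω ∈ Set.Ioo (0 : ℝ) 1 := ae_all_iff.2 fun j =>
    (hid j).symm.ae_snd measurableSet_Ioo hX₀.param_mem
  have hV := fun N => measurable_aggregateVariance (lam := lam) (β := β) hα N
  have hVp : ∀ N, Measurable fun p : Ω × Ω' => aggregateVariance lam β α N p.1 := fun N =>
    (hV N).comp measurable_fst
  have hBp : ∀ t, Measurable fun p : Ω × Ω' => B t p.2 := fun t => (hBm t).comp measurable_snd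
  have hV0 : ∀ N, ∀ᵐ p ∂P.prod P', 0 ≤ aggregateVariance lam β α N p.1 := fun N =>
    Measure.quasiMeasurePreserving_fst.ae
      (hmem.mono fun ω hω => aggregateVariance_nonneg hlam.le hω N)
  have hindp : ∀ N, IndepFun (fun p : Ω × Ω' => aggregateVariance lam β α N p.1)
      (fun p t => B t p.2) (P.prod P') := fun N =>
    indepFun_prod (hV N) (measurable_pi_lambda _ hBm)
  let R : ℕ → Ω × Ω' → ℝ≥0 → ℝ := fun N p t => √(aggregateVariance lam β α N p.1) * B t p.2
  have hR : ∀ N, Measurable (R N) := fun N =>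
    measurable_pi_lambda _ fun t => (hVp N).sqrt.mul (hBp t)
  let μ : ℕ → ProbabilityMeasure (ℝ≥0 → ℝ) := fun N =>
    ⟨(P.prod P').map (R N), Measure.isProbabilityMeasure_map (hR N).aemeasurable⟩
  have hchar : ∀ (N : ℕ) (I : Finset ℝ≥0) (θ : I → ℝ),
      ∫ f, Complex.exp (Complex.I * (∑ t : I, θ t * I.restrict f t : ℝ))
        ∂(μ N : Measure (ℝ≥0 → ℝ))
      = (∫ ω, Real.exp (-(aggregateVariance lam β α N ω
        * (brownianForm (fun t : I => (t : ℝ≥0)) θ / 2))) ∂P : ℝ) := by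
    intro N I θ
    have hm : Measurable fun f : ℝ≥0 → ℝ =>
        Complex.exp (Complex.I * (∑ t : I, θ t * I.restrict f t : ℝ)) :=
      (measurable_exp_sum θ).comp (Finset.measurable_restrict I)
    have h1 := integral_map (hR N).aemeasurable (μ := P.prod P') hm.aestronglyMeasurable
    refine h1.trans ((integral_exp_sqrt_mul_brownian (hVp N) hBp (hV0 N)
      (isPreBrownianReal_snd P hB) (hindp N) I θ).trans ?_)
    congr 1
    have h2 := integral_fun_fst (μ := P) (ν := P') (fun ω => Real.exp
      (-(aggregateVariance lam β α N ω * (brownianForm (fun t : I => (t : ℝ≥0)) θ / 2))))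
    rw [h2, probReal_univ, one_smul]
  refine ⟨μ, fun N _ I => ?_, fun I => ?_⟩
  · refine tendstoInDistribution_of_tendsto_integral_exp (fun n => ?_) ?_ fun θ => ?_
    · exact (measurable_pi_lambda _ fun t : I =>
        (measurable_aggregate hα hX N n t).const_mul _).aemeasurable
    · exact (Finset.measurable_restrict I).aemeasurable
    · rw [hchar]
      exact tendsto_integral_exp_aggregate hlam.le hX₀ hα hcopy hindep
        (fun t : I => (t : ℝ≥0)) θ N
  · refine tendstoInDistribution_of_tendsto_integral_exp (fun n => ?_) ?_ fun θ => ?_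
    · exact (Finset.measurable_restrict I).aemeasurable
    · exact (measurable_restrict_sqrt_mul hY hBm I).aemeasurable
    · simp_rw [hchar]
      have hlim := hα₀.tendsto_laplace_aggregateVariance hX₀.measurable_param hlam hβ
        hX₀.param_mem hid hindα (s := brownianForm (fun t : I => (t : ℝ≥0)) θ / 2)
        (div_nonneg (brownianForm_nonneg _ _) zero_le_two)
      simp_rw [mul_comm _ (brownianForm (fun t : I => (t : ℝ≥0)) θ / 2)]
      have h := hlaw.integral_exp_sqrt_mul_brownian hY hBm hB hind I θ
      have h2 := (Complex.continuous_ofReal.tendsto _).comp hlim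
      rw [← h] at h2
      exact h2

/-- The positive stable law exists. -/
theorem exists_isPositiveStableLaw [IsProbabilityMeasure P] [IsProbabilityMeasure P₀] {ψ : ℝ → ℝ}
    {ψ₁ : ℝ} {α₀ : Ω₀ → ℝ}
    (hlam : 0 < lam) (hβ : β ∈ Set.Ioo (-1 : ℝ) 1) (hα₀ : HasMixingDensity α₀ P₀ ψ β ψ₁)
    (hα₀m : Measurable α₀) (hα₀mem : ∀ᵐ ω ∂P₀, α₀ ω ∈ Set.Ioo (0 : ℝ) 1)
    (hα : ∀ j, Measurable (α j)) (hid : ∀ j, IdentDistrib (α j) α₀ P P₀) (hind : iIndepFun α P) :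
    ∃ ν : Measure ℝ, IsPositiveStableLaw ((1 + β) / 2) (stableConst lam β ψ₁) ν := by
  have hβ1 : 0 < (1 + β) / 2 := by linarith [hβ.1]
  have hmem : ∀ᵐ ω ∂P, ∀ j, α j ω ∈ Set.Ioo (0 : ℝ) 1 := ae_all_iff.2 fun j =>
    (hid j).symm.ae_snd measurableSet_Ioo hα₀mem
  have hV := fun N => measurable_aggregateVariance (lam := lam) (β := β) hα N
  have hprob : ∀ N, IsProbabilityMeasure (P.map (aggregateVariance lam β α N)) := fun N =>
    Measure.isProbabilityMeasure_map (hV N).aemeasurable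
  -- The rescaled variances of the given copies serve as the approximating laws, so existence needs
  -- no separate construction.
  obtain ⟨ν, hν, hν0, hνL⟩ := exists_measure_of_tendsto_laplace
    (μ := fun N => P.map (aggregateVariance lam β α N))
    (f := fun θ => Real.exp (-(stableConst lam β ψ₁ * θ ^ ((1 + β) / 2))))
    (fun N => (ae_map_iff (hV N).aemeasurable measurableSet_Ici).2
      (hmem.mono fun ω hω => aggregateVariance_nonneg hlam.le hω N))
    (fun θ hθ => by
      simp_rw [fun N => integral_map (hV N).aemeasurable (μ := P)
        (f := fun y => Real.exp (-(θ * y))) (by fun_prop)]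
      exact hα₀.tendsto_laplace_aggregateVariance hα₀m hlam hβ hα₀mem hid hind hθ)
    (by
      have h := (((Real.continuousAt_rpow_const 0 ((1 + β) / 2)
        (Or.inr hβ1.le)).tendsto.const_mul (stableConst lam β ψ₁)).neg.rexp).mono_left
        (nhdsWithin_le_nhds (s := Set.Ioi 0))
      rwa [Real.zero_rpow hβ1.ne', mul_zero, neg_zero, Real.exp_zero] at h)
  exact ⟨ν, isPositiveStableLaw_of_laplace hβ1 (stableConst_pos hlam hβ hα₀.limit_pos) hν0 hνL⟩

end Iterated

end RandomizedINAR

theorem mainTheorem4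
    (lam β ψ₁ : ℝ) (ψ : ℝ → ℝ) (hlam : 0 < lam) (hβ : β ∈ Set.Ioo (-1 : ℝ) 1)
    -- the randomized INAR(1) process with its mixing variable
    {Ω₀ : Type*} [MeasurableSpace Ω₀] (P₀ : Measure Ω₀) [IsProbabilityMeasure P₀]
    (α₀ : Ω₀ → ℝ) (X₀ : ℕ → Ω₀ → ℕ) (ξ₀ : ℕ → ℕ → Ω₀ → ℕ) (ε₀ : ℕ → Ω₀ → ℕ)
    (hX₀ : RandomizedINAR.IsRandomizedINAR1 lam α₀ X₀ ξ₀ ε₀ P₀)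
    (hα₀ : RandomizedINAR.HasMixingDensity α₀ P₀ ψ β ψ₁)
    -- its independent copies
    {Ω : Type*} [MeasurableSpace Ω] (P : Measure Ω) [IsProbabilityMeasure P]
    (α : ℕ → Ω → ℝ) (X : ℕ → ℕ → Ω → ℕ)
    (hα : ∀ j, Measurable (α j)) (hX : ∀ j k, Measurable (X j k))
    (hcopy : ∀ j, IdentDistrib (fun ω => (α j ω, fun k => X j k ω))
      (fun ω => (α₀ ω, fun k => X₀ k ω)) P P₀)
    (hindep : iIndepFun (fun j ω => (α j ω, fun k => X j k ω)) P) :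
    -- the law of the positive stable variable exists
    (∃ ν : Measure ℝ, RandomizedINAR.IsPositiveStableLaw ((1 + β) / 2)
      (RandomizedINAR.stableConst lam β ψ₁) ν) ∧
    ∀ (Ω' : Type*) [MeasurableSpace Ω'] (P' : Measure Ω') [IsProbabilityMeasure P']
      (Y : Ω' → ℝ) (B : ℝ≥0 → Ω' → ℝ),
      Measurable Y → (∀ t, Measurable (B t)) →
      RandomizedINAR.IsPositiveStableLaw ((1 + β) / 2)
        (RandomizedINAR.stableConst lam β ψ₁) (P'.map Y) →
      IsBrownianReal B P' →
      IndepFun Y (fun ω t => B t ω) P' →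
      -- the iterated limit theorem
      RandomizedINAR.IteratedLimitFDD
        (fun N n t ω => (N : ℝ) ^ (-(1 / (1 + β))) * (n : ℝ) ^ (-(1 / 2) : ℝ)
          * RandomizedINAR.aggregate P α X N n t ω) P
        (fun t ω => Real.sqrt (Y ω) * B t ω) P' ∧
      -- `Y` is stable, with the stated characteristic function
      RandomizedINAR.IsStrictlyStable ((1 + β) / 2) (P'.map Y) ∧
      (∀ θ : ℝ, ∫ ω, Complex.exp (Complex.I * (θ : ℂ) * (Y ω : ℂ)) ∂P'
        = Complex.exp (-(((RandomizedINAR.stableConst lam β ψ₁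
            * |θ| ^ ((1 + β) / 2) : ℝ) : ℂ)
            * Complex.exp (-(Complex.I
              * ((Real.sign θ * (Real.pi * (1 + β) / 4) : ℝ) : ℂ)))))) ∧
      -- the limit is a stable process with stationary increments and continuous paths from `0`
      RandomizedINAR.HasStableFDD (1 + β) (fun t ω => Real.sqrt (Y ω) * B t ω) P' ∧
      RandomizedINAR.HasStationaryIncrements (fun t ω => Real.sqrt (Y ω) * B t ω) P' ∧
      (∀ᵐ ω ∂P', Real.sqrt (Y ω) * B 0 ω = 0 ∧
        Continuous (fun t => Real.sqrt (Y ω) * B t ω)) := by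
  have hβ1 : 0 < (1 + β) / 2 := by linarith [hβ.1]
  have hα₀m := hX₀.measurable_param
  refine ⟨RandomizedINAR.exists_isPositiveStableLaw hlam hβ hα₀ hα₀m hX₀.param_mem hα
    (fun j => (hcopy j).comp measurable_fst)
    (hindep.comp (fun _ => Prod.fst) fun _ => measurable_fst), ?_⟩
  intro Ω' _ P' _ Y B hY hBm hlaw hB hind
  have hpre := hB.toIsPreBrownianReal
  refine ⟨RandomizedINAR.iteratedLimitFDD hlam hβ hX₀ hα₀ hα hX hcopy hindep hY hBm hlaw hpre hind,
    hlaw.isStrictlyStable hβ1, fun θ => ?_, ?_,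
    RandomizedINAR.hasStationaryIncrements_sqrt_mul_brownian hY hBm
      ((hlaw.ae_pos hY).mono fun _ => le_of_lt) hpre hind, ?_⟩
  · have h := hlaw.charFun_eq hβ1 θ
    rw [show Real.pi * ((1 + β) / 2) / 2 = Real.pi * (1 + β) / 4 by ring] at h
    rw [← h, charFun_apply_real, integral_map hY.aemeasurable (by fun_prop)]
    congr with ω
    ring_nf
  · have h := hlaw.hasStableFDD hβ1 hY hBm hpre hind
    rwa [mul_div_cancel₀ _ two_ne_zero] at h
  · filter_upwards [hpre.eval_zero_ae_eq_zero, hB.cont] with ω h0 hc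
    exact ⟨by rw [h0, mul_zero], continuous_const.mul hc⟩
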